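/- **Conventions.** Let $A$ be a C*-algebra, not necessarily unital. * Write $a\sim_{\mathrm{Tr}}b$ if $a-b\in\overline{[A,A]}$, the closed linear span of the commutators $xy-yx$, $x,y\in A$. * If $A$ is unital, $\mathrm U^0(A)$ is the connected component of $1$ in the unitary group of $A$; if $A$ is not unital, it is the group of unitaries of the form $1+x$, $x\in A$, in the connected component of $1$ of the unitary group of the unitization $A^\sim$. In a group, $(v,w)=vwv^{-1}w^{-1}$. * For C*-algebras $F_n$, $\prod_n F_n$ denotes the bounded sequences and $\bigoplus_n F_n$ the sequences converging to $0$ in norm. Put $A_\infty=\prod_{n}A/\bigoplus_{n}A$ and let $\iota\colon A\to A_\infty$ be the inclusion as constant sequences. * A completely positive (c.p.) map is of order zero if it preserves orthogonality ($ab=0$) of positive elements; c.p.c. means completely positive contractive. * $A$ has nuclear dimension at most $m$ if for every finite $S\subseteq A$ and $\varepsilon>0$ there are finite dimensional C*-algebras $F_0,\dots,F_m$, a c.p.c. map $\psi\colon A\to\bigoplus_i F_i$ and a c.p. map $\varphi\colon\bigoplus_i F_i\to A$ such that each $\varphi|_{F_i}$ is c.p.c. of order zero and $\|\varphi\psi(a)-a\|<\varepsilon$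 for all $a\in S$. * A *partition of unity* $e_0,\dots,e_m$ for $A$ consists of elements of $A_\infty\cap\iota(A)'$ for which there are c.p.c. order zero maps $A\xrightarrow{\psi_i}N_i\xrightarrow{\varphi_i}A_\infty$ ($i=0,\dots,m$), with $N_i=\prod_n F_{i,n}/\bigoplus_n F_{i,n}$ and all $F_{i,n}$ finite dimensional C*-algebras, such that $\iota=\sum_{i=0}^m\varphi_i\psi_i$ and $\varphi_i\psi_i(a)=e_i\,\iota(a)$ for all $a\in A$ and all $i$. * The elements $e_0,\dots,e_m$ *recursively commute* if there are a binary tree and a bijection from $\{0,\dots,m\}$ to its leaves such that, for every node with children $\lambda_0,\lambda_1$, the elements $\sum_{j\in\Lambda_0}e_j$ and $\sum_{j\in\Lambda_1}e_j$ commute, where $\Lambda_i$ is the set of (indices of) leaves under $\lambda_i$. **Theorem.** Let $m\ge 0$ and let $A$ be a C*-algebra of nuclear dimension at most $m$ that has a partition of unity $e_0,\dots,e_m$ whose elements recursively commute. Let $k\ge1$ and let $u\in\mathrm U^0(A)$ be of the form $u=e^{ih_1}e^{ih_2}\cdots e^{ih_k}$, where $h_1,\dots,h_k\in A$ are selfadjoint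 and $\sum_{j=1}^k h_j\sim_{\mathrm{Tr}}0$. Put $$M=2(m+1)k+\Big\lfloor\frac{m+1}{2}\Big\rfloor(k-1).$$ Then for every $\varepsilon>0$ there exist $v_j,w_j\in\mathrm U^0(A)$, $j=1,\dots,M$, and a selfadjoint $c\in A$ with $c\sim_{\mathrm{Tr}}0$ and $\|c\|<\varepsilon$ such that $$u=\prod_{j=1}^{M}(v_j,w_j)\cdot e^{ic}.$$ -/

import Mathlib

open scoped ENNReal Topology CStarAlgebra

universe u v w

noncomputable section

/-! ### Sequence algebras -/

/-- The closed two-sided ideal `⨁ F n` of `∏ F n` (bounded sequences): sequences whose norms tend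
to zero. -/
def c0Sum (F : ℕ → Type u) [∀ n, NonUnitalCStarAlgebra (F n)] : Submodule ℂ (lp F ∞) where
  carrier := {x | Filter.Tendsto (fun n => ‖x n‖) Filter.atTop (𝓝 0)}
  zero_mem' := by simp
  add_mem' := by
    intro x y hx hy
    refine squeeze_zero (fun _ => norm_nonneg _) (fun n => ?_) (by simpa using hx.add hy)
    exact norm_add_le (x n) (y n)
  smul_mem' := by
    intro c x hx
    have := hx.const_mul ‖c‖
    rw [mul_zero] at this
    refine this.congr fun n => ?_
    exact (norm_smul c (x n)).symm

/-- The sequence algebra `∏ F n / ⨁ F n`. -/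
def SeqAlg (F : ℕ → Type u) [∀ n, NonUnitalCStarAlgebra (F n)] : Type u := lp F ∞ ⧸ c0Sum F

namespace SeqAlg

variable {F : ℕ → Type u} [∀ n, NonUnitalCStarAlgebra (F n)]

theorem mem_c0Sum {x : lp F ∞} :
    x ∈ c0Sum F ↔ Filter.Tendsto (fun n => ‖x n‖) Filter.atTop (𝓝 0) := Iff.rfl

theorem isClosed_c0Sum : IsClosed (c0Sum F : Set (lp F ∞)) := by
  rw [← closure_subset_iff_isClosed]
  intro x hx
  rw [SetLike.mem_coe, mem_c0Sum, Metric.tendsto_atTop]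
  intro ε hε
  obtain ⟨y, hy, hxy⟩ := Metric.mem_closure_iff.1 hx (ε / 2) (half_pos hε)
  obtain ⟨N, hN⟩ := Metric.tendsto_atTop.1 (mem_c0Sum.1 hy) (ε / 2) (half_pos hε)
  refine ⟨N, fun n hn => ?_⟩
  have h1 := hN n hn
  rw [dist_zero_right, norm_norm] at h1 ⊢
  rw [dist_eq_norm] at hxy
  have h2 : ‖x n - y n‖ ≤ ‖x - y‖ := lp.norm_apply_le_norm ENNReal.top_ne_zero (x - y) n
  have h3 : ‖x n‖ ≤ ‖x n - y n‖ + ‖y n‖ := by simpa using norm_add_le (x n - y n) (y n)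
  linarith

theorem c0Sum_mul_left {x : lp F ∞} (y : lp F ∞) (hx : x ∈ c0Sum F) : y * x ∈ c0Sum F := by
  have := (mem_c0Sum.1 hx).const_mul ‖y‖
  rw [mul_zero] at this
  refine squeeze_zero (fun _ => norm_nonneg _) (fun n => ?_) this
  exact (norm_mul_le (y n) (x n)).trans (mul_le_mul_of_nonneg_right
    (lp.norm_apply_le_norm ENNReal.top_ne_zero y n) (norm_nonneg _))

theorem c0Sum_mul_right {x : lp F ∞} (y : lp F ∞) (hx : x ∈ c0Sum F) : x * y ∈ c0Sum F := by
  have := (mem_c0Sum.1 hx).mul_const ‖y‖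
  rw [zero_mul] at this
  refine squeeze_zero (fun _ => norm_nonneg _) (fun n => ?_) this
  exact (norm_mul_le (x n) (y n)).trans (mul_le_mul_of_nonneg_left
    (lp.norm_apply_le_norm ENNReal.top_ne_zero y n) (norm_nonneg _))

theorem c0Sum_star {x : lp F ∞} (hx : x ∈ c0Sum F) : star x ∈ c0Sum F :=
  (mem_c0Sum.1 hx).congr fun n => (norm_star (x n)).symm

instance : NormedAddCommGroup (SeqAlg F) :=
  @Submodule.Quotient.normedAddCommGroup _ _ _ _ _ (c0Sum F) isClosed_c0Sum

instance : NormedSpace ℂ (SeqAlg F) :=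
  inferInstanceAs (NormedSpace ℂ (lp F ∞ ⧸ c0Sum F))

instance : CompleteSpace (SeqAlg F) :=
  inferInstanceAs (CompleteSpace (lp F ∞ ⧸ c0Sum F))

/-- The quotient map `∏ F n → ∏ F n / ⨁ F n`. -/
def mk : lp F ∞ →ₗ[ℂ] SeqAlg F := (c0Sum F).mkQ

theorem mk_surjective : Function.Surjective (mk : lp F ∞ → SeqAlg F) :=
  (c0Sum F).mkQ_surjective

theorem mk_eq_mk {x y : lp F ∞} : mk x = mk y ↔ x - y ∈ c0Sum F :=
  Submodule.Quotient.eq (c0Sum F)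

theorem norm_mk_le (x : lp F ∞) : ‖mk x‖ ≤ ‖x‖ := Submodule.Quotient.norm_mk_le (S := c0Sum F) x

theorem exists_norm_lt (a : SeqAlg F) {ε : ℝ} (hε : 0 < ε) : ∃ x, mk x = a ∧ ‖x‖ < ‖a‖ + ε :=
  Submodule.Quotient.norm_mk_lt (S := c0Sum F) a hε

instance : Mul (SeqAlg F) where
  mul := Quotient.map₂ (· * ·) (by
    intro x x' hx y y' hy
    have hx' := (Submodule.quotientRel_def _).1 hx
    have hy' := (Submodule.quotientRel_def _).1 hy
    refine (Submodule.quotientRel_def _).2 ?_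
    have : x * y - x' * y' = (x - x') * y + x' * (y - y') := by
      rw [sub_mul, mul_sub]; abel
    rw [this]
    exact add_mem (c0Sum_mul_right _ hx') (c0Sum_mul_left _ hy'))

instance : Star (SeqAlg F) where
  star := Quotient.map star (by
    intro x y h
    have h' := (Submodule.quotientRel_def _).1 h
    refine (Submodule.quotientRel_def _).2 ?_
    rw [← star_sub]
    exact c0Sum_star h')

theorem mk_mul (x y : lp F ∞) : mk (x * y) = mk x * mk y := rfl

theorem mk_star (x : lp F ∞) : mk (star x) = star (mk x) := rfl

instance : NonUnitalRing (SeqAlg F) :=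
  { (inferInstance : AddCommGroup (SeqAlg F)), (inferInstance : Mul (SeqAlg F)) with
    left_distrib := by
      intro a b c
      obtain ⟨x, rfl⟩ := mk_surjective a
      obtain ⟨y, rfl⟩ := mk_surjective b
      obtain ⟨z, rfl⟩ := mk_surjective c
      change mk x * (mk y + mk z) = mk x * mk y + mk x * mk z
      rw [← map_add, ← mk_mul, ← mk_mul, ← mk_mul, ← map_add, mul_add]
    right_distrib := by
      intro a b c
      obtain ⟨x, rfl⟩ := mk_surjective a
      obtain ⟨y, rfl⟩ := mk_surjective b
      obtain ⟨z, rfl⟩ := mk_surjective c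
      change (mk x + mk y) * mk z = mk x * mk z + mk y * mk z
      rw [← map_add, ← mk_mul, ← mk_mul, ← mk_mul, ← map_add, add_mul]
    zero_mul := by
      intro a
      obtain ⟨x, rfl⟩ := mk_surjective a
      change (0 : SeqAlg F) * mk x = 0
      rw [← map_zero mk, ← mk_mul, zero_mul]
    mul_zero := by
      intro a
      obtain ⟨x, rfl⟩ := mk_surjective a
      change mk x * (0 : SeqAlg F) = 0
      rw [← map_zero mk, ← mk_mul, mul_zero]
    mul_assoc := by
      intro a b c
      obtain ⟨x, rfl⟩ := mk_surjective a
      obtain ⟨y, rfl⟩ := mk_surjective b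
      obtain ⟨z, rfl⟩ := mk_surjective c
      change mk x * mk y * mk z = mk x * (mk y * mk z)
      rw [← mk_mul, ← mk_mul, ← mk_mul, ← mk_mul, mul_assoc] }

instance : NonUnitalNormedRing (SeqAlg F) :=
  { (inferInstance : NormedAddCommGroup (SeqAlg F)),
    (inferInstance : NonUnitalRing (SeqAlg F)) with
    norm_mul_le := by
      intro a b
      have h : ∀ ε : ℝ, 0 < ε → ‖a * b‖ ≤ (‖a‖ + ε) * (‖b‖ + ε) := by
        intro ε hε
        obtain ⟨x, rfl, hx⟩ := exists_norm_lt a hε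
        obtain ⟨y, rfl, hy⟩ := exists_norm_lt b hε
        rw [← mk_mul]
        calc ‖mk (x * y)‖ ≤ ‖x * y‖ := norm_mk_le _
          _ ≤ ‖x‖ * ‖y‖ := norm_mul_le _ _
          _ ≤ _ := mul_le_mul hx.le hy.le (norm_nonneg _) ((norm_nonneg _).trans hx.le)
      have ht : Filter.Tendsto (fun ε : ℝ => (‖a‖ + ε) * (‖b‖ + ε)) (𝓝[>] 0)
          (𝓝 (‖a‖ * ‖b‖)) := by
        have : Continuous (fun ε : ℝ => (‖a‖ + ε) * (‖b‖ + ε)) := by fun_prop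
        simpa using (this.tendsto 0).mono_left nhdsWithin_le_nhds
      exact ge_of_tendsto ht (eventually_nhdsWithin_of_forall fun ε hε => h ε hε) }

instance : StarRing (SeqAlg F) where
  star_involutive := by
    intro a
    obtain ⟨x, rfl⟩ := mk_surjective a
    rw [← mk_star, ← mk_star, star_star]
  star_mul := by
    intro a b
    obtain ⟨x, rfl⟩ := mk_surjective a
    obtain ⟨y, rfl⟩ := mk_surjective b
    rw [← mk_mul, ← mk_star, ← mk_star, ← mk_star, ← mk_mul, star_mul]
  star_add := by
    intro a b
    obtain ⟨x, rfl⟩ := mk_surjective a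
    obtain ⟨y, rfl⟩ := mk_surjective b
    rw [← map_add, ← mk_star, ← mk_star, ← mk_star, ← map_add, star_add]

/-- If the entries are eventually bounded by `C`, so is the norm of the class. -/
theorem norm_mk_le_of_eventually {x : lp F ∞} {C : ℝ} (hC : 0 ≤ C)
    (h : ∀ᶠ n in Filter.atTop, ‖x n‖ ≤ C) : ‖mk x‖ ≤ C := by
  classical
  obtain ⟨N, hN⟩ := Filter.eventually_atTop.1 h
  have hy : Memℓp (fun n => if N ≤ n then x n else 0) ∞ := by
    refine memℓp_infty ⟨C, ?_⟩
    rintro _ ⟨n, rfl⟩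
    dsimp only
    split_ifs with hn
    · exact hN n hn
    · simpa using hC
  let y : lp F ∞ := ⟨_, hy⟩
  have hxy : mk x = mk y := by
    refine mk_eq_mk.2 (tendsto_const_nhds.congr' ?_)
    filter_upwards [Filter.eventually_ge_atTop N] with n hn
    change 0 = ‖x n - (if N ≤ n then x n else 0)‖
    simp [hn]
  rw [hxy]
  refine (norm_mk_le y).trans (lp.norm_le_of_forall_le hC fun n => ?_)
  change ‖if N ≤ n then x n else 0‖ ≤ C
  split_ifs with hn
  · exact hN n hn
  · simpa using hC

theorem eventually_norm_lt (x : lp F ∞) {ε : ℝ} (hε : 0 < ε) :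
    ∀ᶠ n in Filter.atTop, ‖x n‖ < ‖mk x‖ + ε := by
  obtain ⟨y, hy, hlt⟩ := exists_norm_lt (mk x) (half_pos hε)
  have h0 := mem_c0Sum.1 (mk_eq_mk.1 hy.symm)
  filter_upwards [h0.eventually (gt_mem_nhds (half_pos hε))] with n hn
  have h1 : ‖y n‖ ≤ ‖y‖ := lp.norm_apply_le_norm ENNReal.top_ne_zero y n
  have h2 : ‖x n‖ ≤ ‖x n - y n‖ + ‖y n‖ := by simpa using norm_add_le (x n - y n) (y n)
  have h3 : ‖x n - y n‖ < ε / 2 := hn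
  linarith

/-- `∏ F n / ⨁ F n` with the quotient norm is a C⋆-algebra. -/
instance : NonUnitalCStarAlgebra (SeqAlg F) where
  norm_mul_self_le := by
    intro a
    obtain ⟨x, rfl⟩ := mk_surjective a
    refine le_of_forall_pos_le_add fun ε hε => ?_
    have hnn : 0 ≤ ‖star (mk x) * mk x‖ + ε := by positivity
    have h : ‖mk x‖ ≤ Real.sqrt (‖star (mk x) * mk x‖ + ε) := by
      refine norm_mk_le_of_eventually (Real.sqrt_nonneg _) ?_
      filter_upwards [eventually_norm_lt (star x * x) hε] with n hn
      refine Real.le_sqrt_of_sq_le ?_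
      have : ‖(star x * x) n‖ = ‖x n‖ * ‖x n‖ := CStarRing.norm_star_mul_self (x := x n)
      rw [this] at hn
      rw [sq]
      exact hn.le
    calc ‖mk x‖ * ‖mk x‖
        ≤ Real.sqrt (‖star (mk x) * mk x‖ + ε) * Real.sqrt (‖star (mk x) * mk x‖ + ε) :=
          mul_le_mul h h (norm_nonneg _) (Real.sqrt_nonneg _)
      _ = _ := Real.mul_self_sqrt hnn
  smul_assoc := by
    intro c a b
    obtain ⟨x, rfl⟩ := mk_surjective a
    obtain ⟨y, rfl⟩ := mk_surjective b
    change (c • mk x) * mk y = c • (mk x * mk y)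
    rw [← map_smul, ← mk_mul, ← mk_mul, ← map_smul, smul_mul_assoc]
  smul_comm := by
    intro c a b
    obtain ⟨x, rfl⟩ := mk_surjective a
    obtain ⟨y, rfl⟩ := mk_surjective b
    change c • (mk x * mk y) = mk x * (c • mk y)
    rw [← map_smul, ← mk_mul, ← mk_mul, ← map_smul, mul_smul_comm]
  star_smul := by
    intro c a
    obtain ⟨x, rfl⟩ := mk_surjective a
    rw [← map_smul, ← mk_star, ← mk_star, ← map_smul, star_smul]

instance : PartialOrder (SeqAlg F) := CStarAlgebra.spectralOrder _

instance : StarOrderedRing (SeqAlg F) := CStarAlgebra.spectralOrderedRing _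

/-- The inclusion `ι : A → A_∞ = ∏ A / ⨁ A` as constant sequences. -/
def const {A : Type u} [NonUnitalCStarAlgebra A] (a : A) : SeqAlg (fun _ : ℕ => A) :=
  mk (⟨fun _ => a, memℓp_infty ⟨‖a‖, by rintro _ ⟨_, rfl⟩; exact le_rfl⟩⟩ : lp (fun _ : ℕ => A) ∞)

end SeqAlg

/-! ### Order zero maps, nuclear dimension, partitions of unity -/

section NuclearDimension

variable {A : Type u} {B : Type v} [NonUnitalCStarAlgebra A] [NonUnitalCStarAlgebra B]
  [PartialOrder A] [PartialOrder B] [StarOrderedRing A] [StarOrderedRing B]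

/-- A completely positive map is contractive and of order zero, i.e. preserves orthogonality of
positive elements. -/
structure IsContractiveOrderZero (φ : A →CP B) : Prop where
  contractive : ∀ a, ‖φ a‖ ≤ ‖a‖
  orderZero : ∀ a b, 0 ≤ a → 0 ≤ b → a * b = 0 → φ a * φ b = 0

end NuclearDimension

/-- The C⋆-algebra `A` has nuclear dimension at most `m`: for every finite `S ⊆ A` and `ε > 0` there
are finite dimensional C⋆-algebras `F 0, …, F m` and completely positive maps `A → ⨁ F i → A`, the
first one contractive and the second one contractive of order zero on every `F i`, whose composition
moves the elements of `S` by less than `ε`. The map into `⨁ F i` (with the maximum norm) is given by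
its components. -/
def HasNuclearDimensionLE (A : Type u) [NonUnitalCStarAlgebra A] [PartialOrder A]
    [StarOrderedRing A] (m : ℕ) : Prop :=
  ∀ (S : Finset A) (ε : ℝ), 0 < ε →
    ∃ (F : Fin (m + 1) → Type) (_ : ∀ i, NonUnitalCStarAlgebra (F i))
      (_ : ∀ i, PartialOrder (F i)) (_ : ∀ i, StarOrderedRing (F i))
      (ψ : ∀ i, A →CP F i) (φ : ∀ i, F i →CP A),
      (∀ i, FiniteDimensional ℂ (F i)) ∧
      (∀ i a, ‖ψ i a‖ ≤ ‖a‖) ∧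
      (∀ i, IsContractiveOrderZero (φ i)) ∧
      ∀ a ∈ S, ‖∑ i, φ i (ψ i a) - a‖ < ε

/-- A decomposition `ι = ∑ i, φ i ∘ ψ i` of the inclusion `ι : A → A_∞`, with `ψ i : A → N i` and
`φ i : N i → A_∞` completely positive contractive of order zero, `i = 0, …, m`, where
`N i = ∏ₙ F i n / ⨁ₙ F i n` and all `F i n` are finite dimensional C⋆-algebras. -/
structure NuclearDecomposition (A : Type u) [NonUnitalCStarAlgebra A] [PartialOrder A]
    [StarOrderedRing A] (m : ℕ) where
  F : Fin (m + 1) → ℕ → Type v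
  [cstar : ∀ i n, NonUnitalCStarAlgebra (F i n)]
  finiteDimensional : ∀ i n, FiniteDimensional ℂ (F i n)
  ψ : ∀ i, A →CP SeqAlg (F i)
  φ : ∀ i, SeqAlg (F i) →CP SeqAlg (fun _ : ℕ => A)
  ψ_orderZero : ∀ i, IsContractiveOrderZero (ψ i)
  φ_orderZero : ∀ i, IsContractiveOrderZero (φ i)
  sum_eq : ∀ a : A, ∑ i, φ i (ψ i a) = SeqAlg.const a

attribute [instance] NuclearDecomposition.cstar

/-- `e 0, …, e m ∈ A' ∩ A_∞` is a partition of unity associated to the given decomposition. -/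
structure NuclearDecomposition.IsPartitionOfUnity {A : Type u} [NonUnitalCStarAlgebra A]
    [PartialOrder A] [StarOrderedRing A] {m : ℕ} (D : NuclearDecomposition.{u, v} A m)
    (e : Fin (m + 1) → SeqAlg (fun _ : ℕ => A)) : Prop where
  commute : ∀ i (a : A), Commute (e i) (SeqAlg.const a)
  φ_ψ : ∀ i (a : A), D.φ i (D.ψ i a) = e i * SeqAlg.const a

/-! ### Recursive commutation along a binary tree -/

/-- Binary trees with leaves labelled by `α`. -/
inductive LeafTree (α : Type w) : Type w
  | leaf (a : α) : LeafTree α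
  | node (l r : LeafTree α) : LeafTree α

namespace LeafTree

variable {α : Type w} {R : Type u}

/-- The labels of the leaves, from left to right. -/
def leaves : LeafTree α → List α
  | leaf a => [a]
  | node l r => l.leaves ++ r.leaves

/-- At every node, the sum of the `e j` over the leaves `j` under the left child commutes with the
sum over the leaves under the right child. -/
def NodesCommute [NonUnitalRing R] (e : α → R) : LeafTree α → Prop
  | leaf _ => True
  | node l r => Commute (l.leaves.map e).sum (r.leaves.map e).sum ∧
      l.NodesCommute e ∧ r.NodesCommute e

end LeafTree

/-- `e 0, …, e m` recursively commute: for some binary tree whose leaves are in bijection with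
`{0, …, m}`. -/
def RecursivelyCommute {R : Type u} [NonUnitalRing R] {m : ℕ} (e : Fin (m + 1) → R) : Prop :=
  ∃ t : LeafTree (Fin (m + 1)), t.leaves.Perm (List.finRange (m + 1)) ∧ t.NodesCommute e

/-! ### The universal trace -/

/-- `a ∼_Tr b`: the difference `a - b` vanishes in `A / closure [A, A]`, where `[A, A]` is the
linear span of the commutators `x y - y x`. -/
def TrEquiv {A : Type u} [NonUnitalCStarAlgebra A] (a b : A) : Prop :=
  a - b ∈ closure (Submodule.span ℂ {c : A | ∃ x y : A, c = x * y - y * x} : Set A)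

/-! ### The connected unitary group -/

/-- `U⁰(A)`: the unitaries of the form `1 + x`, `x ∈ A`, in the connected component of the identity
of the unitary group of the unitization of `A`. If `A` has a unit, the unitization is `ℂ × A` and
this is the connected component of the identity of the unitary group of `A`:
see `UnitaryZero.equivOfUnital`. -/
def UnitaryZero (A : Type u) [NonUnitalCStarAlgebra A] : Subgroup (unitary (Unitization ℂ A)) where
  carrier := {u | u ∈ Subgroup.connectedComponentOfOne (unitary (Unitization ℂ A)) ∧
    (u : Unitization ℂ A).fst = 1}
  one_mem' := ⟨one_mem _, by simp⟩
  mul_mem' := by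
    rintro u w ⟨hu, hu'⟩ ⟨hw, hw'⟩
    exact ⟨mul_mem hu hw, by simp [hu', hw']⟩
  inv_mem' := by
    rintro u ⟨hu, hu'⟩
    refine ⟨inv_mem hu, ?_⟩
    rw [← Unitary.star_eq_inv, Unitary.coe_star, Unitization.fst_star, hu', star_one]

namespace UnitaryZero

variable {A : Type u} [NonUnitalCStarAlgebra A]

/-- A self-adjoint element of `A`, seen in the unitization. -/
def inrSelfAdjoint (h : selfAdjoint A) : selfAdjoint (Unitization ℂ A) :=
  ⟨((h : A) : Unitization ℂ A), by
    rw [selfAdjoint.mem_iff, ← Unitization.inr_star, selfAdjoint.mem_iff.1 h.2]⟩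

theorem fst_exp (x : Unitization ℂ A) :
    (NormedSpace.exp x).fst = NormedSpace.exp x.fst := by
  let +nondep : NormedAlgebra ℚ (Unitization ℂ A) := .restrictScalars ℚ ℂ _
  exact NormedSpace.map_exp (Unitization.fstHom ℂ A) Unitization.continuous_fst x

/-- The exponential `e^{ih} ∈ U⁰(A)` of a self-adjoint `h ∈ A`. -/
def expI (h : selfAdjoint A) : UnitaryZero A :=
  ⟨selfAdjoint.expUnitary (inrSelfAdjoint h), by
    refine ⟨?_, ?_⟩
    · exact pathComponent_subset_component _ (selfAdjoint.joined_one_expUnitary _)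
    · rw [selfAdjoint.expUnitary_coe, fst_exp]
      simp [inrSelfAdjoint]⟩

/-- For unital `A`, the unital ⋆-homomorphism `ℂ ⊕ A → A`, `(z, a) ↦ z 1 + a`. -/
def toUnital (A : Type u) [CStarAlgebra A] : Unitization ℂ A →⋆ₐ[ℂ] A :=
  Unitization.starLift (NonUnitalStarAlgHom.id ℂ A)

theorem toUnital_apply {A : Type u} [CStarAlgebra A] (x : Unitization ℂ A) :
    toUnital A x = algebraMap ℂ A x.fst + x.snd := by
  simp [toUnital, Unitization.starLift]

theorem continuous_toUnital (A : Type u) [CStarAlgebra A] : Continuous (toUnital A) := by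
  have : (toUnital A : Unitization ℂ A → A) = fun x => algebraMap ℂ A x.fst + x.snd :=
    funext toUnital_apply
  rw [this]
  exact ((continuous_algebraMap ℂ A).comp Unitization.continuous_fst).add
    Unitization.continuous_snd

/-- For unital `A`, the group homomorphism `u ↦ 1 + (u - 1_A)`. -/
def ofUnital (A : Type u) [CStarAlgebra A] : unitary A →* unitary (Unitization ℂ A) where
  toFun u := ⟨1 + Unitization.inr ((u : A) - 1), by
    have h1 : star (u : A) * u = 1 := Unitary.coe_star_mul_self u
    have h2 : (u : A) * star (u : A) = 1 := Unitary.coe_mul_star_self u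
    rw [Unitary.mem_iff]
    constructor <;> ext <;>
      simp [-Unitization.inr_sub, mul_sub, sub_mul, h1, h2]⟩
  map_one' := by ext <;> simp
  map_mul' u w := by
    ext
    · simp [-Unitization.inr_sub]
    · simp [-Unitization.inr_sub, mul_sub, sub_mul]

/-- For unital `A`, the group homomorphism `z + a ↦ z 1_A + a` on unitaries. -/
def mapToUnital (A : Type u) [CStarAlgebra A] : unitary (Unitization ℂ A) →* unitary A where
  toFun u := ⟨toUnital A u, Unitary.map_mem (toUnital A) u.2⟩
  map_one' := by ext; simp
  map_mul' u w := by ext; simp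

theorem continuous_mapToUnital (A : Type u) [CStarAlgebra A] : Continuous (mapToUnital A) :=
  Continuous.subtype_mk ((continuous_toUnital A).comp continuous_subtype_val) _

theorem continuous_ofUnital (A : Type u) [CStarAlgebra A] : Continuous (ofUnital A) := by
  refine Continuous.subtype_mk ?_ _
  exact continuous_const.add
    (Unitization.continuous_inr.comp (continuous_subtype_val.sub continuous_const))

/-- For unital `A`, the group `U⁰(A)` is the connected component of the identity of the unitary
group of `A`, with `1 + x` corresponding to `1_A + x`. -/
def equivOfUnital (A : Type u) [CStarAlgebra A] :
    UnitaryZero A ≃* Subgroup.connectedComponentOfOne (unitary A) where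
  toFun u := ⟨mapToUnital A u, by
    have := (continuous_mapToUnital A).image_connectedComponent_subset 1 ⟨_, u.2.1, rfl⟩
    rwa [map_one] at this⟩
  invFun u := ⟨ofUnital A u, by
    refine ⟨?_, by simp [-Unitization.inr_sub, ofUnital]⟩
    have := (continuous_ofUnital A).image_connectedComponent_subset 1 ⟨_, u.2, rfl⟩
    rwa [map_one] at this⟩
  left_inv u := by
    have := u.2.2
    ext
    · simp [-Unitization.inr_sub, ofUnital, this]
    · simp [-Unitization.inr_sub, ofUnital, mapToUnital, toUnital_apply, this]
  right_inv u := by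
    ext
    simp [-Unitization.inr_sub, ofUnital, mapToUnital, toUnital_apply]
  map_mul' u w := by
    ext
    simp

theorem equivOfUnital_expI {A : Type u} [CStarAlgebra A] (h : selfAdjoint A) :
    (equivOfUnital A (expI h) : unitary A) = selfAdjoint.expUnitary h := by
  ext
  let +nondep : NormedAlgebra ℚ (Unitization ℂ A) := .restrictScalars ℚ ℂ _
  let +nondep : NormedAlgebra ℚ A := .restrictScalars ℚ ℂ _
  refine (NormedSpace.map_exp (toUnital A) (continuous_toUnital A) _).trans ?_
  rw [map_smul, toUnital_apply]
  simp [inrSelfAdjoint]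

end UnitaryZero

end

/-!
The proof writes `u` as a product of commutators up to a small error inside the sequence algebra
`A_∞`, passes to an entry far out in the sequences, and recognises the error as an exponential
`e^{ic}` with `c` small and of trace zero.

*From `A` to finite dimensional algebras.* Write `x_{ij} = φ_i ψ_i h_j = e_i ι(h_j)`, so that
`ι(h_j) = ∑ i, x_{ij}`. As the `e_i` commute recursively and commute with `ι(A)`, the identity
`e^{x + y} = e^x e^y` for commuting `x`, `y` may be applied at every node of the tree, and
`e^{is ι(h_j)}` is the product over the leaves of the `e^{is x_{ij}}`
(`LeafTree.NodesCommute.exp_sum`, `expInr_const_eq_prod`). The relation `∼_Tr` survives the order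
zero map `ψ_i` (`IsContractiveOrderZero.universalTrace_eq_zero`): for a bounded trace `τ`, the map
`τ ∘ ψ_i` vanishes on `p q` whenever `q p = 0`, because the real and imaginary parts of `ψ_i (p q)`
are off-diagonal with respect to the orthogonal elements `ψ_i (p p*)` and `ψ_i (q* q)`. A bounded
map `σ` with this property is a trace (`map_mul_comm_of_zero_product`): cutting along the spectrum
of a self-adjoint `x` shows that `σ` kills double commutators with `x`, so the function
`t ↦ σ(e^{itx} y e^{-itx})` is affine and bounded, hence constant.

*Trace zero in finite dimensional algebras.* A self-adjoint element is a sum of a central element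
and of `b - w b w*`, where `w` is a product of two symmetries and `b` commutes with `w b w*`
(`exists_central_add_sub_conj`). On the eigenvalues this is the statement that a zero sum family is
a coboundary, with bounds, for a cyclic permutation, which is a product of two reflections
(`exists_involutions`). If the self-adjoint elements sum to zero modulo the closed span of the
commutators, then so do their central parts, and the central parts themselves sum to zero, since
averaging over the unitary group keeps central elements fixed and annihilates commutators
(`norm_le_of_central`, `mk_eq_zero_of_central`).

*Back along order zero maps.* Multiplication by the range of `φ_i` is controlled by
`φ(x) φ(y) = φ(1) φ(x y)` for commuting `x`, `y`
(`IsContractiveOrderZero.map_mul_map_of_commute`), so `φ_i` preserves commutation. A symmetry `s`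
need not go to a unitary, but a regularised version `σ` of `φ(1)⁻¹ φ(s)` is self-adjoint with
`σ² = 1` approximately on the range of `φ`, and conjugation by `e^{iπσ/2}` approximates the action
of `s` (`IsContractiveOrderZero.exists_conj_map`). Therefore, for `|s| ≤ 1`, every `e^{is x_{ij}}` is
close to one commutator times `e^{is γ_{ij}}`, where for fixed `i` the `γ_{ij}` commute and sum to
zero (`IsColumnDecomposition.norm_sub_le`, `exists_factorization`).

*Counting.* Collecting the `(m + 1) k` commutators on the left of the product over `j` and `i` leaves
the product of the `e^{is γ_{ij}}`. Interchanging the two indices costs at most `(m + 1) k` further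
commutators, and the reordered product is `1`, being a product over `i` of
`e^{is ∑ j, γ_{ij}} = 1`. So `2 (m + 1) k` commutators are enough
(`IsCommutatorProduct.prod_prod_mul`), and the remaining ones may be taken trivial.

*The error term.* All data lift to bounded sequences in `A`, and the estimates hold for the entries
at some `n`, uniformly for `s ∈ [0, 1]`, by compactness (`eventually_norm_starMap_le`). The quotient
of `∏ j, e^{is h_j}` by the commutators is then a path of unitaries near `1` whose logarithmic
derivative has constant universal trace, namely the class of `√-1 ∑ j, h_j`, which is `0`
(`HasTraceSlope`). Differentiating the
logarithm series shows that the logarithm of the end point has trace zero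
(`HasTraceSlope.tsum_eq_zero`, `exists_expI_of_norm_path`), which yields `c`.
-/

noncomputable section

/-! ### Paths of unitaries and traces of their logarithms -/

section TracePath

variable {E : Type*} [CStarAlgebra E] {V : Type*} [NormedAddCommGroup V] [NormedSpace ℂ V]

/-- A bounded differentiable path of unitaries starting at `1` whose logarithmic derivative has
constant value `τ` under the map `T`. -/
structure HasTraceSlope (T : E →L[ℂ] V) (g : ℝ → E) (τ : V) : Prop where
  mem_unitary : ∀ s, g s ∈ unitary E
  map_zero : g 0 = 1
  exists_deriv : ∃ (g' : ℝ → E) (C : ℝ), (∀ s, HasDerivAt g (g' s) s) ∧ (∀ s, ‖g' s‖ ≤ C) ∧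
    ∀ s, T (star (g s) * g' s) = τ

theorem norm_le_one_of_mem_unitary {u : E} (hu : u ∈ unitary E) : ‖u‖ ≤ 1 := by
  rcases subsingleton_or_nontrivial E with h | h
  · rw [Subsingleton.elim u 0]; simp
  · exact (CStarRing.norm_of_mem_unitary hu).le

namespace HasTraceSlope

variable {T : E →L[ℂ] V} {g k : ℝ → E} {τ σ : V}

theorem one : HasTraceSlope T (fun _ => 1) 0 :=
  ⟨fun _ => one_mem _, rfl, fun _ => 0, 0, fun s => hasDerivAt_const s _, by simp, by simp⟩

theorem mul (hT : ∀ x y, T (x * y) = T (y * x)) (hg : HasTraceSlope T g τ)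
    (hk : HasTraceSlope T k σ) : HasTraceSlope T (fun s => g s * k s) (τ + σ) := by
  obtain ⟨g', C, hg1, hg2, hg3⟩ := hg.exists_deriv
  obtain ⟨k', D, hk1, hk2, hk3⟩ := hk.exists_deriv
  refine ⟨fun s => mul_mem (hg.mem_unitary s) (hk.mem_unitary s), by simp [hg.map_zero, hk.map_zero],
    fun s => g' s * k s + g s * k' s, C + D, fun s => (hg1 s).mul (hk1 s), fun s => ?_, fun s => ?_⟩
  · refine (norm_add_le _ _).trans (add_le_add ?_ ?_)
    · refine (norm_mul_le _ _).trans ?_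
      nlinarith [norm_nonneg (g' s), norm_le_one_of_mem_unitary (hk.mem_unitary s), hg2 s]
    · refine (norm_mul_le _ _).trans ?_
      nlinarith [norm_nonneg (k' s), norm_le_one_of_mem_unitary (hg.mem_unitary s), hk2 s]
  · have hgs := (Unitary.mem_iff.1 (hg.mem_unitary s)).1
    have hks := (Unitary.mem_iff.1 (hk.mem_unitary s)).2
    have h1 : star (g s * k s) * (g' s * k s + g s * k' s) =
        star (k s) * (star (g s) * g' s * k s) + star (k s) * k' s := by
      rw [star_mul, mul_add]
      congr 1
      · simp only [mul_assoc]
      · rw [mul_assoc, ← mul_assoc (star (g s)), hgs, one_mul]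
    rw [h1, map_add, hT, mul_assoc (star (g s) * g' s), hks, mul_one, hg3, hk3]

theorem star (hT : ∀ x y, T (x * y) = T (y * x)) (hg : HasTraceSlope T g τ) :
    HasTraceSlope T (fun s => star (g s)) (-τ) := by
  obtain ⟨g', C, hg1, hg2, hg3⟩ := hg.exists_deriv
  refine ⟨fun s => Unitary.star_mem (hg.mem_unitary s), by simp [hg.map_zero],
    fun s => Star.star (g' s), C, fun s => (hg1 s).star, fun s => by simpa using hg2 s,
    fun s => ?_⟩
  have hgs := fun s => (Unitary.mem_iff.1 (hg.mem_unitary s))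
  -- differentiate the relation `star (g s) * g s = 1`
  have h1 : Star.star (g' s) * g s + Star.star (g s) * g' s = 0 := by
    have h2 := ((hg1 s).star).mul (hg1 s)
    have h3 : (fun s => Star.star (g s) * g s) = fun _ => 1 := funext fun s => (hgs s).1
    exact HasDerivAt.unique (h3 ▸ h2) (hasDerivAt_const s 1)
  rw [star_star, hT, eq_neg_of_add_eq_zero_left h1, map_neg, hg3]

theorem conj (hT : ∀ x y, T (x * y) = T (y * x)) (hg : HasTraceSlope T g τ) {w : E}
    (hw : w ∈ unitary E) : HasTraceSlope T (fun s => w * g s * Star.star w) τ := by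
  obtain ⟨g', C, hg1, hg2, hg3⟩ := hg.exists_deriv
  have hw' := Unitary.mem_iff.1 hw
  refine ⟨fun s => mul_mem (mul_mem hw (hg.mem_unitary s)) (Unitary.star_mem hw),
    by simp [hg.map_zero, hw'.2], fun s => w * g' s * Star.star w, C,
    fun s => ((hg1 s).const_mul w).mul_const _, fun s => ?_, fun s => ?_⟩
  · have h1 := norm_le_one_of_mem_unitary hw
    have h2 := norm_le_one_of_mem_unitary (Unitary.star_mem hw)
    calc ‖w * g' s * Star.star w‖ ≤ ‖w‖ * ‖g' s‖ * ‖Star.star w‖ :=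
          (norm_mul_le _ _).trans (mul_le_mul_of_nonneg_right (norm_mul_le _ _) (norm_nonneg _))
      _ ≤ 1 * ‖g' s‖ * 1 := by gcongr
      _ ≤ C := by simpa using hg2 s
  · have : Star.star (w * g s * Star.star w) * (w * g' s * Star.star w) =
        w * (Star.star (g s) * g' s * Star.star w) := by
      simp only [star_mul, star_star, mul_assoc]
      rw [← mul_assoc (Star.star w) w, hw'.1, one_mul]
    rw [this, hT, mul_assoc, hw'.1, mul_one, hg3]

theorem exp (x : selfAdjoint E) (T : E →L[ℂ] V) :
    HasTraceSlope T (fun s : ℝ => NormedSpace.exp (Complex.I • (s • (x : E))))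
      (Complex.I • T x) := by
  have hu : ∀ s : ℝ, NormedSpace.exp (Complex.I • (s • (x : E))) ∈ unitary E := fun s =>
    (selfAdjoint.expUnitary (s • x)).2
  refine ⟨hu, by rw [zero_smul, smul_zero, NormedSpace.exp_zero],
    fun s => NormedSpace.exp (Complex.I • (s • (x : E))) * (Complex.I • (x : E)), ‖(x : E)‖,
    fun s => ?_, fun s => ?_, fun s => ?_⟩
  · have := hasDerivAt_exp_smul_const (𝕂 := ℝ) (Complex.I • (x : E)) s
    rw [smul_comm s Complex.I (x : E)] at this
    refine this.congr_of_eventuallyEq (Filter.Eventually.of_forall fun t => ?_)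
    simp only [smul_comm t Complex.I (x : E)]
  · refine (norm_mul_le _ _).trans ?_
    have := norm_le_one_of_mem_unitary (hu s)
    rw [norm_smul, Complex.norm_I, one_mul]
    nlinarith [norm_nonneg (x : E)]
  · rw [← mul_assoc, (Unitary.mem_iff.1 (hu s)).1, one_mul, map_smul]

/-- If a path `g` with vanishing trace slope stays close to `1`, then the trace vanishes on the
logarithm series of the end point `g 1`: the derivative of the trace of the logarithm is the trace
of the logarithmic derivative. -/
theorem tsum_eq_zero [CompleteSpace V] (hT : ∀ x y, T (x * y) = T (y * x))
    (hg : HasTraceSlope T g 0) {η : ℝ} (hη : η < 1) (hgη : ∀ s ∈ Set.Icc (0 : ℝ) 1, ‖1 - g s‖ ≤ η) :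
    ∑' n : ℕ, T ((((n : ℂ) + 1)⁻¹) • (1 - g 1) ^ (n + 1)) = 0 := by
  obtain ⟨g', C, hg1, hg2, hg3⟩ := hg.exists_deriv
  have hη0 : 0 ≤ η := (norm_nonneg _).trans (hgη 0 (by simp))
  -- reparametrize so that the path stays in the ball for all times
  let φ : ℝ → ℝ := fun s => Real.sin s ^ 2
  have hφ : ∀ s, φ s ∈ Set.Icc (0 : ℝ) 1 := fun s => ⟨sq_nonneg _, Real.sin_sq_le_one s⟩
  have hφ' : ∀ s, HasDerivAt φ (2 * Real.sin s * Real.cos s) s := fun s => by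
    simpa [φ] using (Real.hasDerivAt_sin s).fun_pow 2
  let y : ℝ → E := fun s => 1 - g (φ s)
  let y' : ℝ → E := fun s => -((2 * Real.sin s * Real.cos s) • g' (φ s))
  have hy : ∀ s, HasDerivAt y (y' s) s := fun s =>
    ((hg1 (φ s)).scomp s (hφ' s)).const_sub 1
  have hyη : ∀ s, ‖y s‖ ≤ η := fun s => hgη _ (hφ s)
  have hC0 : 0 ≤ C := (norm_nonneg _).trans (hg2 0)
  have hy'C : ∀ s, ‖y' s‖ ≤ C := fun s => by
    have h1 : |2 * Real.sin s * Real.cos s| ≤ 1 := by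
      rw [← Real.sin_two_mul]; exact Real.abs_sin_le_one _
    calc ‖y' s‖ = |2 * Real.sin s * Real.cos s| * ‖g' (φ s)‖ := by
          simp only [y', norm_neg, norm_smul, Real.norm_eq_abs]
      _ ≤ 1 * C := mul_le_mul h1 (hg2 _) (norm_nonneg _) zero_le_one
      _ = C := one_mul C
  have hpow : ∀ s n, ‖y s ^ n * y' s‖ ≤ η ^ n * C := by
    intro s n
    induction n with
    | zero => simpa using hy'C s
    | succ n ih =>
      rw [pow_succ', mul_assoc, pow_succ' η, mul_assoc]
      exact (norm_mul_le _ _).trans (mul_le_mul (hyη s) ih (norm_nonneg _) hη0)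
  have hder : ∀ (n : ℕ) (s : ℝ), HasDerivAt (fun s => T ((((n : ℂ) + 1)⁻¹) • (y s) ^ (n + 1)))
      (T (y s ^ n * y' s)) s := by
    intro n s
    have h1 := ((hy s).fun_pow' (n + 1)).const_smul (((n : ℂ) + 1)⁻¹)
    have h2 := (T.restrictScalars ℝ).hasFDerivAt.comp_hasDerivAt s h1
    refine h2.congr_deriv ?_
    have h3 : ∀ i ∈ Finset.range (n + 1),
        T (y s ^ (Nat.pred (n + 1) - i) * y' s * y s ^ i) = T (y s ^ n * y' s) := by
      intro i hi
      have : i + (n - i) = n := by have := Finset.mem_range.1 hi; omega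
      rw [hT, ← mul_assoc, ← pow_add, Nat.pred_succ, this]
    have hn : ((n : ℂ) + 1) ≠ 0 := by exact_mod_cast n.succ_ne_zero
    simp only [ContinuousLinearMap.coe_restrictScalars', map_smul, map_sum]
    rw [Finset.sum_congr rfl h3, Finset.sum_const, Finset.card_range, ← Nat.cast_smul_eq_nsmul ℂ,
      smul_smul]
    push_cast
    rw [inv_mul_cancel₀ hn, one_smul]
  have hsum : Summable fun n : ℕ => ‖T‖ * (η ^ n * C) :=
    ((summable_geometric_of_lt_one hη0 hη).mul_right C).mul_left _
  have hy0 : y 0 = 0 := by simp [y, φ, hg.map_zero]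
  have key := fun s => hasDerivAt_tsum (𝕜 := ℝ) (y₀ := 0) hsum hder
    (fun n s => (T.le_opNorm _).trans (mul_le_mul_of_nonneg_left (hpow s n) (norm_nonneg _)))
    (by simp [hy0, summable_zero]) s
  have hzero : ∀ s, ∑' n, T (y s ^ n * y' s) = 0 := by
    intro s
    have hsm : Summable fun n => y s ^ n * y' s :=
      Summable.of_norm_bounded ((summable_geometric_of_lt_one hη0 hη).mul_right C) (hpow s)
    rw [← T.map_tsum hsm]
    -- the sum `S` satisfies `g * S = y'`
    have hS : g (φ s) * ∑' n, y s ^ n * y' s = y' s := by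
      have h1 : ∑' n, y s ^ n * y' s = y' s + y s * ∑' n, y s ^ n * y' s := by
        conv_lhs => rw [hsm.tsum_eq_zero_add]
        rw [← hsm.tsum_mul_left]
        simp [pow_succ', mul_assoc]
      have h2 : g (φ s) = 1 - y s := by simp [y]
      rw [h2, sub_mul, one_mul]
      nth_rewrite 1 [h1]
      abel
    have h4 : ∑' n, y s ^ n * y' s = Star.star (g (φ s)) * y' s := by
      rw [← hS, ← mul_assoc, (Unitary.mem_iff.1 (hg.mem_unitary _)).1, one_mul, hS]
    have h5 : Star.star (g (φ s)) * y' s =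
        -(((2 * Real.sin s * Real.cos s : ℝ) : ℂ) • (Star.star (g (φ s)) * g' (φ s))) := by
      simp only [y', mul_neg, mul_smul_comm, Complex.coe_smul]
    rw [h4, h5, map_neg, map_smul, hg3, smul_zero, neg_zero]
  have hconst := is_const_of_deriv_eq_zero (f := fun s => ∑' n : ℕ, T ((((n : ℂ) + 1)⁻¹) • (y s) ^ (n + 1)))
    (fun s => (key s).differentiableAt) (fun s => by rw [(key s).deriv, hzero]) (Real.pi / 2) 0
  have hy1 : y (Real.pi / 2) = 1 - g 1 := by simp [y, φ]
  simp only [hy0, hy1] at hconst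
  rw [hconst]
  simp

end HasTraceSlope

/-- The logarithm series of a unitary close to `1`. -/
theorem hasSum_log_unitary (u : unitary E) {r : ℝ} (hr : r < 1) (hu : ‖(1 : E) - u‖ ≤ r) :
    HasSum (fun n : ℕ => (((n : ℂ) + 1)⁻¹) • ((1 : E) - u) ^ (n + 1))
      (-(Complex.I • (Unitary.argSelfAdjoint u : E))) := by
  have hr0 : 0 ≤ r := (norm_nonneg _).trans hu
  have hsm : Summable fun n : ℕ => (((n : ℂ) + 1)⁻¹) • ((1 : E) - u) ^ (n + 1) := by
    refine Summable.of_norm_bounded (g := fun n => r ^ (n + 1)) ?_ fun n => ?_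
    · exact (summable_nat_add_iff 1).2 (summable_geometric_of_lt_one hr0 hr)
    · rw [norm_smul]
      have h1 : ‖((n : ℂ) + 1)⁻¹‖ ≤ 1 := by
        rw [norm_inv]
        refine inv_le_one_of_one_le₀ ?_
        have : ((n : ℂ) + 1) = ((n + 1 : ℕ) : ℂ) := by push_cast; rfl
        rw [this, Complex.norm_natCast]
        exact_mod_cast Nat.le_add_left 1 n
      calc _ ≤ 1 * ‖((1 : E) - u) ^ (n + 1)‖ := by gcongr
        _ ≤ r ^ (n + 1) := by
          rw [one_mul]
          exact (norm_pow_le' _ n.succ_pos).trans (pow_le_pow_left₀ (norm_nonneg _) hu _)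
  have hspec : ∀ z ∈ spectrum ℂ (u : E), ‖1 - z‖ ≤ r := by
    intro z hz
    refine (norm_apply_le_norm_cfc (fun z : ℂ => 1 - z) (u : E) hz).trans ?_
    rwa [cfc_sub .., cfc_const_one .., cfc_id' ..]
  have hslit : spectrum ℂ (u : E) ⊆ Complex.slitPlane := by
    rw [Unitary.spectrum_subset_slitPlane_iff_norm_lt_two u.2, norm_sub_rev]
    linarith
  have hcont : ContinuousOn Complex.log (spectrum ℂ (u : E)) :=
    fun z hz => (continuousAt_clog (hslit hz)).continuousWithinAt
  have hcont' : ContinuousOn Complex.arg (spectrum ℂ (u : E)) :=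
    fun z hz => (Complex.continuousAt_arg (hslit hz)).continuousWithinAt
  have hlog : Complex.I • (Unitary.argSelfAdjoint u : E) = cfc Complex.log (u : E) := by
    rw [Unitary.argSelfAdjoint_coe, ← cfc_smul ..]
    refine cfc_congr fun z hz => ?_
    have hz1 : ‖z‖ = 1 := spectrum.norm_eq_one_of_unitary u.2 hz
    exact Complex.ext (by simp [Complex.log_re, hz1]) (by simp [Complex.log_im])
  have hpart : ∀ N : ℕ, ∑ n ∈ Finset.range N, (((n : ℂ) + 1)⁻¹) • ((1 : E) - u) ^ (n + 1) =
      cfc (fun z : ℂ => ∑ n ∈ Finset.range N, (((n : ℂ) + 1)⁻¹) * (1 - z) ^ (n + 1)) (u : E) := by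
    intro N
    have h1 : (fun z : ℂ => ∑ n ∈ Finset.range N, (((n : ℂ) + 1)⁻¹) * (1 - z) ^ (n + 1)) =
        ∑ n ∈ Finset.range N, fun z : ℂ => (((n : ℂ) + 1)⁻¹) * (1 - z) ^ (n + 1) := by
      ext z; simp
    rw [h1, cfc_sum _ _ _ fun i _ => by fun_prop]
    refine Finset.sum_congr rfl fun n _ => ?_
    rw [cfc_const_mul .., cfc_pow .., cfc_sub .., cfc_const_one .., cfc_id' ..]
  rw [hsm.hasSum_iff_tendsto_nat, tendsto_iff_norm_sub_tendsto_zero]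
  refine squeeze_zero (fun _ => norm_nonneg _) (g := fun N => r ^ (N + 1) * (1 - r)⁻¹)
    (fun N => ?_) ?_
  · rw [hpart, hlog, sub_neg_eq_add, ← cfc_add ..]
    have h1r : 0 < 1 - r := by linarith
    refine norm_cfc_le (by positivity) fun z hz => ?_
    have hz := hspec z hz
    have h1 := Complex.norm_log_sub_logTaylor_le N (z := z - 1)
      (by rw [norm_sub_rev]; exact hz.trans_lt hr)
    have h2 : Complex.logTaylor (N + 1) (z - 1) =
        -∑ n ∈ Finset.range N, (((n : ℂ) + 1)⁻¹) * (1 - z) ^ (n + 1) := by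
      rw [Complex.logTaylor, Finset.sum_range_succ', ← Finset.sum_neg_distrib]
      simp only [Nat.cast_zero, div_zero, add_zero]
      refine Finset.sum_congr rfl fun n _ => ?_
      have h3 : z - 1 = (-1) * (1 - z) := by ring
      have h5 : (-1 : ℂ) ^ (n + 1 + 1 + (n + 1)) = -1 := by
        rw [show n + 1 + 1 + (n + 1) = 2 * (n + 1) + 1 by ring, pow_succ, pow_mul]
        norm_num
      rw [h3, mul_pow, ← mul_assoc, ← pow_add, h5]
      push_cast
      ring
    rw [h2, add_sub_cancel, sub_neg_eq_add, add_comm] at h1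
    refine h1.trans ?_
    rw [norm_sub_rev]
    have h4 : ‖1 - z‖ ^ (N + 1) * (1 - ‖1 - z‖)⁻¹ ≤ r ^ (N + 1) * (1 - r)⁻¹ := by
      have : 0 ≤ (1 - ‖1 - z‖)⁻¹ := inv_nonneg.2 (by linarith)
      gcongr
    refine (div_le_self ?_ (by linarith [(Nat.cast_nonneg N : (0 : ℝ) ≤ N)])).trans h4
    have : 0 < 1 - ‖1 - z‖ := by linarith
    positivity
  · have := ((tendsto_pow_atTop_nhds_zero_of_lt_one hr0 hr).comp
      (Filter.tendsto_add_atTop_nat 1)).mul_const (1 - r)⁻¹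
    simpa using this

/-- If a path with vanishing trace slope stays close to `1` then its end point is the exponential
of an element on which the trace vanishes. -/
theorem HasTraceSlope.map_argSelfAdjoint [CompleteSpace V] {T : E →L[ℂ] V}
    (hT : ∀ x y, T (x * y) = T (y * x)) {g : ℝ → E} (hg : HasTraceSlope T g 0) {η : ℝ}
    (hη : η < 1) (hgη : ∀ s ∈ Set.Icc (0 : ℝ) 1, ‖1 - g s‖ ≤ η) :
    T (Unitary.argSelfAdjoint (⟨g 1, hg.mem_unitary 1⟩ : unitary E)) = 0 := by
  have h1 := (hasSum_log_unitary (⟨g 1, hg.mem_unitary 1⟩ : unitary E) hη (hgη 1 (by simp)))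
  have h2 := T.hasSum h1
  have h3 := hg.tsum_eq_zero hT hη hgη
  have h4 := h2.tsum_eq
  rw [h3, map_neg, map_smul, eq_comm, neg_eq_zero, smul_eq_zero] at h4
  exact h4.resolve_left Complex.I_ne_zero

end TracePath

section UnitizationLog

variable {A : Type*} [NonUnitalCStarAlgebra A]

/-- The logarithm of a unitary in `1 + A` close to `1` lies in `A`. -/
theorem fst_argSelfAdjoint (u : unitary (Unitization ℂ A)) (hu : (u : Unitization ℂ A).fst = 1)
    (hu1 : ‖(1 : Unitization ℂ A) - u‖ < 1) :
    (Unitary.argSelfAdjoint u : Unitization ℂ A).fst = 0 := by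
  have h1 := hasSum_log_unitary u hu1 le_rfl
  have h2 := h1.map (Unitization.fstHom ℂ A) Unitization.continuous_fst
  have h3 : ∀ n : ℕ, ((Unitization.fstHom ℂ A) ∘ fun n : ℕ => (((n : ℂ) + 1)⁻¹) •
      ((1 : Unitization ℂ A) - u) ^ (n + 1)) n = 0 := by
    intro n
    have h4 : Unitization.fstHom ℂ A (u : Unitization ℂ A) = 1 := hu
    rw [Function.comp_apply, map_smul, map_pow, map_sub, map_one, h4, sub_self, zero_pow (by simp),
      smul_zero]
  rw [funext h3] at h2
  have h5 := h2.unique hasSum_zero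
  rw [map_neg, map_smul, neg_eq_zero, smul_eq_zero] at h5
  exact h5.resolve_left Complex.I_ne_zero

end UnitizationLog

/-! ### The universal trace -/

section UniversalTrace

variable (A : Type u) [NonUnitalCStarAlgebra A]

/-- The closed linear span of the commutators. -/
def commutatorClosure : Submodule ℂ A :=
  (Submodule.span ℂ {c : A | ∃ x y : A, c = x * y - y * x}).topologicalClosure

/-- The quotient of `A` by the closed linear span of the commutators, the range of the universal
trace. -/
def TraceQuotient : Type u := A ⧸ commutatorClosure A

theorem isClosed_commutatorClosure : IsClosed (commutatorClosure A : Set A) :=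
  Submodule.isClosed_topologicalClosure _

instance : NormedAddCommGroup (TraceQuotient A) :=
  @Submodule.Quotient.normedAddCommGroup _ _ _ _ _ (commutatorClosure A)
    (isClosed_commutatorClosure A)

instance : NormedSpace ℂ (TraceQuotient A) :=
  inferInstanceAs (NormedSpace ℂ (A ⧸ commutatorClosure A))

instance : CompleteSpace (TraceQuotient A) :=
  inferInstanceAs (CompleteSpace (A ⧸ commutatorClosure A))

/-- The universal trace. -/
def universalTrace : A →L[ℂ] TraceQuotient A where
  toLinearMap := (commutatorClosure A).mkQ
  cont := continuous_quot_mk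

variable {A}

theorem universalTrace_eq_zero_iff {a : A} : universalTrace A a = 0 ↔ a ∈ commutatorClosure A :=
  Submodule.Quotient.mk_eq_zero _

theorem trEquiv_iff {a b : A} : TrEquiv a b ↔ universalTrace A a = universalTrace A b := by
  rw [← sub_eq_zero, ← map_sub, universalTrace_eq_zero_iff]
  rfl

theorem universalTrace_mul_comm (x y : A) :
    universalTrace A (x * y) = universalTrace A (y * x) := by
  rw [← sub_eq_zero, ← map_sub, universalTrace_eq_zero_iff]
  exact Submodule.le_topologicalClosure _ (Submodule.subset_span ⟨x, y, rfl⟩)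

variable (A) in
/-- The universal trace of `A` on the unitization, vanishing at `1`. -/
def unitizationTrace : Unitization ℂ A →L[ℂ] TraceQuotient A :=
  (universalTrace A).comp ⟨Unitization.sndHom ℂ ℂ A, Unitization.continuous_snd⟩

theorem unitizationTrace_apply (x : Unitization ℂ A) :
    unitizationTrace A x = universalTrace A x.snd := rfl

theorem unitizationTrace_mul_comm (x y : Unitization ℂ A) :
    unitizationTrace A (x * y) = unitizationTrace A (y * x) := by
  simp only [unitizationTrace_apply, Unitization.snd_mul, map_add, map_smul,
    universalTrace_mul_comm x.snd y.snd]
  abel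

/-- A path of unitaries with vanishing trace slope that stays sufficiently close to `1` ends at
`e^{ic}` for a small self-adjoint `c ∼_Tr 0`. -/
theorem exists_expI_of_norm_path (ε : ℝ) (hε : 0 < ε) : ∃ η > 0, ∀ (g : ℝ → Unitization ℂ A)
    (U : UnitaryZero A), HasTraceSlope (unitizationTrace A) g 0 →
    (∀ s ∈ Set.Icc (0 : ℝ) 1, ‖1 - g s‖ ≤ η) →
    g 1 = ((U : unitary (Unitization ℂ A)) : Unitization ℂ A) →
    ∃ c : selfAdjoint A, TrEquiv (c : A) 0 ∧ ‖(c : A)‖ < ε ∧ U = UnitaryZero.expI c := by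
  have hcont : Filter.Tendsto (fun x : ℝ => Real.arccos (1 - x ^ 2 / 2)) (𝓝 0) (𝓝 0) := by
    have h1 : Continuous (fun x : ℝ => Real.arccos (1 - x ^ 2 / 2)) :=
      Real.continuous_arccos.comp (by fun_prop)
    have := h1.tendsto 0
    simpa using this
  obtain ⟨δ, hδ, hδε⟩ := Metric.eventually_nhds_iff.1 (hcont.eventually (gt_mem_nhds hε))
  refine ⟨min (δ / 2) (1 / 2), by positivity, fun g U hg hη hgU => ?_⟩
  have hη1 : min (δ / 2) (1 / 2) < 1 := (min_le_right _ _).trans_lt (by norm_num)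
  have h1 := hg.map_argSelfAdjoint unitizationTrace_mul_comm hη1 hη
  have hu : (⟨g 1, hg.mem_unitary 1⟩ : unitary (Unitization ℂ A)) = U := Subtype.ext hgU
  have hclose := hη 1 (by simp)
  rw [hgU] at hclose
  rw [hu] at h1
  have hfst := fst_argSelfAdjoint (U : unitary (Unitization ℂ A)) U.2.2 (hclose.trans_lt hη1)
  set c := Unitary.argSelfAdjoint (U : unitary (Unitization ℂ A)) with hc
  have hcinr : ((c : Unitization ℂ A).snd : Unitization ℂ A) = c := by
    ext
    · simp [hfst]
    · simp
  have hcsa : IsSelfAdjoint (c : Unitization ℂ A).snd := by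
    have := congrArg (fun x : Unitization ℂ A => x.snd) (selfAdjoint.mem_iff.1 c.2)
    rwa [Unitization.snd_star] at this
  have hclose' : ‖((U : unitary (Unitization ℂ A)) : Unitization ℂ A) - 1‖ < 2 := by
    rw [norm_sub_rev]; linarith
  refine ⟨⟨(c : Unitization ℂ A).snd, hcsa⟩, ?_, ?_, ?_⟩
  · rw [trEquiv_iff, map_zero]
    exact h1
  · have h2 : ‖(c : Unitization ℂ A).snd‖ = ‖c‖ := by
      rw [← Unitization.norm_inr (𝕜 := ℂ), hcinr]; rfl
    change ‖(c : Unitization ℂ A).snd‖ < ε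
    rw [h2, hc, Unitary.norm_argSelfAdjoint hclose']
    refine hδε ?_
    rw [dist_zero_right, norm_norm, norm_sub_rev]
    exact (hclose.trans (min_le_left _ _)).trans_lt (by linarith)
  · refine Subtype.ext ?_
    rw [← expUnitary_argSelfAdjoint hclose', ← hc]
    refine congrArg selfAdjoint.expUnitary (Subtype.ext hcinr.symm)

end UniversalTrace

/-! ### Order zero maps pull back traces to traces -/

section OffDiagonal

variable {N : Type*} [NonUnitalCStarAlgebra N]

/-- An approximate support of a self-adjoint element `a`, in the form `k * a`. -/
theorem exists_approx_support (a : N) (ha : IsSelfAdjoint a) {δ : ℝ} (hδ : 0 < δ) :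
    ∃ k : N, IsSelfAdjoint k ∧ a * k = k * a ∧ ‖a - k * a * a‖ ≤ δ ∧ ‖k * a‖ ≤ 1 := by
  have hpos : ∀ t : ℝ, t ^ 2 + δ ^ 2 ≠ 0 := fun t => by positivity
  have hc : Continuous (fun t : ℝ => t / (t ^ 2 + δ ^ 2)) := by fun_prop (disch := exact hpos _)
  refine ⟨cfcₙ (fun t : ℝ => t / (t ^ 2 + δ ^ 2)) a, cfcₙ_predicate _ a, ?_, ?_, ?_⟩
  · exact ((Commute.refl a).cfcₙ_real _).eq.symm
  · have h1 : cfcₙ (fun t : ℝ => t / (t ^ 2 + δ ^ 2)) a * a * a =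
        cfcₙ (fun t : ℝ => t / (t ^ 2 + δ ^ 2) * t * t) a := by
      rw [cfcₙ_mul .., cfcₙ_mul .., cfcₙ_id' ..]
    have h2 : a - cfcₙ (fun t : ℝ => t / (t ^ 2 + δ ^ 2) * t * t) a =
        cfcₙ (fun t : ℝ => t - t / (t ^ 2 + δ ^ 2) * t * t) a := by
      rw [cfcₙ_sub .., cfcₙ_id' ..]
    rw [h1, h2]
    refine norm_cfcₙ_le fun t _ => ?_
    have h3 : t - t / (t ^ 2 + δ ^ 2) * t * t = t * δ ^ 2 / (t ^ 2 + δ ^ 2) := by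
      field_simp [hpos t]; ring
    rw [h3, Real.norm_eq_abs, abs_div, abs_of_pos (by positivity : 0 < t ^ 2 + δ ^ 2),
      div_le_iff₀ (by positivity), abs_mul, abs_of_nonneg (sq_nonneg δ)]
    nlinarith [sq_nonneg (|t| - δ), sq_abs t, mul_pos hδ hδ, abs_nonneg t,
      mul_nonneg hδ.le (sq_nonneg (|t| - δ)), mul_nonneg hδ.le (abs_nonneg t), mul_pos hδ (mul_pos hδ hδ)]
  · have h1 : cfcₙ (fun t : ℝ => t / (t ^ 2 + δ ^ 2)) a * a =
        cfcₙ (fun t : ℝ => t / (t ^ 2 + δ ^ 2) * t) a := by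
      rw [cfcₙ_mul .., cfcₙ_id' ..]
    rw [h1]
    refine norm_cfcₙ_le fun t _ => ?_
    rw [div_mul_eq_mul_div, Real.norm_eq_abs, abs_div, ← sq, abs_of_nonneg (sq_nonneg t),
      abs_of_pos (by positivity : 0 < t ^ 2 + δ ^ 2), div_le_one (by positivity)]
    nlinarith [sq_nonneg δ]

variable [PartialOrder N] [StarOrderedRing N]
  {V : Type*} [NormedAddCommGroup V] [NormedSpace ℂ V]

/-- If `P` is self-adjoint and orthogonal to `b`, then `P z P ≤ t P a P` and `-P z P ≤ t P a P` for
all `t > 0`; let `t` tend to zero. -/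
theorem mul_mul_eq_zero_of_forall_le {a b z P : N} (hP : IsSelfAdjoint P) (hPb : b * P = 0)
    (h : ∀ t : ℝ, 0 < t → z ≤ t • a + t⁻¹ • b) (h' : ∀ t : ℝ, 0 < t → -z ≤ t • a + t⁻¹ • b) :
    P * z * P = 0 := by
  have key : ∀ y : N, (∀ t : ℝ, 0 < t → y ≤ t • a + t⁻¹ • b) → P * y * P ≤ 0 := by
    intro y hy
    have h1 : ∀ t : ℝ, 0 < t → P * y * P ≤ t • (P * a * P) := by
      intro t ht
      refine (hP.conjugate_le_conjugate (hy t ht)).trans_eq ?_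
      rw [mul_add, add_mul, mul_smul_comm, smul_mul_assoc, mul_smul_comm, smul_mul_assoc,
        mul_assoc P b P, hPb, mul_zero, smul_zero, add_zero]
    have h2 : Filter.Tendsto (fun t : ℝ => t • (P * a * P)) (𝓝[>] 0) (𝓝 0) := by
      have : Continuous (fun t : ℝ => t • (P * a * P)) := by fun_prop
      simpa using (this.tendsto 0).mono_left nhdsWithin_le_nhds
    exact ge_of_tendsto h2 (eventually_nhdsWithin_of_forall h1)
  refine le_antisymm (key z h) ?_
  have := key (-z) h'
  rwa [mul_neg, neg_mul, neg_nonpos] at this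

/-- An element dominated by `t a + t⁻¹ b` for all `t > 0`, where `a` and `b` are orthogonal, is
off-diagonal with respect to the supports of `a` and `b`, hence it is killed by traces. -/
theorem trace_eq_zero_of_forall_le (τ : N →L[ℂ] V) (hτ : ∀ x y, τ (x * y) = τ (y * x))
    {a b z : N} (ha : 0 ≤ a) (hb : 0 ≤ b) (hab : a * b = 0)
    (h : ∀ t : ℝ, 0 < t → z ≤ t • a + t⁻¹ • b) (h' : ∀ t : ℝ, 0 < t → -z ≤ t • a + t⁻¹ • b) :
    τ z = 0 := by
  have hasa : IsSelfAdjoint a := .of_nonneg ha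
  have hbsa : IsSelfAdjoint b := .of_nonneg hb
  have hba : b * a = 0 := by
    have := congrArg star hab
    rwa [star_mul, hasa.star_eq, hbsa.star_eq, star_zero] at this
  have hzs : 0 ≤ z + (a + b) := by
    have := h' 1 one_pos
    simp only [one_smul, inv_one] at this
    rwa [neg_le_iff_add_nonneg'] at this
  have hzs' : z + (a + b) ≤ (2 : ℝ) • (a + b) := by
    have := h 1 one_pos
    simp only [one_smul, inv_one] at this
    rw [two_smul]
    exact add_le_add_left this _
  have hzsa : IsSelfAdjoint z := by
    have h1 : IsSelfAdjoint (z + (a + b)) := .of_nonneg hzs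
    simpa using h1.sub (hasa.add hbsa)
  obtain ⟨y, hy⟩ := CStarAlgebra.nonneg_iff_eq_star_mul_self.1 hzs
  -- a bound for `τ z` which tends to zero with `δ`
  have key : ∀ δ : ℝ, 0 < δ → ‖τ z‖ ≤ ‖τ‖ * (3 * (‖y‖ * √(12 * δ) + 2 * δ)) := by
    intro δ hδ
    obtain ⟨k, hk, hka, hk1, hk2⟩ := exists_approx_support a hasa hδ
    obtain ⟨l, hl, hlb, hl1, hl2⟩ := exists_approx_support b hbsa hδ
    have hP : IsSelfAdjoint (k * a) := by
      rw [IsSelfAdjoint, star_mul, hasa.star_eq, hk.star_eq, hka]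
    have hQ : IsSelfAdjoint (l * b) := by
      rw [IsSelfAdjoint, star_mul, hbsa.star_eq, hl.star_eq, hlb]
    have hPb : b * (k * a) = 0 := by rw [← hka, ← mul_assoc, hba, zero_mul]
    have hQa : a * (l * b) = 0 := by rw [← hlb, ← mul_assoc, hab, zero_mul]
    have hPQ : k * a * (l * b) = 0 := by rw [mul_assoc, hQa, mul_zero]
    have hQP : l * b * (k * a) = 0 := by rw [mul_assoc, hPb, mul_zero]
    have hPzP := mul_mul_eq_zero_of_forall_le hP hPb h h'
    have hQzQ : (l * b) * z * (l * b) = 0 := by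
      refine mul_mul_eq_zero_of_forall_le (a := b) (b := a) hQ hQa (fun t ht => ?_) (fun t ht => ?_)
      · simpa [add_comm] using h t⁻¹ (inv_pos.2 ht)
      · simpa [add_comm] using h' t⁻¹ (inv_pos.2 ht)
    set P := k * a with hPdef
    set Q := l * b with hQdef
    have hu : IsSelfAdjoint (P + Q) := hP.add hQ
    have hu2 : ‖P + Q‖ ≤ 2 := (norm_add_le _ _).trans (by linarith)
    have hτu : τ ((P + Q) * z * (P + Q)) = 0 := by
      have h1 : (P + Q) * z * (P + Q) = P * z * P + P * z * Q + Q * z * P + Q * z * Q := by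
        noncomm_ring
      have h2 : τ (P * z * Q) = 0 := by
        rw [hτ, ← mul_assoc, hQP, zero_mul, map_zero]
      have h3 : τ (Q * z * P) = 0 := by
        rw [hτ, ← mul_assoc, hPQ, zero_mul, map_zero]
      rw [h1, map_add, map_add, map_add, h2, h3, hPzP, hQzQ]
      simp
    have hs : ‖(a + b) - (P + Q) * (a + b)‖ ≤ 2 * δ := by
      have h1 : (a + b) - (P + Q) * (a + b) = (a - k * a * a) + (b - l * b * b) := by
        have h2 : P * b = 0 := by rw [hPdef, mul_assoc, hab, mul_zero]
        have h3 : Q * a = 0 := by rw [hQdef, mul_assoc, hba, mul_zero]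
        rw [add_mul, mul_add, mul_add, h2, h3]
        abel
      rw [h1]
      exact (norm_add_le _ _).trans (by linarith)
    have hs' : ‖(a + b) - (a + b) * (P + Q)‖ ≤ 2 * δ := by
      have h1 : (a + b) - (a + b) * (P + Q) = star ((a + b) - (P + Q) * (a + b)) := by
        rw [star_sub, star_mul, hu.star_eq, (hasa.add hbsa).star_eq]
      rw [h1, norm_star]
      exact hs
    have hconj : ∀ c w : N, star (c - c * w) * (c - c * w) =
        star c * c - star c * c * w - star w * (star c * c) + star w * (star c * c) * w := by
      intro c w
      rw [star_sub, star_mul]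
      noncomm_ring
    have hyu : ‖y - y * (P + Q)‖ ^ 2 ≤ 12 * δ := by
      rw [sq, ← CStarRing.norm_star_mul_self, hconj, ← hy, hu.star_eq]
      -- conjugation by `1 - u` is monotone
      have h1 : (z + (a + b)) - (z + (a + b)) * (P + Q) - (P + Q) * (z + (a + b)) +
          (P + Q) * (z + (a + b)) * (P + Q) ≤ (2 : ℝ) • ((a + b) - (a + b) * (P + Q) -
          (P + Q) * (a + b) + (P + Q) * (a + b) * (P + Q)) := by
        obtain ⟨c, hc⟩ := CStarAlgebra.nonneg_iff_eq_star_mul_self.1 (sub_nonneg.2 hzs')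
        have h2 := star_mul_self_nonneg (c - c * (P + Q))
        rw [hconj, ← hc, hu.star_eq] at h2
        rw [← sub_nonneg]
        refine h2.trans_eq ?_
        rw [two_smul, two_smul]
        noncomm_ring
      have h0 : 0 ≤ (z + (a + b)) - (z + (a + b)) * (P + Q) - (P + Q) * (z + (a + b)) +
          (P + Q) * (z + (a + b)) * (P + Q) := by
        have h2 := star_mul_self_nonneg (y - y * (P + Q))
        rwa [hconj, ← hy, hu.star_eq] at h2
      refine (CStarAlgebra.norm_le_norm_of_nonneg_of_le h0 h1).trans ?_
      have h3 : (a + b) - (a + b) * (P + Q) - (P + Q) * (a + b) + (P + Q) * (a + b) * (P + Q) =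
          ((a + b) - (P + Q) * (a + b)) - ((a + b) - (P + Q) * (a + b)) * (P + Q) := by
        noncomm_ring
      rw [h3, norm_smul, Real.norm_two]
      have h4 : ‖((a + b) - (P + Q) * (a + b)) * (P + Q)‖ ≤ (2 * δ) * 2 :=
        (norm_mul_le _ _).trans (mul_le_mul hs hu2 (norm_nonneg _) (by positivity))
      have h5 := norm_sub_le ((a + b) - (P + Q) * (a + b))
        (((a + b) - (P + Q) * (a + b)) * (P + Q))
      linarith
    have hzu : ‖z - z * (P + Q)‖ ≤ ‖y‖ * √(12 * δ) + 2 * δ := by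
      have h1 : z - z * (P + Q) = star y * (y - y * (P + Q)) -
          ((a + b) - (a + b) * (P + Q)) := by
        rw [mul_sub, ← mul_assoc, ← hy]
        noncomm_ring
      rw [h1]
      refine (norm_sub_le _ _).trans (add_le_add ?_ hs')
      refine (norm_mul_le _ _).trans ?_
      rw [norm_star]
      exact mul_le_mul_of_nonneg_left (Real.le_sqrt_of_sq_le hyu) (norm_nonneg _)
    have huz : ‖z - (P + Q) * z‖ ≤ ‖y‖ * √(12 * δ) + 2 * δ := by
      have h1 : z - (P + Q) * z = star (z - z * (P + Q)) := by
        rw [star_sub, star_mul, hu.star_eq, hzsa.star_eq]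
      rw [h1, norm_star]
      exact hzu
    have hfin : τ z = τ ((z - z * (P + Q)) + (z - (P + Q) * z) * (P + Q)) := by
      have h1 : z = ((z - z * (P + Q)) + (z - (P + Q) * z) * (P + Q)) + (P + Q) * z * (P + Q) := by
        noncomm_ring
      conv_lhs => rw [h1, map_add, hτu, add_zero]
    rw [hfin]
    refine (τ.le_opNorm _).trans (mul_le_mul_of_nonneg_left ?_ (norm_nonneg _))
    refine (norm_add_le _ _).trans ?_
    have h6 : ‖(z - (P + Q) * z) * (P + Q)‖ ≤ (‖y‖ * √(12 * δ) + 2 * δ) * 2 :=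
      (norm_mul_le _ _).trans (mul_le_mul huz hu2 (norm_nonneg _) (by positivity))
    linarith
  have hlim : Filter.Tendsto (fun δ : ℝ => ‖τ‖ * (3 * (‖y‖ * √(12 * δ) + 2 * δ))) (𝓝[>] 0) (𝓝 0) := by
    have : Continuous (fun δ : ℝ => ‖τ‖ * (3 * (‖y‖ * √(12 * δ) + 2 * δ))) := by fun_prop
    simpa using (this.tendsto 0).mono_left nhdsWithin_le_nhds
  exact norm_le_zero_iff.1 (ge_of_tendsto hlim (eventually_nhdsWithin_of_forall key))

end OffDiagonal

section ZeroProduct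

variable {A : Type*} [NonUnitalCStarAlgebra A] {V : Type*} [NormedAddCommGroup V] [NormedSpace ℂ V]

/-- The tent function of width `δ` around `c`, written as a difference of two ramps. -/
def tent (δ c t : ℝ) : ℝ :=
  max 0 (min 1 ((t - c) / δ + 1)) - max 0 (min 1 ((t - c) / δ))

/-- A cutoff function around `c`, equal to `1` on the support of `tent δ c`. -/
def tentCutoff (δ c t : ℝ) : ℝ := max 0 (min 1 (2 - |(t - c) / δ|))

@[fun_prop]
theorem continuous_tent (δ c : ℝ) : Continuous (tent δ c) := by unfold tent; fun_prop

@[fun_prop]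
theorem continuous_tentCutoff (δ c : ℝ) : Continuous (tentCutoff δ c) := by
  unfold tentCutoff; fun_prop

theorem abs_tent_le_one (δ c t : ℝ) : |tent δ c t| ≤ 1 := by
  unfold tent
  rw [abs_le]
  constructor <;> linarith [le_max_left 0 (min 1 ((t - c) / δ)),
    le_max_left 0 (min 1 ((t - c) / δ + 1)), max_le zero_le_one (min_le_left 1 ((t - c) / δ)),
    max_le zero_le_one (min_le_left 1 ((t - c) / δ + 1))]

theorem abs_tentCutoff_le_one (δ c t : ℝ) : |tentCutoff δ c t| ≤ 1 := by
  unfold tentCutoff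
  rw [abs_of_nonneg (le_max_left _ _)]
  exact max_le zero_le_one (min_le_left _ _)

theorem tent_eq_zero {δ c t : ℝ} (h : 1 ≤ |(t - c) / δ|) : tent δ c t = 0 := by
  unfold tent
  rcases le_abs.1 h with h | h
  · rw [min_eq_left h, min_eq_left (by linarith)]; simp
  · rw [min_eq_right (by linarith), min_eq_right (by linarith), max_eq_left (by linarith),
      max_eq_left (by linarith), sub_zero]

theorem tentCutoff_eq_zero {δ c t : ℝ} (h : 2 ≤ |(t - c) / δ|) : tentCutoff δ c t = 0 := by
  unfold tentCutoff
  rw [min_eq_right (by linarith), max_eq_left (by linarith)]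

theorem tent_mul_one_sub_tentCutoff (δ c t : ℝ) : (1 - tentCutoff δ c t) * tent δ c t = 0 := by
  by_cases h : 1 ≤ |(t - c) / δ|
  · rw [tent_eq_zero h, mul_zero]
  · push Not at h
    unfold tentCutoff
    rw [min_eq_left (by linarith), max_eq_right zero_le_one, sub_self, zero_mul]

theorem abs_tent_mul_pow_le {δ : ℝ} (hδ : 0 < δ) (c t : ℝ) (n : ℕ) :
    |tent δ c t * (t - c) ^ n| ≤ δ ^ n := by
  by_cases h : 1 ≤ |(t - c) / δ|
  · rw [tent_eq_zero h, zero_mul, abs_zero]; positivity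
  · push Not at h
    rw [abs_div, abs_of_pos hδ, div_lt_one hδ] at h
    rw [abs_mul, abs_pow]
    calc _ ≤ 1 * δ ^ n := mul_le_mul (abs_tent_le_one _ _ _)
          (pow_le_pow_left₀ (abs_nonneg _) h.le _) (by positivity) zero_le_one
      _ = _ := one_mul _

theorem abs_tentCutoff_mul_pow_le {δ : ℝ} (hδ : 0 < δ) (c t : ℝ) (n : ℕ) :
    |(t - c) ^ n * tentCutoff δ c t| ≤ (2 * δ) ^ n := by
  by_cases h : 2 ≤ |(t - c) / δ|
  · rw [tentCutoff_eq_zero h, mul_zero, abs_zero]; positivity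
  · push Not at h
    rw [abs_div, abs_of_pos hδ, div_lt_iff₀ hδ] at h
    rw [abs_mul, abs_pow]
    calc _ ≤ (2 * δ) ^ n * 1 := mul_le_mul (pow_le_pow_left₀ (abs_nonneg _) h.le _)
          (abs_tentCutoff_le_one _ _ _) (by positivity) (by positivity)
      _ = _ := mul_one _

theorem sum_tent {δ R t : ℝ} (hδ : 0 < δ) {n : ℕ} (hn : n * δ = 2 * R) (ht : |t| ≤ R) :
    ∑ i ∈ Finset.range (n + 1), tent δ (-R + i * δ) t = 1 := by
  have h1 : ∀ i : ℕ, tent δ (-R + i * δ) t =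
      max 0 (min 1 ((t + R) / δ - i + 1)) - max 0 (min 1 ((t + R) / δ - (i + 1 : ℕ) + 1)) := by
    intro i
    have : (t - (-R + i * δ)) / δ = (t + R) / δ - i := by field_simp; ring
    unfold tent
    rw [this]
    push_cast
    congr 3
    ring
  rw [Finset.sum_congr rfl fun i _ => h1 i, Finset.sum_range_sub']
  have h2 : 0 ≤ (t + R) / δ := div_nonneg (by linarith [(abs_le.1 ht).1]) hδ.le
  have h3 : (t + R) / δ ≤ n := by rw [div_le_iff₀ hδ]; linarith [(abs_le.1 ht).2]
  rw [min_eq_left (by simpa using h2), min_eq_right (a := 1) (by push_cast; linarith),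
    max_eq_right zero_le_one, max_eq_left (by push_cast; linarith), sub_zero]

variable (σ : A →L[ℂ] V) (hσ : ∀ p q : A, q * p = 0 → σ (p * q) = 0)

theorem inr_snd_mul_inr (g : Unitization ℂ A) (y : A) : ((g * (y : Unitization ℂ A)).snd :
    Unitization ℂ A) = g * y := by
  ext <;> simp

theorem inr_snd_inr_mul (g : Unitization ℂ A) (y : A) : (((y : Unitization ℂ A) * g).snd :
    Unitization ℂ A) = y * g := by
  ext <;> simp

include hσ in
theorem map_snd_mul_eq_zero {g k : Unitization ℂ A} (hkg : k * g = 0) (y₁ y₂ : A) :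
    σ (g * ((y₁ : Unitization ℂ A) * y₂) * k).snd = 0 := by
  have h1 : g * ((y₁ : Unitization ℂ A) * y₂) * k =
      (((g * (y₁ : Unitization ℂ A)).snd * ((y₂ : Unitization ℂ A) * k).snd : A) :
        Unitization ℂ A) := by
    rw [Unitization.inr_mul, inr_snd_mul_inr, inr_snd_inr_mul]
    simp only [mul_assoc]
  rw [h1, Unitization.snd_inr]
  refine hσ _ _ (Unitization.inr_injective (R := ℂ) ?_)
  rw [Unitization.inr_mul, inr_snd_mul_inr, inr_snd_inr_mul, Unitization.inr_zero,
    mul_assoc, ← mul_assoc k, hkg, zero_mul, mul_zero]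

theorem unitization_snd_sub (x y : Unitization ℂ A) : (x - y).snd = x.snd - y.snd :=
  map_sub (Unitization.sndHom ℂ ℂ A) x y

theorem norm_snd_le_of_fst_eq_zero {x : Unitization ℂ A} (hx : x.fst = 0) : ‖x.snd‖ = ‖x‖ := by
  have : ((x.snd : A) : Unitization ℂ A) = x := by ext <;> simp [hx]
  rw [← Unitization.norm_inr (𝕜 := ℂ), this]

set_option maxHeartbeats 1000000 in
/-- Cut `y` into pieces along the spectrum of `x` at scale `δ`. The far off-diagonal pieces do not
contribute, the near diagonal ones are `O(1/δ)` many of size `O(δ ^ 2)`. -/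
theorem map_double_commutator_le {x : Unitization ℂ A} (hx : IsSelfAdjoint x) (y₁ y₂ : A)
    (hσ : ∀ p q : A, q * p = 0 → σ (p * q) = 0) {R : ℝ} (hR : 0 < R) (hxR : ‖x‖ ≤ R) (n : ℕ)
    (hn : 0 < n) :
    ‖σ (x * x * ((y₁ : Unitization ℂ A) * y₂) - 2 * (x * ((y₁ : Unitization ℂ A) * y₂) * x) +
      ((y₁ : Unitization ℂ A) * y₂) * (x * x)).snd‖ ≤
    (n + 1) * (‖σ‖ * (9 * (2 * R / n) ^ 2 * ‖(y₁ : Unitization ℂ A) * y₂‖)) := by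
  set Y := (y₁ : Unitization ℂ A) * y₂ with hY
  set δ := 2 * R / n with hδdef
  have hn' : (0 : ℝ) < n := by exact_mod_cast hn
  have hδ : 0 < δ := by positivity
  have hnδ : n * δ = 2 * R := by rw [hδdef]; field_simp
  let c : ℕ → ℝ := fun i => -R + i * δ
  let g : ℕ → Unitization ℂ A := fun i => cfc (tent δ (c i)) x
  let G : ℕ → Unitization ℂ A := fun i => cfc (tentCutoff δ (c i)) x
  let X : ℕ → Unitization ℂ A := fun i => cfc (fun t : ℝ => t - c i) x
  have hX : ∀ i, X i = x - algebraMap ℝ _ (c i) := fun i => by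
    simp only [X]
    rw [cfc_sub .., cfc_id' .., cfc_const ..]
  have hsum : ∑ i ∈ Finset.range (n + 1), g i = 1 := by
    have h1 : ∑ i ∈ Finset.range (n + 1), g i =
        cfc (∑ i ∈ Finset.range (n + 1), tent δ (c i)) x :=
      (cfc_sum _ _ _ fun i _ => (continuous_tent δ (c i)).continuousOn).symm
    rw [h1, ← cfc_const_one ℝ x]
    refine cfc_congr fun t ht => ?_
    rw [Finset.sum_apply]
    refine sum_tent hδ hnδ ?_
    rcases subsingleton_or_nontrivial (Unitization ℂ A) with h | h
    · simp [spectrum.of_subsingleton] at ht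
    · exact (spectrum.norm_le_norm_of_mem ht).trans hxR
  have hD : ∀ i, x * x * Y - 2 * (x * Y * x) + Y * (x * x) =
      X i ^ 2 * Y - 2 * (X i * Y * X i) + Y * X i ^ 2 := by
    intro i
    have hc : ∀ z : Unitization ℂ A, z * algebraMap ℝ _ (c i) = algebraMap ℝ _ (c i) * z :=
      fun z => (Algebra.commutes _ _).symm
    rw [hX, sq]
    generalize algebraMap ℝ (Unitization ℂ A) (c i) = w at hc
    have h1 := hc x
    have h2 := hc Y
    have e1 : (x - w) * (x - w) * Y - 2 * ((x - w) * Y * (x - w)) + Y * ((x - w) * (x - w)) =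
      x * x * Y - 2 * (x * Y * x) + Y * (x * x) - (x * w * Y + w * x * Y - w * w * Y) +
        2 * (x * (Y * w) + w * Y * x - w * (Y * w)) - (Y * (x * w) + (Y * w) * x - (Y * w) * w) := by
      noncomm_ring
    rw [e1, h2, h1, ← mul_assoc Y w x, h2, mul_assoc w Y w, h2, ← mul_assoc x w Y, h1]
    noncomm_ring
  have hXpow : ∀ i m, X i ^ m = cfc (fun t : ℝ => (t - c i) ^ m) x := fun i m => by
    rw [cfc_pow ..]
  have hgX : ∀ i m, ‖g i * X i ^ m‖ ≤ δ ^ m := fun i m => by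
    rw [hXpow, ← cfc_mul (tent δ (c i)) (fun t : ℝ => (t - c i) ^ m) x
      (continuous_tent _ _).continuousOn (Continuous.continuousOn (by fun_prop))]
    exact norm_cfc_le (by positivity) fun t _ => abs_tent_mul_pow_le hδ _ _ _
  have hGX : ∀ i m, ‖X i ^ m * G i‖ ≤ (2 * δ) ^ m := fun i m => by
    rw [hXpow, ← cfc_mul (fun t : ℝ => (t - c i) ^ m) (tentCutoff δ (c i)) x
      (Continuous.continuousOn (by fun_prop)) (continuous_tentCutoff _ _).continuousOn]
    exact norm_cfc_le (by positivity) fun t _ => abs_tentCutoff_mul_pow_le hδ _ _ _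
  have hzero : ∀ i a b, X i ^ b * (1 - G i) * (g i * X i ^ a) = 0 := by
    intro i a b
    have h1 : (1 - G i) * g i = 0 := by
      have hcG := (continuous_tentCutoff δ (c i)).continuousOn (s := spectrum ℝ x)
      have hcg := (continuous_tent δ (c i)).continuousOn (s := spectrum ℝ x)
      rw [← cfc_const_one ℝ x, ← cfc_sub _ _ x continuousOn_const hcG,
        ← cfc_mul (fun t => 1 - tentCutoff δ (c i) t) _ x (continuousOn_const.sub hcG) hcg]
      refine (cfc_congr fun t _ => tent_mul_one_sub_tentCutoff δ (c i) t).trans ?_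
      exact cfc_const_zero ..
    rw [mul_assoc, ← mul_assoc (1 - G i), h1, zero_mul, mul_zero]
  have hterm : ∀ i, ‖σ (g i * (x * x * Y - 2 * (x * Y * x) + Y * (x * x))).snd‖ ≤
      ‖σ‖ * (9 * δ ^ 2 * ‖Y‖) := by
    intro i
    rw [hD i]
    have hfar : σ (g i * (X i ^ 2 * Y - 2 * (X i * Y * X i) + Y * X i ^ 2) * (1 - G i)).snd = 0 := by
      have h1 : g i * (X i ^ 2 * Y - 2 * (X i * Y * X i) + Y * X i ^ 2) * (1 - G i) =
          g i * X i ^ 2 * Y * (X i ^ 0 * (1 - G i)) - (g i * X i ^ 1 * Y * (X i ^ 1 * (1 - G i)) +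
          g i * X i ^ 1 * Y * (X i ^ 1 * (1 - G i))) +
          g i * X i ^ 0 * Y * (X i ^ 2 * (1 - G i)) := by noncomm_ring
      have h2 : ∀ a b, σ (g i * X i ^ a * Y * (X i ^ b * (1 - G i))).snd = 0 := fun a b =>
        map_snd_mul_eq_zero σ hσ (hzero i a b) y₁ y₂
      rw [h1, Unitization.snd_add, unitization_snd_sub, Unitization.snd_add, map_add, map_sub,
        map_add, h2, h2, h2]
      simp
    have hsplit : g i * (X i ^ 2 * Y - 2 * (X i * Y * X i) + Y * X i ^ 2) =
        g i * (X i ^ 2 * Y - 2 * (X i * Y * X i) + Y * X i ^ 2) * G i +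
        g i * (X i ^ 2 * Y - 2 * (X i * Y * X i) + Y * X i ^ 2) * (1 - G i) := by noncomm_ring
    rw [hsplit, Unitization.snd_add, map_add, hfar, add_zero]
    refine (σ.le_opNorm _).trans (mul_le_mul_of_nonneg_left ?_ (norm_nonneg _))
    have hY0 : Unitization.fstHom ℂ A Y = 0 := by
      rw [hY, map_mul]
      exact mul_eq_zero_of_left (Unitization.fst_inr ℂ y₁) _
    have hfst : Unitization.fstHom ℂ A
        (g i * (X i ^ 2 * Y - 2 * (X i * Y * X i) + Y * X i ^ 2) * G i) = 0 := by
      simp only [map_mul, map_add, map_sub, hY0, mul_zero, zero_mul, sub_zero, add_zero]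
    rw [norm_snd_le_of_fst_eq_zero hfst]
    have h3 : g i * (X i ^ 2 * Y - 2 * (X i * Y * X i) + Y * X i ^ 2) * G i =
        g i * X i ^ 2 * Y * (X i ^ 0 * G i) - (g i * X i ^ 1 * Y * (X i ^ 1 * G i) +
          g i * X i ^ 1 * Y * (X i ^ 1 * G i)) +
          g i * X i ^ 0 * Y * (X i ^ 2 * G i) := by noncomm_ring
    have h4 : ∀ a b, ‖g i * X i ^ a * Y * (X i ^ b * G i)‖ ≤ δ ^ a * ‖Y‖ * (2 * δ) ^ b := by
      intro a b
      refine (norm_mul_le _ _).trans (mul_le_mul ?_ (hGX i b) (norm_nonneg _) (by positivity))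
      exact (norm_mul_le _ _).trans (mul_le_mul_of_nonneg_right (hgX i a) (norm_nonneg _))
    rw [h3]
    refine (norm_add_le _ _).trans ?_
    have h5 := norm_sub_le (g i * X i ^ 2 * Y * (X i ^ 0 * G i))
      (g i * X i ^ 1 * Y * (X i ^ 1 * G i) + g i * X i ^ 1 * Y * (X i ^ 1 * G i))
    have h6 := norm_add_le (g i * X i ^ 1 * Y * (X i ^ 1 * G i))
      (g i * X i ^ 1 * Y * (X i ^ 1 * G i))
    have h7 := h4 2 0
    have h8 := h4 1 1
    have h9 := h4 0 2
    simp only [pow_zero, pow_one, mul_one, one_mul] at h5 h6 h7 h8 h9 ⊢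
    nlinarith
  have hall : x * x * Y - 2 * (x * Y * x) + Y * (x * x) =
      ∑ i ∈ Finset.range (n + 1), g i * (x * x * Y - 2 * (x * Y * x) + Y * (x * x)) := by
    rw [← Finset.sum_mul, hsum, one_mul]
  rw [hall]
  have hsnd : (∑ i ∈ Finset.range (n + 1), g i * (x * x * Y - 2 * (x * Y * x) + Y * (x * x))).snd =
      ∑ i ∈ Finset.range (n + 1), (g i * (x * x * Y - 2 * (x * Y * x) + Y * (x * x))).snd :=
    map_sum (Unitization.sndHom ℂ ℂ A) _ _
  rw [hsnd, map_sum]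
  refine (norm_sum_le _ _).trans ((Finset.sum_le_sum fun i _ => hterm i).trans_eq ?_)
  rw [Finset.sum_const, Finset.card_range, nsmul_eq_mul]
  push_cast
  ring

include hσ in
/-- The bound of `map_double_commutator_le` tends to zero with the mesh of the cuts. -/
theorem map_double_commutator_eq_zero {x : Unitization ℂ A} (hx : IsSelfAdjoint x) (y₁ y₂ : A) :
    σ (x * x * ((y₁ : Unitization ℂ A) * y₂) - 2 * (x * ((y₁ : Unitization ℂ A) * y₂) * x) +
      ((y₁ : Unitization ℂ A) * y₂) * (x * x)).snd = 0 := by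
  set R := ‖x‖ + 1
  have hR : 0 < R := by positivity
  have h1 := fun n : ℕ => map_double_commutator_le σ hx y₁ y₂ hσ hR (by simp [R]) (n + 1)
    n.succ_pos
  have h2 : Filter.Tendsto (fun n : ℕ => ((n + 1 : ℕ) + 1 : ℝ) * (‖σ‖ *
      (9 * (2 * R / (n + 1 : ℕ)) ^ 2 * ‖(y₁ : Unitization ℂ A) * y₂‖))) Filter.atTop (𝓝 0) := by
    have h3 : Filter.Tendsto (fun n : ℕ => 1 / ((n : ℝ) + 1)) Filter.atTop (𝓝 0) :=
      tendsto_one_div_add_atTop_nhds_zero_nat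
    have h4 := (((h3.pow 2).add h3).const_mul
      (‖σ‖ * (9 * (2 * R) ^ 2 * ‖(y₁ : Unitization ℂ A) * y₂‖)))
    rw [zero_pow two_ne_zero, add_zero, mul_zero] at h4
    refine h4.congr fun n => ?_
    have : (n : ℝ) + 1 ≠ 0 := by positivity
    push_cast
    field_simp
    ring
  exact norm_le_zero_iff.1 (ge_of_tendsto h2 (Filter.Eventually.of_forall h1))

include hσ in
/-- The function `t ↦ σ (e^{itx} y e^{-itx})` has vanishing second derivative and is bounded,
hence it is constant. -/
theorem map_commutator_eq_zero {x : Unitization ℂ A} (hx : IsSelfAdjoint x) (y₁ y₂ : A) :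
    σ (x * ((y₁ : Unitization ℂ A) * y₂) - ((y₁ : Unitization ℂ A) * y₂) * x).snd = 0 := by
  set Y := (y₁ : Unitization ℂ A) * y₂ with hY
  let S : Unitization ℂ A →L[ℂ] V := σ.comp ⟨Unitization.sndHom ℂ ℂ A, Unitization.continuous_snd⟩
  have hS : ∀ z, S z = σ z.snd := fun _ => rfl
  let u : ℝ → Unitization ℂ A := fun t => NormedSpace.exp (t • (Complex.I • x))
  have hu : ∀ t, HasDerivAt u (Complex.I • (u t * x)) t := fun t => by
    have := hasDerivAt_exp_smul_const (𝕂 := ℝ) (Complex.I • x) t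
    rwa [mul_smul_comm] at this
  have hu' : ∀ t, HasDerivAt (fun t => u (-t)) (-(Complex.I • (x * u (-t)))) t := fun t => by
    have := hasDerivAt_exp_smul_const' (𝕂 := ℝ) (Complex.I • x) (-t)
    rw [smul_mul_assoc] at this
    refine (this.scomp t (hasDerivAt_neg t)).congr_deriv ?_
    rw [neg_smul, one_smul]
  have hcomm : ∀ t, u t * x = x * u t := fun t =>
    (((Commute.refl x).smul_right Complex.I).smul_right t).exp_right.eq.symm
  have hmem : ∀ t, u t ∈ unitary (Unitization ℂ A) := fun t => by
    have := (selfAdjoint.expUnitary (t • (⟨x, hx⟩ : selfAdjoint (Unitization ℂ A)))).2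
    rw [selfAdjoint.expUnitary_coe] at this
    have h1 : Complex.I • ((t • (⟨x, hx⟩ : selfAdjoint (Unitization ℂ A)) :
      selfAdjoint (Unitization ℂ A)) : Unitization ℂ A) = t • (Complex.I • x) := smul_comm ..
    rwa [h1] at this
  let Z : ℝ → Unitization ℂ A := fun t => u t * Y * u (-t)
  have hZ : ∀ t, HasDerivAt Z (Complex.I • (x * Z t - Z t * x)) t := fun t => by
    refine (((hu t).mul_const Y).mul (hu' t)).congr_deriv ?_
    have h1 := hcomm t
    have h2 := hcomm (-t)
    simp only [Z]
    rw [smul_mul_assoc, smul_mul_assoc, mul_neg, mul_smul_comm, h1, ← sub_eq_add_neg, ← smul_sub,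
      mul_assoc (u t * Y) (u (-t)) x, h2]
    simp only [mul_assoc]
  have hZprod : ∀ t, ∃ z₁ z₂ : A, Z t = (z₁ : Unitization ℂ A) * z₂ := fun t =>
    ⟨(u t * (y₁ : Unitization ℂ A)).snd, ((y₂ : Unitization ℂ A) * u (-t)).snd, by
      rw [inr_snd_mul_inr, inr_snd_inr_mul]
      simp only [Z, hY, mul_assoc]⟩
  -- the derivative of `S ∘ Z` is constant
  have hd : ∀ t, HasDerivAt (fun t => S (x * Z t - Z t * x)) 0 t := fun t => by
    have h1 := ((hZ t).const_mul x).sub ((hZ t).mul_const x)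
    have h2 := (S.restrictScalars ℝ).hasFDerivAt.comp_hasDerivAt t h1
    refine h2.congr_deriv ?_
    obtain ⟨z₁, z₂, hz⟩ := hZprod t
    have h3 := map_double_commutator_eq_zero σ hσ hx z₁ z₂
    rw [← hz] at h3
    rw [ContinuousLinearMap.coe_restrictScalars', mul_smul_comm, smul_mul_assoc, ← smul_sub,
      map_smul, hS]
    have h4 : x * (x * Z t - Z t * x) - (x * Z t - Z t * x) * x =
        x * x * Z t - 2 * (x * Z t * x) + Z t * (x * x) := by noncomm_ring
    rw [h4, h3, smul_zero]
  have hconst : ∀ t, S (x * Z t - Z t * x) = S (x * Z 0 - Z 0 * x) := fun t =>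
    is_const_of_deriv_eq_zero (fun t => (hd t).differentiableAt) (fun t => (hd t).deriv) t 0
  have hZ0 : Z 0 = Y := by
    have : u 0 = 1 := by simp only [u]; rw [zero_smul, NormedSpace.exp_zero]
    simp only [Z, neg_zero, this, one_mul, mul_one]
  rw [hZ0] at hconst
  set ξ := S (x * Y - Y * x) with hξ
  have hlin : ∀ t, HasDerivAt (fun t : ℝ => S (Z t) - t • (Complex.I • ξ)) 0 t := fun t => by
    have h1 := (S.restrictScalars ℝ).hasFDerivAt.comp_hasDerivAt t (hZ t)
    have h2 := (hasDerivAt_id t).smul_const (Complex.I • ξ)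
    refine (h1.sub h2).congr_deriv ?_
    rw [ContinuousLinearMap.coe_restrictScalars', map_smul, hconst, one_smul, sub_self]
  have hlin' : ∀ t, S (Z t) - t • (Complex.I • ξ) = S Y := fun t => by
    have := is_const_of_deriv_eq_zero (fun t => (hlin t).differentiableAt)
      (fun t => (hlin t).deriv) t 0
    simpa [hZ0] using this
  have hbound : ∀ t, ‖S (Z t)‖ ≤ ‖S‖ * ‖Y‖ := fun t => by
    refine (S.le_opNorm _).trans (mul_le_mul_of_nonneg_left ?_ (norm_nonneg _))
    calc ‖Z t‖ ≤ ‖u t‖ * ‖Y‖ * ‖u (-t)‖ :=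
          (norm_mul_le _ _).trans (mul_le_mul_of_nonneg_right (norm_mul_le _ _) (norm_nonneg _))
      _ ≤ 1 * ‖Y‖ * 1 := by
          gcongr
          · exact norm_le_one_of_mem_unitary (hmem t)
          · exact norm_le_one_of_mem_unitary (hmem (-t))
      _ = ‖Y‖ := by ring
  by_contra hne
  have hξ0 : 0 < ‖ξ‖ := norm_pos_iff.2 hne
  have h5 := hlin' ((2 * (‖S‖ * ‖Y‖) + 1) / ‖ξ‖)
  have h6 : ((2 * (‖S‖ * ‖Y‖) + 1) / ‖ξ‖) • (Complex.I • ξ) =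
      S (Z ((2 * (‖S‖ * ‖Y‖) + 1) / ‖ξ‖)) - S Y := by rw [← h5]; abel
  have h7 := congrArg norm h6
  rw [norm_smul, norm_smul, Complex.norm_I, one_mul, Real.norm_of_nonneg (by positivity),
    div_mul_cancel₀ _ hξ0.ne'] at h7
  have h8 := (norm_sub_le (S (Z ((2 * (‖S‖ * ‖Y‖) + 1) / ‖ξ‖))) (S Y)).trans
    (add_le_add (hbound _) (S.le_opNorm Y))
  linarith

include hσ in
/-- A bounded linear map vanishing on `p * q` whenever `q * p = 0` is a trace. -/
theorem map_mul_comm_of_zero_product (a b : A) : σ (a * b) = σ (b * a) := by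
  let : PartialOrder A := CStarAlgebra.spectralOrder A
  have : StarOrderedRing A := CStarAlgebra.spectralOrderedRing A
  have h1 : ∀ x y : A, 0 ≤ x → 0 ≤ y → σ (x * y) = σ (y * x) := by
    intro x y hx hy
    obtain ⟨z, hz⟩ := CStarAlgebra.nonneg_iff_eq_star_mul_self.1 hy
    have hx' : IsSelfAdjoint (x : Unitization ℂ A) := (IsSelfAdjoint.of_nonneg hx).inr ℂ
    have := map_commutator_eq_zero σ hσ hx' (star z) z
    rw [← Unitization.inr_mul, ← hz, ← Unitization.inr_mul, ← Unitization.inr_mul,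
      ← Unitization.inr_sub, Unitization.snd_inr, map_sub, sub_eq_zero] at this
    exact this
  have ha : a ∈ Submodule.span ℂ {x : A | 0 ≤ x} := by
    rw [CStarAlgebra.span_nonneg]; trivial
  have hb : b ∈ Submodule.span ℂ {x : A | 0 ≤ x} := by
    rw [CStarAlgebra.span_nonneg]; trivial
  induction ha using Submodule.span_induction with
  | zero => simp
  | add x y _ _ hx hy => rw [add_mul, mul_add, map_add, map_add, hx, hy]
  | smul c x _ hx => rw [smul_mul_assoc, mul_smul_comm, map_smul, map_smul, hx]
  | mem x hx =>
    induction hb using Submodule.span_induction with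
    | zero => simp
    | add y z _ _ hy hz => rw [add_mul, mul_add, map_add, map_add, hy, hz]
    | smul c y _ hy => rw [smul_mul_assoc, mul_smul_comm, map_smul, map_smul, hy]
    | mem y hy => exact h1 x y hx hy

end ZeroProduct

section OrderZero

variable {A : Type u} {N : Type v} [NonUnitalCStarAlgebra A] [NonUnitalCStarAlgebra N]
  [PartialOrder A] [PartialOrder N] [StarOrderedRing A] [StarOrderedRing N]

/-- The continuous linear map underlying a contractive completely positive map. -/
def IsContractiveOrderZero.toCLM {ψ : A →CP N} (hψ : IsContractiveOrderZero ψ) : A →L[ℂ] N :=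
  (ψ.toLinearMap).mkContinuous 1 fun a => (hψ.contractive a).trans_eq (one_mul _).symm

/-- If `q * p = 0`, then `p p*` and `q* q` are orthogonal and the self-adjoint part of `p q` is
dominated by `t p p* + t⁻¹ q* q` for all `t > 0`; an order zero map preserves both relations. -/
theorem IsContractiveOrderZero.trace_mul_eq_zero {ψ : A →CP N} (hψ : IsContractiveOrderZero ψ)
    {V : Type*} [NormedAddCommGroup V] [NormedSpace ℂ V] (τ : N →L[ℂ] V)
    (hτ : ∀ x y, τ (x * y) = τ (y * x)) {p q : A} (hqp : q * p = 0) : τ (ψ (p * q)) = 0 := by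
  have hre : ∀ p q : A, q * p = 0 → τ (ψ (p * q + star q * star p)) = 0 := by
    intro p q hqp
    have horth : ψ (p * star p) * ψ (star q * q) = 0 := by
      refine hψ.orderZero _ _ (mul_star_self_nonneg p) (star_mul_self_nonneg q) ?_
      rw [mul_assoc, ← mul_assoc (star p), ← star_mul, hqp, star_zero, zero_mul, mul_zero]
    have hle : ∀ t : ℝ, 0 < t → ∀ w : ℝ, w = 1 ∨ w = -1 →
        w • (p * q + star q * star p) ≤ t • (p * star p) + t⁻¹ • (star q * q) := by
      intro t ht w hw
      have hs : √t ≠ 0 := (Real.sqrt_pos.2 ht).ne'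
      have h1 := mul_star_self_nonneg (√t • p - (w * (√t)⁻¹) • star q)
      have h2 : (√t • p - (w * (√t)⁻¹) • star q) * star (√t • p - (w * (√t)⁻¹) • star q) =
          (√t * √t) • (p * star p) + ((w * w) * ((√t)⁻¹ * (√t)⁻¹)) • (star q * q) -
          (w * (√t * (√t)⁻¹)) • (p * q + star q * star p) := by
        simp only [star_sub, star_smul, star_star, star_trivial, mul_sub, sub_mul, smul_mul_assoc,
          mul_smul_comm]
        module
      have hw2 : w * w = 1 := by rcases hw with rfl | rfl <;> norm_num
      rw [h2, hw2, ← mul_inv, Real.mul_self_sqrt ht.le, mul_inv_cancel₀ hs, mul_one, one_mul] at h1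
      exact sub_nonneg.1 h1
    have hψle : ∀ t : ℝ, 0 < t → ∀ w : ℝ, w = 1 ∨ w = -1 →
        w • ψ (p * q + star q * star p) ≤ t • ψ (p * star p) + t⁻¹ • ψ (star q * q) := by
      intro t ht w hw
      have h1 := OrderHomClass.mono ψ (hle t ht w hw)
      have hreal : ∀ (r : ℝ) (x : A), ψ (r • x) = r • ψ x := fun r x => by
        rw [← Complex.coe_smul, map_smul, Complex.coe_smul]
      simpa only [map_add, hreal] using h1
    refine trace_eq_zero_of_forall_le τ hτ (map_nonneg ψ (mul_star_self_nonneg p))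
      (map_nonneg ψ (star_mul_self_nonneg q)) horth (fun t ht => ?_) (fun t ht => ?_)
    · simpa using hψle t ht 1 (Or.inl rfl)
    · simpa only [neg_smul, one_smul] using hψle t ht (-1) (Or.inr rfl)
  have h1 := hre p q hqp
  have h2 := hre (Complex.I • p) q (by rw [mul_smul_comm, hqp, smul_zero])
  rw [smul_mul_assoc, star_smul, mul_smul_comm, map_add, map_smul, map_smul, map_add, map_smul,
    map_smul] at h2
  rw [map_add, map_add] at h1
  simp only [Complex.star_def, Complex.conj_I, neg_smul] at h2
  rw [← sub_eq_add_neg, ← smul_sub, smul_eq_zero] at h2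
  have h3 := sub_eq_zero.1 (h2.resolve_left Complex.I_ne_zero)
  rw [← h3, ← two_smul ℂ, smul_eq_zero] at h1
  exact h1.resolve_left two_ne_zero

/-- Completely positive order zero maps preserve the relation `∼_Tr`. -/
theorem IsContractiveOrderZero.universalTrace_eq_zero {ψ : A →CP N}
    (hψ : IsContractiveOrderZero ψ) {a : A} (ha : universalTrace A a = 0) :
    universalTrace N (ψ a) = 0 := by
  rw [universalTrace_eq_zero_iff] at ha
  have hσ : ∀ p q : A, q * p = 0 → ((universalTrace N).comp hψ.toCLM) (p * q) = 0 :=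
    fun p q hqp => hψ.trace_mul_eq_zero _ universalTrace_mul_comm hqp
  have h1 := map_mul_comm_of_zero_product ((universalTrace N).comp hψ.toCLM) hσ
  have h2 : commutatorClosure A ≤ LinearMap.ker
      ((universalTrace N).comp hψ.toCLM : A →ₗ[ℂ] TraceQuotient N) := by
    refine Submodule.topologicalClosure_minimal _ (Submodule.span_le.2 ?_) ?_
    · rintro _ ⟨x, y, rfl⟩
      simp only [SetLike.mem_coe, LinearMap.mem_ker]
      exact (map_sub ((universalTrace N).comp hψ.toCLM) _ _).trans (sub_eq_zero.2 (h1 x y))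
    · exact ((universalTrace N).comp hψ.toCLM).isClosed_ker
  exact h2 ha

end OrderZero

/-! ### Zero sum functions as coboundaries of a product of two involutions -/

section ZeroSum

variable {I : Type*} [DecidableEq I]

/-- A zero sum family can be enumerated such that all partial sums are bounded by the size of
the entries: one always continues with an entry of sign opposite to the current partial sum. -/
theorem exists_list_partial_sums_le (f : I → ℝ) {M : ℝ} (hM : ∀ i, |f i| ≤ M) (S : Finset I) :
    ∀ c : ℝ, |c| ≤ M → c + ∑ i ∈ S, f i = 0 →
    ∃ l : List I, l.Nodup ∧ (∀ i, i ∈ l ↔ i ∈ S) ∧ ∀ n, |c + ((l.take n).map f).sum| ≤ M := by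
  induction S using Finset.strongInduction with
  | H S ih =>
    intro c hc hsum
    rcases S.eq_empty_or_nonempty with rfl | hne
    · exact ⟨[], List.nodup_nil, by simp, by simpa using hc⟩
    have hex : ∃ i ∈ S, |c + f i| ≤ M := by
      by_contra! hcon
      rcases le_total 0 c with h0 | h0
      · have h1 : ∀ i ∈ S, 0 < f i := fun i hi => by
          by_contra! hfi
          have h2 := hcon i hi
          have h3 := abs_le.1 (hM i)
          have h4 := abs_le.1 hc
          exact absurd (abs_le.2 ⟨by linarith, by linarith⟩) (not_le.2 h2)
        have := Finset.sum_pos h1 hne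
        linarith
      · have h1 : ∀ i ∈ S, f i < 0 := fun i hi => by
          by_contra! hfi
          have h2 := hcon i hi
          have h3 := abs_le.1 (hM i)
          have h4 := abs_le.1 hc
          exact absurd (abs_le.2 ⟨by linarith, by linarith⟩) (not_le.2 h2)
        have := Finset.sum_neg h1 hne
        linarith
    obtain ⟨i, hi, hci⟩ := hex
    obtain ⟨l, hl1, hl2, hl3⟩ := ih (S.erase i) (Finset.erase_ssubset hi) (c + f i) hci
      (by rw [← hsum, ← Finset.add_sum_erase S f hi]; ring)
    refine ⟨i :: l, ?_, fun j => ?_, fun n => ?_⟩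
    · rw [List.nodup_cons]
      exact ⟨fun h => by simpa using (hl2 i).1 h, hl1⟩
    · rw [List.mem_cons, hl2, Finset.mem_erase]
      by_cases h : j = i <;> simp [h, hi]
    · cases n with
      | zero => simpa using hc
      | succ n => simpa [add_assoc] using hl3 n

/-- The involution `k ↦ n - 2 - k` of `{0, …, n - 1}`, read modulo `n`. -/
def shiftedRev {n : ℕ} (k : Fin n) : Fin n :=
  if k.1 + 1 = n then k else ⟨n - 2 - k.1, by have := k.2; omega⟩

theorem shiftedRev_shiftedRev {n : ℕ} (k : Fin n) : shiftedRev (shiftedRev k) = k := by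
  have := k.2
  unfold shiftedRev
  ext
  split_ifs <;> simp_all <;> omega

/-- The composition of the two reversals moves every index one step down, cyclically. -/
theorem shiftedRev_rev {n : ℕ} (k : Fin n) :
    ((shiftedRev k.rev : Fin n) : ℕ) = if k.1 = 0 then n - 1 else k.1 - 1 := by
  have := k.2
  unfold shiftedRev
  split_ifs <;> simp_all [Fin.val_rev] <;> omega

/-- The case of a single class: `b` is the family of partial sums along a suitable enumeration, and
the two involutions are reversals whose composition is the cyclic shift. -/
theorem exists_involutions_of_finset (f : I → ℝ) {M : ℝ} (hM0 : 0 ≤ M) (hM : ∀ i, |f i| ≤ M)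
    (S : Finset I) (hS : ∑ i ∈ S, f i = 0) :
    ∃ (b : I → ℝ) (θ θ' : I → I), (∀ i, |b i| ≤ M) ∧ (∀ i ∈ S, θ i ∈ S) ∧ (∀ i ∈ S, θ' i ∈ S) ∧
      (∀ i ∈ S, θ (θ i) = i) ∧ (∀ i ∈ S, θ' (θ' i) = i) ∧
      ∀ i ∈ S, f i = b i - b (θ' (θ i)) := by
  obtain ⟨l, hl1, hl2, hl3⟩ := exists_list_partial_sums_le f hM S 0 (by simpa using hM0)
    (by simpa using hS)
  simp only [zero_add] at hl3
  let e : Fin l.length ≃ {i // i ∈ l} := hl1.getEquiv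
  have he : ∀ k, ((e k : {i // i ∈ l}) : I) = l[k.1] := fun k => rfl
  let lift : (Fin l.length → Fin l.length) → I → I := fun ρ i =>
    if h : i ∈ l then e (ρ (e.symm ⟨i, h⟩)) else i
  have hlift : ∀ ρ k, lift ρ (e k) = e (ρ k) := fun ρ k => by
    simp only [lift, dif_pos (e k).2]
    rw [Subtype.coe_eta, Equiv.symm_apply_apply]
  let B : ℕ → ℝ := fun n => ((l.take n).map f).sum
  let b : I → ℝ := fun i => if h : i ∈ l then B ((e.symm ⟨i, h⟩).1 + 1) else 0
  have hb : ∀ k, b (e k) = B (k.1 + 1) := fun k => by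
    simp only [b, dif_pos (e k).2]
    rw [Subtype.coe_eta, Equiv.symm_apply_apply]
  have hex : ∀ i ∈ S, ∃ k, ((e k : {i // i ∈ l}) : I) = i := fun i hi =>
    ⟨e.symm ⟨i, (hl2 i).2 hi⟩, by simp⟩
  have hB : ∀ k : Fin l.length, B (k.1 + 1) = B k.1 + f (e k) := fun k => by
    simp only [B]
    rw [he, List.take_succ_eq_append_getElem k.2]
    simp
  have hBlast : B l.length = 0 := by
    simp only [B, List.take_length]
    rw [← List.sum_toFinset f hl1, ← hS]
    exact Finset.sum_congr (by ext i; simp [hl2]) fun _ _ => rfl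
  refine ⟨b, lift Fin.rev, lift shiftedRev, fun i => ?_, ?_, ?_, ?_, ?_, ?_⟩
  · simp only [b]
    split_ifs with h
    · exact hl3 _
    · simpa using hM0
  · intro i hi
    obtain ⟨k, rfl⟩ := hex i hi
    rw [hlift]
    exact (hl2 _).1 (e _).2
  · intro i hi
    obtain ⟨k, rfl⟩ := hex i hi
    rw [hlift]
    exact (hl2 _).1 (e _).2
  · intro i hi
    obtain ⟨k, rfl⟩ := hex i hi
    rw [hlift, hlift, Fin.rev_rev]
  · intro i hi
    obtain ⟨k, rfl⟩ := hex i hi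
    rw [hlift, hlift, shiftedRev_shiftedRev]
  · intro i hi
    obtain ⟨k, rfl⟩ := hex i hi
    rw [hlift, hlift, hb, hb, hB, shiftedRev_rev]
    have hk := k.2
    split_ifs with h0
    · rw [Nat.sub_add_cancel (by omega), hBlast, h0]
      simp [B]
    · rw [Nat.sub_add_cancel (by omega)]
      ring

/-- A function with sum zero on every class is a coboundary for the composition of two class
preserving involutions. -/
theorem exists_involutions [Fintype I] {K : Type*} [DecidableEq K] (cl : I → K) (f : I → ℝ)
    {M : ℝ} (hM0 : 0 ≤ M) (hM : ∀ i, |f i| ≤ M)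
    (hf : ∀ c, ∑ i ∈ Finset.univ.filter (fun i => cl i = c), f i = 0) :
    ∃ (b : I → ℝ) (θ θ' : I → I), (∀ i, |b i| ≤ M) ∧ (∀ i, cl (θ i) = cl i) ∧
      (∀ i, cl (θ' i) = cl i) ∧ (∀ i, θ (θ i) = i) ∧ (∀ i, θ' (θ' i) = i) ∧
      ∀ i, f i = b i - b (θ' (θ i)) := by
  choose b θ θ' hb h1 h2 h3 h4 h5 using fun c =>
    exists_involutions_of_finset f hM0 hM (Finset.univ.filter (fun i => cl i = c)) (hf c)
  have hmem : ∀ i, i ∈ Finset.univ.filter (fun j => cl j = cl i) := fun i => by simp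
  have h1' : ∀ i, cl (θ (cl i) i) = cl i := fun i => by simpa using h1 (cl i) i (hmem i)
  have h2' : ∀ i, cl (θ' (cl i) i) = cl i := fun i => by simpa using h2 (cl i) i (hmem i)
  refine ⟨fun i => b (cl i) i, fun i => θ (cl i) i, fun i => θ' (cl i) i, fun i => hb _ _, h1', h2',
    fun i => ?_, fun i => ?_, fun i => ?_⟩
  · simp only [h1']
    exact h3 _ i (hmem i)
  · simp only [h2']
    exact h4 _ i (hmem i)
  · have h6 : cl (θ' (cl i) (θ (cl i) i)) = cl i := by
      simpa using h2 (cl i) _ (h1 (cl i) i (hmem i))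
    simp only [h1', h6]
    exact h5 _ i (hmem i)

end ZeroSum

/-! ### Finite dimensional C⋆-algebras -/

section FiniteDimensionalCStar

variable {F : Type*} [CStarAlgebra F] [FiniteDimensional ℂ F]

theorem finite_spectrum_real (x : F) : (spectrum ℝ x).Finite := by
  have : FiniteDimensional ℝ F := FiniteDimensional.complexToReal F
  have hint : IsIntegral ℝ x := IsIntegral.of_finite ℝ x
  refine ((minpoly ℝ x).roots.toFinset.finite_toSet).subset fun t ht => ?_
  have h1 := spectrum.subset_polynomial_aeval x (minpoly ℝ x) (Set.mem_image_of_mem _ ht)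
  rw [minpoly.aeval] at h1
  rcases subsingleton_or_nontrivial F with h | h
  · simp [spectrum.of_subsingleton] at ht
  · rw [spectrum.zero_eq, Set.mem_singleton_iff] at h1
    simpa [minpoly.ne_zero hint] using h1

theorem continuousOn_spectrum_real (x : F) (f : ℝ → ℝ) : ContinuousOn f (spectrum ℝ x) :=
  (finite_spectrum_real x).continuousOn f

theorem isStarProjection_cfc_indicator (x : F) (s : Set ℝ) :
    IsStarProjection (cfc (s.indicator (fun _ => (1 : ℝ))) x) := by
  refine ⟨?_, cfc_predicate _ x⟩
  rw [IsIdempotentElem, ← cfc_mul _ _ x (continuousOn_spectrum_real x _)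
    (continuousOn_spectrum_real x _)]
  refine cfc_congr fun t _ => ?_
  by_cases h : t ∈ s <;> simp [h]

/-- Spectral decomposition, cut down by a nonzero projection commuting with `x`. -/
theorem exists_spectral_projection {x p : F} (hx : IsSelfAdjoint x) (hp : p ≠ 0) :
    ∃ (t : ℝ) (e : F), IsStarProjection e ∧ (∀ y, Commute x y → Commute e y) ∧ x * e = t • e ∧
      e * p ≠ 0 := by
  let e : ℝ → F := fun t => cfc (Set.indicator {t} (fun _ => (1 : ℝ))) x
  have hsum : ∑ t ∈ (finite_spectrum_real x).toFinset, e t = 1 := by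
    have h1 : ∑ t ∈ (finite_spectrum_real x).toFinset, e t =
        cfc (∑ t ∈ (finite_spectrum_real x).toFinset, Set.indicator {t} (fun _ => (1 : ℝ))) x :=
      (cfc_sum _ _ _ fun i _ => continuousOn_spectrum_real x _).symm
    rw [h1, ← cfc_const_one ℝ x]
    refine cfc_congr fun s hs => ?_
    rw [Finset.sum_apply, Finset.sum_eq_single s]
    · simp
    · intro t _ hts
      simp [Set.indicator, hts.symm]
    · intro h
      simp [hs] at h
  obtain ⟨t, -, ht⟩ : ∃ t ∈ (finite_spectrum_real x).toFinset, e t * p ≠ 0 := by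
    by_contra! hcon
    refine hp ?_
    rw [← one_mul p, ← hsum, Finset.sum_mul]
    exact Finset.sum_eq_zero hcon
  refine ⟨t, e t, isStarProjection_cfc_indicator x _, fun y hy => hy.cfc_real _, ?_, ht⟩
  have h1 : x * e t = cfc (fun s => s * Set.indicator {t} (fun _ => (1 : ℝ)) s) x := by
    rw [cfc_mul (fun s => s) _ x (by fun_prop) (continuousOn_spectrum_real x _), cfc_id' ..]
  rw [h1, ← cfc_smul _ _ x (continuousOn_spectrum_real x _)]
  refine cfc_congr fun s _ => ?_
  by_cases h : s = t <;> simp [h]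

/-- A finite family of nonzero pairwise orthogonal projections with sum `1` commuting with `a`. -/
structure IsProjectionPartition (a : F) (P : Finset F) : Prop where
  proj : ∀ p ∈ P, IsStarProjection p
  ne_zero : ∀ p ∈ P, p ≠ 0
  orth : ∀ p ∈ P, ∀ q ∈ P, p ≠ q → p * q = 0
  sum : ∑ p ∈ P, p = 1
  comm : ∀ p ∈ P, Commute a p

theorem IsProjectionPartition.card_le {a : F} {P : Finset F} (hP : IsProjectionPartition a P) :
    P.card ≤ Module.finrank ℂ F := by
  have hli : LinearIndependent ℂ (fun p : P => (p : F)) := by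
    rw [Fintype.linearIndependent_iff]
    intro g hg q
    have h1 : ∑ p : P, g p • ((p : F) * (q : F)) = 0 := by
      simp only [← smul_mul_assoc, ← Finset.sum_mul, hg, zero_mul]
    rw [Finset.sum_eq_single q] at h1
    · rw [(hP.proj q q.2).1.eq, smul_eq_zero] at h1
      exact h1.resolve_right (hP.ne_zero q q.2)
    · intro p _ hpq
      rw [hP.orth p p.2 q q.2 (fun h => hpq (Subtype.ext h)), smul_zero]
    · simp
  have := hli.fintype_card_le_finrank
  simpa using this

theorem exists_maximal_partition (a : F) : ∃ P : Finset F, IsProjectionPartition a P ∧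
    ∀ Q : Finset F, IsProjectionPartition a Q → Q.card ≤ P.card := by
  classical
  have hne : ∃ P : Finset F, IsProjectionPartition a P := by
    rcases subsingleton_or_nontrivial F with h | h
    · exact ⟨∅, by simp, by simp, by simp, Subsingleton.elim _ _, by simp⟩
    · exact ⟨{1}, by simp [IsStarProjection.one], by simp, by simp, by simp, by simp⟩
  let S : Set ℕ := {n | ∃ P : Finset F, IsProjectionPartition a P ∧ P.card = n}
  have hS : S.Nonempty := hne.imp' _ fun P hP => ⟨P, hP, rfl⟩
  have hb : BddAbove S := ⟨Module.finrank ℂ F, by rintro _ ⟨P, hP, rfl⟩; exact hP.card_le⟩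
  obtain ⟨P, hP, hPc⟩ := Nat.sSup_mem hS hb
  exact ⟨P, hP, fun Q hQ => by rw [hPc]; exact le_csSup hb ⟨Q, hQ, rfl⟩⟩

omit [FiniteDimensional ℂ F] in
/-- In a partition of maximal size commuting with `a`, every subprojection of a member commuting
with `a` is trivial. -/
theorem IsProjectionPartition.eq_zero_or_eq {a : F} {P : Finset F} (hP : IsProjectionPartition a P)
    (hmax : ∀ Q : Finset F, IsProjectionPartition a Q → Q.card ≤ P.card) {p q : F} (hp : p ∈ P)
    (hq : IsStarProjection q) (hpq : p * q = q) (hqa : Commute a q) : q = 0 ∨ q = p := by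
  classical
  by_contra! hcon
  obtain ⟨hq0, hqp⟩ := hcon
  have hpsa := (hP.proj p hp).2.star_eq
  have hqp' : q * p = q := by
    have := congrArg star hpq
    rwa [star_mul, hpsa, hq.2.star_eq] at this
  have hr : IsStarProjection (p - q) := by
    refine ⟨?_, (hP.proj p hp).2.sub hq.2⟩
    rw [IsIdempotentElem, mul_sub, sub_mul, sub_mul, (hP.proj p hp).1.eq, hpq, hqp', hq.1.eq]
    abel
  have hr0 : p - q ≠ 0 := sub_ne_zero.2 hqp.symm
  have horth : ∀ s ∈ P.erase p, s * p = 0 ∧ p * s = 0 := fun s hs =>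
    ⟨hP.orth s (Finset.mem_of_mem_erase hs) p hp (Finset.ne_of_mem_erase hs),
      hP.orth p hp s (Finset.mem_of_mem_erase hs) (Finset.ne_of_mem_erase hs).symm⟩
  have hq1 : ∀ s ∈ P.erase p, s * q = 0 ∧ q * s = 0 := fun s hs => by
    constructor
    · rw [← hpq, ← mul_assoc, (horth s hs).1, zero_mul]
    · rw [← hqp', mul_assoc, (horth s hs).2, mul_zero]
  have hqr : q * (p - q) = 0 := by rw [mul_sub, hqp', hq.1.eq, sub_self]
  have hrq : (p - q) * q = 0 := by rw [sub_mul, hpq, hq.1.eq, sub_self]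
  have hqnot : q ∉ P.erase p := fun h => hq0 (by
    have := (hq1 q h).1; rwa [hq.1.eq] at this)
  have hrnot : p - q ∉ P.erase p := fun h => hr0 (by
    have h1 := (hq1 _ h).1
    have h2 := (horth _ h).1
    have h3 := hr.1.eq
    rw [mul_sub, h2, h1, sub_zero] at h3
    exact h3.symm)
  have hqr' : q ≠ p - q := fun h => hq0 (by
    have := hqr; rw [← h, hq.1.eq] at this; exact this)
  have hqnot' : q ∉ insert (p - q) (P.erase p) := by
    rw [Finset.mem_insert]; push Not; exact ⟨hqr', hqnot⟩
  have hQ : IsProjectionPartition a (insert q (insert (p - q) (P.erase p))) := by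
    refine ⟨?_, ?_, ?_, ?_, ?_⟩
    · intro s hs
      rcases Finset.mem_insert.1 hs with rfl | hs
      · exact hq
      rcases Finset.mem_insert.1 hs with rfl | hs
      · exact hr
      exact hP.proj s (Finset.mem_of_mem_erase hs)
    · intro s hs
      rcases Finset.mem_insert.1 hs with rfl | hs
      · exact hq0
      rcases Finset.mem_insert.1 hs with rfl | hs
      · exact hr0
      exact hP.ne_zero s (Finset.mem_of_mem_erase hs)
    · intro s hs t ht hst
      rcases Finset.mem_insert.1 hs with hs | hs <;> rcases Finset.mem_insert.1 ht with ht | ht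
      · exact absurd (hs.trans ht.symm) hst
      · rcases Finset.mem_insert.1 ht with ht | ht
        · rw [hs, ht, hqr]
        · rw [hs, (hq1 t ht).2]
      · rcases Finset.mem_insert.1 hs with hs | hs
        · rw [hs, ht, hrq]
        · rw [ht, (hq1 s hs).1]
      · rcases Finset.mem_insert.1 hs with hs | hs <;> rcases Finset.mem_insert.1 ht with ht | ht
        · exact absurd (hs.trans ht.symm) hst
        · rw [hs, sub_mul, (horth t ht).2, (hq1 t ht).2, sub_zero]
        · rw [ht, mul_sub, (horth s hs).1, (hq1 s hs).1, sub_zero]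
        · exact hP.orth s (Finset.mem_of_mem_erase hs) t (Finset.mem_of_mem_erase ht) hst
    · rw [Finset.sum_insert hqnot', Finset.sum_insert hrnot, ← hP.sum,
        ← Finset.add_sum_erase P (fun p => p) hp]
      abel
    · intro s hs
      rcases Finset.mem_insert.1 hs with rfl | hs
      · exact hqa
      rcases Finset.mem_insert.1 hs with rfl | hs
      · exact (hP.comm p hp).sub_right hqa
      exact hP.comm s (Finset.mem_of_mem_erase hs)
  have h1 := hmax _ hQ
  rw [Finset.card_insert_of_notMem hqnot', Finset.card_insert_of_notMem hrnot,
    Finset.card_erase_of_mem hp] at h1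
  have : 0 < P.card := Finset.card_pos.2 ⟨p, hp⟩
  omega

/-- The members of a maximal partition are minimal projections: their corners are scalar. -/
theorem IsProjectionPartition.exists_smul_of_commute {a : F} {P : Finset F}
    (hP : IsProjectionPartition a P)
    (hmax : ∀ Q : Finset F, IsProjectionPartition a Q → Q.card ≤ P.card) {p x : F} (hp : p ∈ P)
    (hx : IsSelfAdjoint x) (hxa : Commute x a) (hxp : Commute x p) : ∃ t : ℝ, x * p = t • p := by
  obtain ⟨t, e, he, hcomm, hxe, hep⟩ := exists_spectral_projection hx (hP.ne_zero p hp)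
  refine ⟨t, ?_⟩
  have hep' : Commute e p := hcomm p hxp
  have hq : IsStarProjection (e * p) := by
    refine ⟨?_, ?_⟩
    · rw [IsIdempotentElem, mul_assoc, ← mul_assoc p e p, ← hep'.eq, mul_assoc e p p,
        (hP.proj p hp).1.eq, ← mul_assoc, he.1.eq]
    · rw [IsSelfAdjoint, star_mul, he.2.star_eq, (hP.proj p hp).2.star_eq, hep'.eq]
  have h1 := hP.eq_zero_or_eq hmax hp hq
    (by rw [hep'.eq, ← mul_assoc, (hP.proj p hp).1.eq])
    (((hcomm a hxa).symm).mul_right (hP.comm p hp))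
  have h2 := h1.resolve_left hep
  calc x * p = x * (e * p) := by rw [h2]
    _ = t • p := by rw [← mul_assoc, hxe, smul_mul_assoc, h2]

/-- A self-adjoint element of the corner of a member of a maximal partition is a scalar multiple of
that member. It need not commute with `a` a priori, but `a` is scalar on the corner. -/
theorem IsProjectionPartition.exists_corner_smul {a : F} (ha : IsSelfAdjoint a) {P : Finset F}
    (hP : IsProjectionPartition a P)
    (hmax : ∀ Q : Finset F, IsProjectionPartition a Q → Q.card ≤ P.card) {p x : F} (hp : p ∈ P)
    (hx : IsSelfAdjoint x) (hpx : p * x = x) : ∃ t : ℝ, x = t • p := by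
  have hxp : x * p = x := by
    have := congrArg star hpx
    rwa [star_mul, hx.star_eq, (hP.proj p hp).2.star_eq] at this
  obtain ⟨s, hs⟩ := hP.exists_smul_of_commute hmax hp ha (Commute.refl a) (hP.comm p hp)
  have hps : p * a = s • p := by rw [← (hP.comm p hp).eq, hs]
  have hxa : Commute x a := by
    rw [Commute, SemiconjBy]
    nth_rewrite 1 [← hxp]
    nth_rewrite 2 [← hpx]
    rw [mul_assoc, hps, ← mul_assoc, hs, mul_smul_comm, smul_mul_assoc, hpx, hxp]
  obtain ⟨t, ht⟩ := hP.exists_smul_of_commute hmax hp hx hxa (by rw [Commute, SemiconjBy, hxp, hpx])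
  exact ⟨t, by rw [← hxp, ht]⟩

/-- Two minimal projections of the partition are Murray–von Neumann equivalent or centrally
orthogonal. -/
theorem IsProjectionPartition.exists_partial_isometry {a : F} (ha : IsSelfAdjoint a) {P : Finset F}
    (hP : IsProjectionPartition a P)
    (hmax : ∀ Q : Finset F, IsProjectionPartition a Q → Q.card ≤ P.card) {p q : F} (hp : p ∈ P)
    (hq : q ∈ P) {x : F} (hx : p * x * q ≠ 0) : ∃ v : F, star v * v = q ∧ v * star v = p := by
  let : PartialOrder F := CStarAlgebra.spectralOrder F
  have : StarOrderedRing F := CStarAlgebra.spectralOrderedRing F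
  set y := p * x * q with hy
  have hpp := (hP.proj p hp).1.eq
  have hqq := (hP.proj q hq).1.eq
  have hqs := (hP.proj q hq).2.star_eq
  have hpy : p * y = y := by rw [hy, ← mul_assoc, ← mul_assoc, hpp]
  have hyq : y * q = y := by rw [hy, mul_assoc, hqq]
  obtain ⟨c, hc⟩ := hP.exists_corner_smul ha hmax hq (IsSelfAdjoint.star_mul_self y)
    (by rw [← mul_assoc]; congr 1; rw [← hqs, ← star_mul, hyq])
  obtain ⟨d, hd⟩ := hP.exists_corner_smul ha hmax hp (IsSelfAdjoint.mul_star_self y)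
    (by rw [← mul_assoc, hpy])
  have hcd : c = d := by
    have h1 : y * star y * y = c • y := by rw [mul_assoc, hc, mul_smul_comm, hyq]
    have h2 : y * star y * y = d • y := by rw [hd, smul_mul_assoc, hpy]
    have h3 : (c - d) • y = 0 := by rw [sub_smul, ← h1, ← h2, sub_self]
    exact sub_eq_zero.1 ((smul_eq_zero.1 h3).resolve_right hx)
  have hc0 : 0 < c := by
    by_contra! hcon
    have h1 : 0 ≤ q := by rw [← hqq]; nth_rewrite 1 [← hqs]; exact star_mul_self_nonneg q
    have h2 : star y * y ≤ 0 := by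
      rw [hc]
      exact smul_nonpos_of_nonpos_of_nonneg hcon h1
    have h3 := le_antisymm h2 (star_mul_self_nonneg y)
    exact hx (CStarRing.star_mul_self_eq_zero_iff y |>.1 h3)
  have hs : (√c)⁻¹ * (√c)⁻¹ * c = 1 := by
    rw [← mul_inv, Real.mul_self_sqrt hc0.le, inv_mul_cancel₀ hc0.ne']
  refine ⟨(√c)⁻¹ • y, ?_, ?_⟩
  · rw [star_smul, star_trivial, smul_mul_assoc, mul_smul_comm, smul_smul, hc, smul_smul, hs,
      one_smul]
  · rw [star_smul, star_trivial, smul_mul_assoc, mul_smul_comm, smul_smul, hd, smul_smul, ← hcd, hs,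
      one_smul]

end FiniteDimensionalCStar

section FiniteDimensionalCStar

variable {F : Type*} [CStarAlgebra F]

/-- An orthogonal family of projections with sum `1` together with partial isometries `v i`, from
a projection `r (cl i)` depending only on the class of `i` onto `p i`. -/
structure IsPartialIsometryFamily {I K : Type*} [Fintype I] (cl : I → K) (p v : I → F)
    (r : K → F) : Prop where
  proj : ∀ i, IsStarProjection (p i)
  orth : ∀ i j, i ≠ j → p i * p j = 0
  sum : ∑ i, p i = 1
  initial : ∀ i, star (v i) * v i = r (cl i)
  final : ∀ i, v i * star (v i) = p i
  mul_proj : ∀ i, v i * r (cl i) = v i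
  off : ∀ i j x, cl i ≠ cl j → p i * x * p j = 0

namespace IsPartialIsometryFamily

variable {I K : Type*} [Fintype I] {cl : I → K} {p v : I → F} {r : K → F}

/-- The symmetry permuting the projections `p i` according to a class preserving involution. -/
def symmetry (v : I → F) (θ : I → I) : F := ∑ i, v (θ i) * star (v i)

variable (h : IsPartialIsometryFamily cl p v r)
include h

theorem proj_mul (i : I) : p i * v i = v i := by
  rw [← h.final, mul_assoc, h.initial, h.mul_proj]

theorem star_mul_eq_zero {i j : I} (hij : i ≠ j) : star (v i) * v j = 0 := by
  rw [← h.proj_mul i, ← h.proj_mul j, star_mul, (h.proj i).2.star_eq, mul_assoc,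
    ← mul_assoc (p i), h.orth i j hij, zero_mul, mul_zero]

theorem symmetry_mul {θ : I → I} (hθ : ∀ i, cl (θ i) = cl i) (i : I) :
    symmetry v θ * v i = v (θ i) := by
  rw [symmetry, Finset.sum_mul, Finset.sum_eq_single i]
  · rw [mul_assoc, h.initial, ← hθ, h.mul_proj]
  · intro j _ hji
    rw [mul_assoc, h.star_mul_eq_zero hji, mul_zero]
  · simp

omit h in
theorem isSelfAdjoint_symmetry {θ : I → I} (hθ : ∀ i, θ (θ i) = i) :
    IsSelfAdjoint (symmetry v θ) := by
  rw [IsSelfAdjoint, symmetry, star_sum]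
  refine Fintype.sum_equiv (Function.Involutive.toPerm θ hθ) _ _ fun i => ?_
  change star (v (θ i) * star (v i)) = v (θ (θ i)) * star (v (θ i))
  rw [star_mul, star_star, hθ]

theorem symmetry_mul_self {θ : I → I} (hcl : ∀ i, cl (θ i) = cl i) (hθ : ∀ i, θ (θ i) = i) :
    symmetry v θ * symmetry v θ = 1 := by
  rw [← h.sum]
  nth_rewrite 2 [symmetry]
  rw [Finset.mul_sum]
  refine Finset.sum_congr rfl fun i _ => ?_
  rw [← mul_assoc, h.symmetry_mul hcl, hθ, h.final]

theorem symmetry_conj {θ : I → I} (hcl : ∀ i, cl (θ i) = cl i) (hθ : ∀ i, θ (θ i) = i) (i : I) :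
    symmetry v θ * p i * symmetry v θ = p (θ i) := by
  have h1 : star (v i) * symmetry v θ = star (v (θ i)) := by
    rw [← h.symmetry_mul hcl, star_mul, (isSelfAdjoint_symmetry hθ).star_eq]
  rw [← h.final, ← mul_assoc, h.symmetry_mul hcl, mul_assoc, h1, h.final]

theorem symmetry_conj_sum {θ : I → I} (hcl : ∀ i, cl (θ i) = cl i) (hθ : ∀ i, θ (θ i) = i)
    (b : I → ℝ) : symmetry v θ * (∑ i, b i • p i) * symmetry v θ = ∑ i, b (θ i) • p i := by
  rw [Finset.mul_sum, Finset.sum_mul]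
  refine Fintype.sum_equiv (Function.Involutive.toPerm θ hθ) _ _ fun i => ?_
  change symmetry v θ * b i • p i * symmetry v θ = b (θ (θ i)) • p (θ i)
  rw [hθ, mul_smul_comm, smul_mul_assoc, h.symmetry_conj hcl hθ]

theorem sum_mul_sum (b c : I → ℝ) : (∑ i, b i • p i) * (∑ i, c i • p i) =
    ∑ i, (b i * c i) • p i := by
  classical
  rw [Finset.sum_mul]
  refine Finset.sum_congr rfl fun i _ => ?_
  rw [Finset.mul_sum, Finset.sum_eq_single i]
  · rw [smul_mul_smul_comm, (h.proj i).1.eq]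
  · intro j _ hji
    rw [smul_mul_smul_comm, h.orth i j hji.symm, smul_zero]
  · simp

theorem isSelfAdjoint_sum (b : I → ℝ) : IsSelfAdjoint (∑ i, b i • p i) := by
  rw [IsSelfAdjoint, star_sum]
  refine Finset.sum_congr rfl fun i _ => ?_
  rw [star_smul, star_trivial, (h.proj i).2.star_eq]

theorem norm_sum_le {b : I → ℝ} {M : ℝ} (hM : 0 ≤ M) (hb : ∀ i, |b i| ≤ M) :
    ‖∑ i, b i • p i‖ ≤ M := by
  let : PartialOrder F := CStarAlgebra.spectralOrder F
  have : StarOrderedRing F := CStarAlgebra.spectralOrderedRing F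
  have hp : ∀ i, 0 ≤ p i := fun i => (h.proj i).nonneg
  have h1 : 0 ≤ ∑ i, (b i * b i) • p i :=
    Finset.sum_nonneg fun i _ => smul_nonneg (mul_self_nonneg _) (hp i)
  have h2 : ∑ i, (b i * b i) • p i ≤ algebraMap ℝ F (M * M) := by
    rw [Algebra.algebraMap_eq_smul_one, ← h.sum, Finset.smul_sum]
    refine Finset.sum_le_sum fun i _ => smul_le_smul_of_nonneg_right ?_ (hp i)
    rw [← abs_mul_abs_self]
    exact mul_self_le_mul_self (abs_nonneg _) (hb i)
  have h3 := (CStarAlgebra.norm_le_iff_le_algebraMap _ (mul_self_nonneg M) h1).2 h2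
  rw [← h.sum_mul_sum] at h3
  nth_rewrite 1 [← (h.isSelfAdjoint_sum b).star_eq] at h3
  rw [CStarRing.norm_star_mul_self] at h3
  exact abs_le_of_sq_le_sq' (by nlinarith) hM |>.2

theorem commute_sum (c : K → ℝ) (x : F) : Commute (∑ i, c (cl i) • p i) x := by
  have h1 : (∑ i, c (cl i) • p i) * x = ∑ i, ∑ j, c (cl i) • (p i * x * p j) := by
    conv_lhs => rw [← mul_one x, ← h.sum, Finset.mul_sum, Finset.sum_mul]
    refine Finset.sum_congr rfl fun i _ => ?_
    rw [Finset.mul_sum]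
    refine Finset.sum_congr rfl fun j _ => ?_
    rw [smul_mul_assoc, mul_assoc]
  have h2 : x * (∑ i, c (cl i) • p i) = ∑ i, ∑ j, c (cl j) • (p i * x * p j) := by
    conv_lhs => rw [← one_mul x, ← h.sum, Finset.sum_mul, Finset.sum_mul]
    refine Finset.sum_congr rfl fun i _ => ?_
    rw [Finset.mul_sum]
    refine Finset.sum_congr rfl fun j _ => ?_
    rw [mul_smul_comm]
  rw [Commute, SemiconjBy, h1, h2]
  refine Finset.sum_congr rfl fun i _ => Finset.sum_congr rfl fun j _ => ?_
  by_cases hij : cl i = cl j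
  · rw [hij]
  · rw [h.off i j x hij, smul_zero, smul_zero]

end IsPartialIsometryFamily

/-- Diagonalization of a self-adjoint element along minimal projections, with the partial isometries
between equivalent ones. The classes are the Murray–von Neumann equivalence classes. -/
theorem exists_isPartialIsometryFamily {F : Type u} [CStarAlgebra F] [FiniteDimensional ℂ F]
    {a : F} (ha : IsSelfAdjoint a) :
    ∃ (I K : Type u) (_ : Fintype I) (cl : I → K) (p v : I → F) (r : K → F) (μ : I → ℝ),
      IsPartialIsometryFamily cl p v r ∧ a = ∑ i, μ i • p i ∧ ∀ i, |μ i| ≤ ‖a‖ := by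
  obtain ⟨P, hP, hmax⟩ := exists_maximal_partition a
  have hμ : ∀ p : P, ∃ t : ℝ, a * (p : F) = t • (p : F) := fun p =>
    hP.exists_smul_of_commute hmax p.2 ha (Commute.refl a) (hP.comm p p.2)
  choose μ hμ using hμ
  let R : Setoid P := {
    r := fun p q => ∃ v : F, star v * v = (q : F) ∧ v * star v = (p : F)
    iseqv := by
      refine ⟨fun p => ⟨p, ?_, ?_⟩, ?_, ?_⟩
      · rw [(hP.proj p p.2).2.star_eq, (hP.proj p p.2).1.eq]
      · rw [(hP.proj p p.2).2.star_eq, (hP.proj p p.2).1.eq]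
      · rintro p q ⟨v, h1, h2⟩
        exact ⟨star v, by rw [star_star, h2], by rw [star_star, h1]⟩
      · rintro p q s ⟨v, h1, h2⟩ ⟨w, h3, h4⟩
        refine ⟨v * w, ?_, ?_⟩
        · calc star (v * w) * (v * w) = star w * (star v * v) * w := by
                rw [star_mul]; simp only [mul_assoc]
            _ = (star w * w) * (star w * w) := by rw [h1, ← h4]; simp only [mul_assoc]
            _ = s := by rw [h3, (hP.proj s s.2).1.eq]
        · calc (v * w) * star (v * w) = v * (w * star w) * star v := by
                rw [star_mul]; simp only [mul_assoc]
            _ = (v * star v) * (v * star v) := by rw [h4, ← h1]; simp only [mul_assoc]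
            _ = p := by rw [h2, (hP.proj p p.2).1.eq] }
  have hex : ∀ p : P, ∃ v : F, star v * v = ((Quotient.mk R p).out : F) ∧ v * star v = (p : F) :=
    fun p => by
      obtain ⟨v, h1, h2⟩ := Quotient.mk_out (s := R) p
      exact ⟨star v, by rw [star_star, h2], by rw [star_star, h1]⟩
  choose v hv1 hv2 using hex
  refine ⟨P, Quotient R, inferInstance, Quotient.mk R, fun p => p, v, fun c => (c.out : F), μ,
    ⟨fun p => hP.proj p p.2, fun p q hpq => hP.orth p p.2 q q.2 fun h => hpq (Subtype.ext h), ?_,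
      hv1, hv2, ?_, ?_⟩, ?_, ?_⟩
  · rw [Finset.sum_coe_sort P (fun p => p), hP.sum]
  · intro p
    -- `v r = v` for the initial projection `r = v* v` of a partial isometry
    have hr := (hP.proj _ (Quotient.mk R p).out.2)
    have h1 : star (v p - v p * ((Quotient.mk R p).out : F)) *
        (v p - v p * ((Quotient.mk R p).out : F)) = 0 := by
      rw [star_sub, star_mul, hr.2.star_eq, sub_mul, mul_sub, mul_sub, ← mul_assoc, hv1, hr.1.eq,
        mul_assoc _ (star (v p)), mul_assoc _ (star (v p)), ← mul_assoc (star (v p)), hv1, hr.1.eq,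
        hr.1.eq]
      abel
    exact (sub_eq_zero.1 (CStarRing.star_mul_self_eq_zero_iff _ |>.1 h1)).symm
  · intro p q x hpq
    by_contra hne
    obtain ⟨w, h1, h2⟩ := hP.exists_partial_isometry ha hmax p.2 q.2 hne
    exact hpq (Quotient.sound ⟨w, h1, h2⟩)
  · rw [← Finset.sum_congr rfl fun p _ => hμ p, ← Finset.mul_sum,
      Finset.sum_coe_sort P (fun p => p), hP.sum, mul_one]
  · intro p
    have h1 := congrArg norm (hμ p)
    have hp1 : ‖(p : F)‖ = 1 := by
      have h2 := CStarRing.norm_star_mul_self (x := (p : F))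
      rw [(hP.proj p p.2).2.star_eq, (hP.proj p p.2).1.eq] at h2
      have h3 : ‖(p : F)‖ ≠ 0 := norm_ne_zero_iff.2 (hP.ne_zero p p.2)
      exact (mul_left_cancel₀ h3 (by linarith : ‖(p : F)‖ * ‖(p : F)‖ = ‖(p : F)‖ * 1))
    rw [norm_smul, hp1, mul_one, Real.norm_eq_abs] at h1
    rw [← h1]
    exact (norm_mul_le _ _).trans_eq (by rw [hp1, mul_one])

/-- A self-adjoint element of a finite dimensional C⋆-algebra is the sum of a central element and
a difference `b - w b w*`, where `w` is a product of two symmetries. -/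
theorem exists_central_add_sub_conj [FiniteDimensional ℂ F] {a : F} (ha : IsSelfAdjoint a) :
    ∃ z b s t : F, IsSelfAdjoint z ∧ (∀ x, Commute z x) ∧ ‖z‖ ≤ ‖a‖ ∧ IsSelfAdjoint b ∧
      ‖b‖ ≤ 2 * ‖a‖ ∧ IsSelfAdjoint s ∧ s * s = 1 ∧ IsSelfAdjoint t ∧ t * t = 1 ∧
      Commute b (s * (t * b * t) * s) ∧ a = z + (b - s * (t * b * t) * s) := by
  classical
  obtain ⟨I, K, _, cl, p, v, r, μ, h, hsum, hμ⟩ := exists_isPartialIsometryFamily ha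
  -- the central part has the class averages of the eigenvalues as its coefficients
  let N : K → Finset I := fun c => Finset.univ.filter fun i => cl i = c
  let m : K → ℝ := fun c => (∑ i ∈ N c, μ i) / (N c).card
  have hNpos : ∀ i, 0 < (N (cl i)).card := fun i => Finset.card_pos.2 ⟨i, by simp [N]⟩
  have hm : ∀ i, |m (cl i)| ≤ ‖a‖ := fun i => by
    have h0 : (0 : ℝ) < (N (cl i)).card := by exact_mod_cast hNpos i
    simp only [m]
    rw [abs_div, abs_of_pos h0, div_le_iff₀ h0]
    calc |∑ j ∈ N (cl i), μ j| ≤ ∑ j ∈ N (cl i), |μ j| := Finset.abs_sum_le_sum_abs _ _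
      _ ≤ ∑ j ∈ N (cl i), ‖a‖ := Finset.sum_le_sum fun j _ => hμ j
      _ = ‖a‖ * (N (cl i)).card := by rw [Finset.sum_const, nsmul_eq_mul, mul_comm]
  have hf : ∀ c, ∑ i ∈ Finset.univ.filter (fun i => cl i = c), (μ i - m (cl i)) = 0 := by
    intro c
    rw [Finset.sum_sub_distrib]
    have h1 : ∑ i ∈ Finset.univ.filter (fun i => cl i = c), m (cl i) = (N c).card * m c := by
      rw [← nsmul_eq_mul, ← Finset.sum_const]
      exact Finset.sum_congr rfl fun i hi => by rw [(Finset.mem_filter.1 hi).2]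
    rw [h1]
    rcases (N c).card.eq_zero_or_pos with h0 | h0
    · have : N c = ∅ := Finset.card_eq_zero.1 h0
      simp only [N] at this
      rw [this, h0]
      simp
    · have h0' : ((N c).card : ℝ) ≠ 0 := by exact_mod_cast h0.ne'
      simp only [m]
      rw [mul_div_cancel₀ _ h0', sub_self]
  obtain ⟨b, θ, θ', hb, h1, h2, h3, h4, h5⟩ := exists_involutions cl (fun i => μ i - m (cl i))
    (M := 2 * ‖a‖) (by positivity)
    (fun i => (abs_sub _ _).trans (by linarith [hμ i, hm i])) hf
  have hconj : IsPartialIsometryFamily.symmetry v θ * (IsPartialIsometryFamily.symmetry v θ' *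
      (∑ i, b i • p i) * IsPartialIsometryFamily.symmetry v θ') *
      IsPartialIsometryFamily.symmetry v θ = ∑ i, b (θ' (θ i)) • p i := by
    rw [h.symmetry_conj_sum h2 h4, h.symmetry_conj_sum h1 h3 (fun i => b (θ' i))]
  refine ⟨∑ i, m (cl i) • p i, ∑ i, b i • p i, IsPartialIsometryFamily.symmetry v θ,
    IsPartialIsometryFamily.symmetry v θ', h.isSelfAdjoint_sum _, h.commute_sum m,
    h.norm_sum_le (norm_nonneg _) hm, h.isSelfAdjoint_sum _, h.norm_sum_le (by positivity) hb,
    IsPartialIsometryFamily.isSelfAdjoint_symmetry h3, h.symmetry_mul_self h1 h3,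
    IsPartialIsometryFamily.isSelfAdjoint_symmetry h4, h.symmetry_mul_self h2 h4, ?_, ?_⟩
  · rw [hconj, Commute, SemiconjBy, h.sum_mul_sum, h.sum_mul_sum]
    simp only [mul_comm]
  · rw [hconj, ← Finset.sum_sub_distrib, ← Finset.sum_add_distrib, hsum]
    refine Finset.sum_congr rfl fun i _ => ?_
    rw [← sub_smul, ← h5, ← add_smul, add_sub_cancel]

end FiniteDimensionalCStar

/-! ### Central elements near commutators -/

section Averaging

variable {F : Type*} [CStarAlgebra F] [FiniteDimensional ℂ F]

theorem compactSpace_unitary : CompactSpace (unitary F) := by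
  have : ProperSpace F := FiniteDimensional.proper ℂ F
  refine isCompact_iff_compactSpace.1 (Metric.isCompact_of_isClosed_isBounded isClosed_unitary ?_)
  refine (Metric.isBounded_closedBall (x := (0 : F)) (r := 1)).subset fun u hu => ?_
  rw [mem_closedBall_zero_iff]
  exact norm_le_one_of_mem_unitary hu

/-- In a finite dimensional C⋆-algebra the distance from a central element `z` to the span of the
commutators is `‖z‖`: averaging over the unitary group fixes `z` and annihilates commutators. -/
theorem norm_le_of_central {z c : F} (hz : ∀ x, Commute z x)
    (hc : c ∈ Submodule.span ℂ {c : F | ∃ x y : F, c = x * y - y * x}) {δ : ℝ}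
    (h : ‖z - c‖ ≤ δ) : ‖z‖ ≤ δ := by
  have hK : CompactSpace (unitary F) := compactSpace_unitary
  let : MeasurableSpace (unitary F) := borel _
  have : BorelSpace (unitary F) := ⟨rfl⟩
  let μ : MeasureTheory.Measure (unitary F) := MeasureTheory.Measure.haarMeasure ⊤
  have hμ : MeasureTheory.IsProbabilityMeasure μ := ⟨by
    have := MeasureTheory.Measure.haarMeasure_self (K₀ := (⊤ : TopologicalSpace.PositiveCompacts
      (unitary F)))
    simpa using this⟩
  have hcont : ∀ x : F, Continuous fun u : unitary F => star (u : F) * x * u := fun x => by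
    fun_prop
  have hint : ∀ x : F, MeasureTheory.Integrable (fun u : unitary F => star (u : F) * x * u) μ :=
    fun x => (hcont x).integrable_of_hasCompactSupport (HasCompactSupport.of_compactSpace _)
  let E : F →ₗ[ℂ] F := {
    toFun := fun x => ∫ u : unitary F, star (u : F) * x * u ∂μ
    map_add' := fun x y => by
      rw [← MeasureTheory.integral_add (hint x) (hint y)]
      simp only [mul_add, add_mul]
    map_smul' := fun t x => by
      rw [RingHom.id_apply, ← MeasureTheory.integral_smul]
      simp only [mul_smul_comm, smul_mul_assoc] }
  have hE : ∀ x, E x = ∫ u : unitary F, star (u : F) * x * u ∂μ := fun x => rfl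
  have hnorm : ∀ x, ‖E x‖ ≤ ‖x‖ := fun x => by
    rw [hE]
    refine (MeasureTheory.norm_integral_le_of_norm_le_const (C := ‖x‖) ?_).trans_eq (by simp)
    refine Filter.Eventually.of_forall fun u => ?_
    rw [CStarRing.norm_mul_coe_unitary]
    have h1 := CStarRing.norm_coe_unitary_mul (star u) x
    rw [Unitary.coe_star] at h1
    exact h1.le
  have hEz : E z = z := by
    rw [hE]
    have h1 : ∀ u : unitary F, star (u : F) * z * u = z := fun u => by
      rw [mul_assoc, (hz _).eq, ← mul_assoc, Unitary.coe_star_mul_self, one_mul]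
    simp only [h1, MeasureTheory.integral_const, MeasureTheory.probReal_univ, one_smul]
  have hcomm_unitary : ∀ (x : F) (w : unitary F), E (x * w) = E (w * x) := fun x w => by
    rw [hE, hE]
    rw [← MeasureTheory.integral_mul_left_eq_self (μ := μ)
      (fun u : unitary F => star (u : F) * (x * w) * u) (star w)]
    refine MeasureTheory.integral_congr_ae (Filter.Eventually.of_forall fun u => ?_)
    have h1 : (w : F) * star (w : F) = 1 := Unitary.coe_mul_star_self w
    simp only [Submonoid.coe_mul, Unitary.coe_star, star_mul, star_star]
    calc star (u : F) * w * (x * w) * (star (w : F) * u)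
        = star (u : F) * w * x * (w * star (w : F)) * u := by simp only [mul_assoc]
      _ = star (u : F) * (w * x) * u := by rw [h1]; simp only [mul_assoc, one_mul]
  have hcomm : ∀ x y : F, E (x * y) = E (y * x) := fun x y => by
    have hy : y ∈ Submodule.span ℂ (unitary F : Set F) := by
      rw [CStarAlgebra.span_unitary]; trivial
    induction hy using Submodule.span_induction with
    | mem w hw => exact hcomm_unitary x ⟨w, hw⟩
    | zero => simp
    | add a b _ _ ha hb => rw [mul_add, add_mul, map_add, map_add, ha, hb]
    | smul t a _ ha => rw [mul_smul_comm, smul_mul_assoc, map_smul, map_smul, ha]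
  have hEc : E c = 0 := by
    clear h
    induction hc using Submodule.span_induction with
    | mem w hw =>
      obtain ⟨x, y, rfl⟩ := hw
      rw [map_sub, hcomm, sub_self]
    | zero => simp
    | add a b _ _ ha hb => rw [map_add, ha, hb, add_zero]
    | smul t a _ ha => rw [map_smul, ha, smul_zero]
  calc ‖z‖ = ‖E (z - c)‖ := by rw [map_sub, hEz, hEc, sub_zero]
    _ ≤ ‖z - c‖ := hnorm _
    _ ≤ δ := h

end Averaging

/-! ### The unit of a finite dimensional C⋆-algebra -/

/-- The unit is a cluster point of an approximate unit in the compact unit ball. -/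
theorem exists_unit_of_finiteDimensional (F : Type*) [NonUnitalCStarAlgebra F]
    [FiniteDimensional ℂ F] : ∃ e : F, ∀ x, e * x = x ∧ x * e = x := by
  let : PartialOrder F := CStarAlgebra.spectralOrder F
  have : StarOrderedRing F := CStarAlgebra.spectralOrderedRing F
  have : ProperSpace F := FiniteDimensional.proper ℂ F
  have hl := CStarAlgebra.increasingApproximateUnit F
  let f : Ultrafilter F := Ultrafilter.of (CStarAlgebra.approximateUnit F)
  have hf : (f : Filter F) ≤ CStarAlgebra.approximateUnit F := Ultrafilter.of_le _
  obtain ⟨e, -, he⟩ := (isCompact_closedBall (0 : F) 1).ultrafilter_le_nhds f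
    (by
      rw [Filter.le_principal_iff]
      refine hf ?_
      filter_upwards [hl.eventually_norm] with x hx
      simpa using hx)
  refine ⟨e, fun x => ⟨?_, ?_⟩⟩
  · have h1 : Filter.Tendsto (fun y => y * x) f (𝓝 (e * x)) :=
      ((continuous_mul_const x).tendsto e).mono_left he
    exact tendsto_nhds_unique h1 ((hl.tendsto_mul_right x).mono_left hf)
  · have h1 : Filter.Tendsto (fun y => x * y) f (𝓝 (x * e)) :=
      ((continuous_const_mul x).tendsto e).mono_left he
    exact tendsto_nhds_unique h1 ((hl.tendsto_mul_left x).mono_left hf)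

/-- The given structure of a finite dimensional C⋆-algebra underlies one with a unit. -/
theorem exists_cstarAlgebra_of_finiteDimensional (F : Type*) [inst : NonUnitalCStarAlgebra F]
    [FiniteDimensional ℂ F] :
    ∃ S : CStarAlgebra F, @CStarAlgebra.toNonUnitalCStarAlgebra F S = inst := by
  obtain ⟨e, he⟩ := exists_unit_of_finiteDimensional F
  let R : NormedRing F :=
    { (inferInstance : NonUnitalNormedRing F) with
      one := e
      one_mul := fun x => (he x).1
      mul_one := fun x => (he x).2 }
  let Alg : Algebra ℂ F := Algebra.ofModule (fun t x y => smul_mul_assoc t x y)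
    (fun t x y => mul_smul_comm t x y)
  let S : CStarAlgebra F :=
    { R, Alg, inst with
      norm_smul_le := fun t x => (norm_smul t x).le }
  exact ⟨S, rfl⟩

/-! ### Order zero maps on sequences of finite dimensional C⋆-algebras -/

section OrderZeroUnit

variable {N : Type u} {B : Type v} [NonUnitalCStarAlgebra N] [NonUnitalCStarAlgebra B]
  [PartialOrder N] [PartialOrder B] [StarOrderedRing N] [StarOrderedRing B]

theorem IsContractiveOrderZero.map_mul_map_eq_zero_of_isSelfAdjoint {φ : N →CP B}
    (hφ : IsContractiveOrderZero φ) {p c : N} (hp : 0 ≤ p) (hc : IsSelfAdjoint c)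
    (hpc : p * c = 0) : φ p * φ c = 0 := by
  have h1 : p * c⁺ = p * c⁻ := by
    rw [← sub_eq_zero, ← mul_sub, CFC.posPart_sub_negPart c hc, hpc]
  have h2 : p * c⁺ = 0 := by
    have h3 : p * c⁺ * c⁺ = 0 := by
      rw [h1, mul_assoc, CFC.negPart_mul_posPart, mul_zero]
    rw [← CStarRing.mul_star_self_eq_zero_iff, star_mul, (CFC.posPart_nonneg c).isSelfAdjoint.star_eq,
      ← mul_assoc, h3, zero_mul]
  rw [← CFC.posPart_sub_negPart c hc, map_sub, mul_sub,
    hφ.orderZero _ _ hp (CFC.posPart_nonneg c) h2,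
    hφ.orderZero _ _ hp (CFC.negPart_nonneg c) (h1 ▸ h2), sub_zero]

theorem IsContractiveOrderZero.map_mul_map_eq_zero {φ : N →CP B}
    (hφ : IsContractiveOrderZero φ) {p c : N} (hp : 0 ≤ p) (hpc : p * c = 0) (hcp : c * p = 0) :
    φ p * φ c = 0 := by
  have h1 : p * star c = 0 := by
    have := congrArg star hcp
    rwa [star_mul, hp.isSelfAdjoint.star_eq, star_zero] at this
  have h2 := hφ.map_mul_map_eq_zero_of_isSelfAdjoint hp (realPart c).2 (by
    rw [realPart_apply_coe, mul_smul_comm, mul_add, hpc, h1, add_zero, smul_zero])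
  have h3 := hφ.map_mul_map_eq_zero_of_isSelfAdjoint hp (imaginaryPart c).2 (by
    rw [imaginaryPart_apply_coe, mul_smul_comm, mul_smul_comm, mul_sub, hpc, h1, sub_zero,
      smul_zero, smul_zero])
  rw [← realPart_add_I_smul_imaginaryPart c, map_add, map_smul, mul_add, mul_smul_comm, h2, h3,
    smul_zero, add_zero]

/-- Both sides equal `φ p * φ (p * a)`, as `φ` preserves the orthogonality of `p` and `a - p * a`
and of `e - p` and `p * a`. -/
theorem IsContractiveOrderZero.map_projection_mul {φ : N →CP B}
    (hφ : IsContractiveOrderZero φ) {e p a : N} (he : ∀ x, e * x = x ∧ x * e = x)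
    (hp : IsStarProjection p) (hpa : Commute p a) : φ p * φ a = φ e * φ (p * a) := by
  have hstar : star e = e := by
    have h := (he (star e)).1
    calc star e = e * star e := h.symm
      _ = star (e * star e) := by rw [star_mul, star_star]
      _ = e := by rw [h, star_star]
  have hpe : IsStarProjection (e - p) := by
    refine ⟨?_, ?_⟩
    · rw [IsIdempotentElem, sub_mul, mul_sub, mul_sub, (he e).1, (he p).1, (he p).2, hp.1.eq]
      abel
    · rw [IsSelfAdjoint, star_sub, hstar, hp.2.star_eq]
  have h1 : φ p * φ (a - p * a) = 0 := by
    refine hφ.map_mul_map_eq_zero hp.nonneg ?_ ?_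
    · rw [mul_sub, ← mul_assoc, hp.1.eq, sub_self]
    · rw [sub_mul, hpa.eq, mul_assoc, hp.1.eq, sub_self]
  have h2 : φ (e - p) * φ (p * a) = 0 := by
    refine hφ.map_mul_map_eq_zero hpe.nonneg ?_ ?_
    · rw [sub_mul, (he _).1, ← mul_assoc, hp.1.eq, sub_self]
    · rw [mul_sub, (he _).2, hpa.eq, mul_assoc, hp.1.eq, sub_self]
  rw [map_sub, mul_sub, sub_eq_zero] at h1
  rw [map_sub, sub_mul, sub_eq_zero] at h2
  rw [h1, h2]

end OrderZeroUnit

section SequenceAlgebra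

variable {F : ℕ → Type u} [∀ n, CStarAlgebra (F n)]

/-- A bounded sequence, as an element of `∏ F n`. -/
def boundedSeq (x : ∀ n, F n) {C : ℝ} (h : ∀ n, ‖x n‖ ≤ C) : lp F ∞ :=
  ⟨x, memℓp_infty ⟨C, by rintro _ ⟨n, rfl⟩; exact h n⟩⟩

theorem norm_one_le_one (n : ℕ) : ‖(1 : F n)‖ ≤ 1 :=
  norm_le_one_of_mem_unitary (one_mem _)

variable (F) in
/-- The unit of `∏ F n`. -/
def oneSeq : lp F ∞ := boundedSeq (fun _ => 1) norm_one_le_one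

theorem oneSeq_mul (x : lp F ∞) : oneSeq F * x = x := lp.ext (funext fun n => one_mul (x n))

theorem mul_oneSeq (x : lp F ∞) : x * oneSeq F = x := lp.ext (funext fun n => mul_one (x n))

theorem isSelfAdjoint_oneSeq : IsSelfAdjoint (oneSeq F) :=
  lp.ext (funext fun _ => star_one _)

variable (F) in
/-- The unit of `∏ F n / ⨁ F n`. -/
def seqUnit : SeqAlg F := SeqAlg.mk (oneSeq F)

theorem seqUnit_mul (x : SeqAlg F) : seqUnit F * x = x ∧ x * seqUnit F = x := by
  obtain ⟨x, rfl⟩ := SeqAlg.mk_surjective x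
  rw [seqUnit, ← SeqAlg.mk_mul, ← SeqAlg.mk_mul, oneSeq_mul, mul_oneSeq]
  exact ⟨rfl, rfl⟩

theorem norm_le_one_of_isStarProjection {E : Type*} [NonUnitalCStarAlgebra E] {p : E}
    (hp : IsStarProjection p) :
    ‖p‖ ≤ 1 := by
  have h := CStarRing.norm_star_mul_self (x := p)
  rw [hp.2.star_eq, hp.1.eq] at h
  nlinarith [norm_nonneg p]

variable [∀ n, FiniteDimensional ℂ (F n)]

/-- Entrywise spectral approximation of a bounded self-adjoint sequence: the projections
correspond to the intervals `[jδ, (j + 1)δ)`. -/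
theorem exists_spectral_approx {x : lp F ∞} (hx : IsSelfAdjoint x) {δ : ℝ} (hδ : 0 < δ) :
    ∃ (J : Finset ℤ) (P : ℤ → lp F ∞), (∀ j, IsStarProjection (P j)) ∧
      (∀ j y, Commute x y → Commute (P j) y) ∧
      ‖x - ∑ j ∈ J, ((δ * j : ℝ) : ℂ) • P j‖ ≤ δ := by
  have hxn : ∀ n, IsSelfAdjoint (x n) := fun n => congrArg (fun y : lp F ∞ => y n) hx.star_eq
  let S : ℤ → Set ℝ := fun j => {t | ⌊t / δ⌋ = j}
  let p : ℤ → ∀ n, F n := fun j n => cfc ((S j).indicator (fun _ => (1 : ℝ))) (x n)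
  have hp : ∀ j n, IsStarProjection (p j n) := fun j n => isStarProjection_cfc_indicator _ _
  obtain ⟨K, hK⟩ := exists_nat_gt (‖x‖ / δ + 1)
  refine ⟨Finset.Icc (-K : ℤ) K, fun j => boundedSeq (p j) fun n =>
    norm_le_one_of_isStarProjection (hp j n), fun j => ⟨?_, ?_⟩, fun j y hy => ?_, ?_⟩
  · exact lp.ext (funext fun n => (hp j n).1.eq)
  · exact lp.ext (funext fun n => (hp j n).2.star_eq)
  · refine lp.ext (funext fun n => ?_)
    exact (hxn n).commute_cfc (congrArg (fun z : lp F ∞ => z n) hy.eq) _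
  · refine lp.norm_le_of_forall_le hδ.le fun n => ?_
    have h1 : (x - ∑ j ∈ Finset.Icc (-K : ℤ) K, ((δ * j : ℝ) : ℂ) • boundedSeq (p j) fun n =>
        norm_le_one_of_isStarProjection (hp j n)) n =
        cfc (fun t : ℝ => t - δ * ⌊t / δ⌋) (x n) := by
      have h2 : (x - ∑ j ∈ Finset.Icc (-K : ℤ) K, ((δ * j : ℝ) : ℂ) • boundedSeq (p j) fun n =>
          norm_le_one_of_isStarProjection (hp j n)) n =
          x n - ∑ j ∈ Finset.Icc (-K : ℤ) K, (δ * j : ℝ) • p j n := by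
        rw [lp.coeFn_sub, Pi.sub_apply, lp.coeFn_sum, Finset.sum_apply]
        rfl
      have h3 : ∑ j ∈ Finset.Icc (-K : ℤ) K, (δ * j : ℝ) • p j n =
          cfc (fun t => ∑ j ∈ Finset.Icc (-K : ℤ) K,
            (δ * j : ℝ) * (S j).indicator (fun _ => (1 : ℝ)) t) (x n) := by
        have h5 := cfc_sum (R := ℝ) (fun (j : ℤ) t => (δ * j : ℝ) *
          (S j).indicator (fun _ => (1 : ℝ)) t) (x n) (Finset.Icc (-K : ℤ) K)
          (fun j _ => continuousOn_spectrum_real _ _)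
        rw [show (fun t => ∑ j ∈ Finset.Icc (-K : ℤ) K,
            (δ * j : ℝ) * (S j).indicator (fun _ => (1 : ℝ)) t) =
            ∑ j ∈ Finset.Icc (-K : ℤ) K, fun t => (δ * j : ℝ) *
              (S j).indicator (fun _ => (1 : ℝ)) t from
            funext fun t => by simp only [Finset.sum_apply], h5]
        refine Finset.sum_congr rfl fun j _ => ?_
        exact (cfc_const_mul (δ * j : ℝ) _ (x n) (continuousOn_spectrum_real _ _)).symm
      rw [h2, h3]
      nth_rewrite 1 [← cfc_id ℝ (x n) (hxn n)]
      rw [← cfc_sub _ _ (x n) (continuousOn_spectrum_real _ _) (continuousOn_spectrum_real _ _)]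
      refine cfc_congr fun t ht => ?_
      have ht' : |t| ≤ ‖x‖ := by
        refine (spectrum.norm_le_norm_mul_of_mem ht).trans ?_
        refine (mul_le_of_le_one_right (norm_nonneg _) (norm_one_le_one n)).trans ?_
        exact lp.norm_apply_le_norm ENNReal.top_ne_zero x n
      have h4 : ⌊t / δ⌋ ∈ Finset.Icc (-K : ℤ) K := by
        have h5 : |t / δ| ≤ ‖x‖ / δ := by rw [abs_div, abs_of_pos hδ]; gcongr
        have h6 := abs_le.1 h5
        rw [Finset.mem_Icc]
        constructor
        · refine Int.le_floor.2 ?_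
          push_cast
          linarith
        · have : (⌊t / δ⌋ : ℝ) ≤ K := (Int.floor_le _).trans (by linarith)
          exact_mod_cast this
      simp only [id_eq]
      rw [Finset.sum_eq_single ⌊t / δ⌋]
      · simp [S]
      · intro j _ hj
        rw [Set.indicator_of_notMem, mul_zero]
        exact fun h => hj h.symm
      · exact fun h => absurd h4 h
    rw [h1]
    refine norm_cfc_le hδ.le fun t _ => ?_
    have h2 := Int.floor_le (t / δ)
    have h3 := Int.lt_floor_add_one (t / δ)
    rw [le_div_iff₀ hδ] at h2
    rw [div_lt_iff₀ hδ] at h3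
    rw [Real.norm_eq_abs, abs_le]
    constructor <;> nlinarith

variable {B : Type v} [NonUnitalCStarAlgebra B] [PartialOrder B] [StarOrderedRing B]

/-- An order zero map `φ` is multiplicative on commuting elements, up to the factor `φ 1`. -/
theorem IsContractiveOrderZero.map_mul_map_of_commute {φ : SeqAlg F →CP B}
    (hφ : IsContractiveOrderZero φ) {x y : lp F ∞} (hx : IsSelfAdjoint x) (hxy : Commute x y) :
    φ (SeqAlg.mk x) * φ (SeqAlg.mk y) = φ (seqUnit F) * φ (SeqAlg.mk (x * y)) := by
  let Φ : lp F ∞ → B := fun z => φ (SeqAlg.mk z) * φ (SeqAlg.mk y) -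
    φ (seqUnit F) * φ (SeqAlg.mk (z * y))
  have hzero : ∀ P, IsStarProjection P → Commute P y → Φ P = 0 := fun P hP hPy => by
    refine sub_eq_zero.2 ?_
    rw [SeqAlg.mk_mul]
    refine hφ.map_projection_mul seqUnit_mul ⟨?_, ?_⟩ ?_
    · rw [IsIdempotentElem, ← SeqAlg.mk_mul, hP.1.eq]
    · rw [IsSelfAdjoint, ← SeqAlg.mk_star, hP.2.star_eq]
    · rw [Commute, SemiconjBy, ← SeqAlg.mk_mul, hPy.eq, SeqAlg.mk_mul]
  have hadd : ∀ a b, Φ (a + b) = Φ a + Φ b := fun a b => by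
    simp only [Φ, map_add, add_mul, mul_add]; abel
  have hsmul : ∀ (c : ℂ) a, Φ (c • a) = c • Φ a := fun c a => by
    simp only [Φ, map_smul, smul_mul_assoc, mul_smul_comm, smul_sub]
  let Ψ : lp F ∞ →ₗ[ℂ] B := ⟨⟨Φ, hadd⟩, hsmul⟩
  have hbound : ∀ z, ‖Ψ z‖ ≤ 2 * ‖y‖ * ‖z‖ := fun z => by
    have h1 : ∀ w : lp F ∞, ‖φ (SeqAlg.mk w)‖ ≤ ‖w‖ := fun w =>
      (hφ.contractive _).trans (SeqAlg.norm_mk_le w)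
    have h0 : ‖φ (seqUnit F)‖ ≤ 1 := (h1 _).trans
      (lp.norm_le_of_forall_le zero_le_one norm_one_le_one)
    calc ‖Ψ z‖ ≤ ‖φ (SeqAlg.mk z) * φ (SeqAlg.mk y)‖ + ‖φ (seqUnit F) * φ (SeqAlg.mk (z * y))‖ :=
          norm_sub_le _ _
      _ ≤ ‖z‖ * ‖y‖ + 1 * (‖z‖ * ‖y‖) := by
          refine add_le_add ?_ ?_
          · exact (norm_mul_le _ _).trans (mul_le_mul (h1 z) (h1 y) (norm_nonneg _) (norm_nonneg _))
          · exact (norm_mul_le _ _).trans (mul_le_mul h0 ((h1 _).trans (norm_mul_le z y))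
              (norm_nonneg _) zero_le_one)
      _ = _ := by ring
  have hmain : ‖Ψ x‖ ≤ 0 := by
    refine le_of_forall_pos_le_add fun ε hε => ?_
    have hδ : 0 < ε / (2 * ‖y‖ + 1) := by positivity
    obtain ⟨J, P, hP, hc, hn⟩ := exists_spectral_approx hx hδ
    have h1 : Ψ (∑ j ∈ J, ((ε / (2 * ‖y‖ + 1) * j : ℝ) : ℂ) • P j) = 0 := by
      rw [map_sum]
      refine Finset.sum_eq_zero fun j _ => ?_
      rw [map_smul]
      exact (congrArg _ (hzero (P j) (hP j) (hc j y hxy))).trans (smul_zero _)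
    have h2 := hbound (x - ∑ j ∈ J, ((ε / (2 * ‖y‖ + 1) * j : ℝ) : ℂ) • P j)
    rw [map_sub, h1, sub_zero] at h2
    calc ‖Ψ x‖ ≤ 2 * ‖y‖ * (ε / (2 * ‖y‖ + 1)) := h2.trans (by gcongr)
      _ ≤ (2 * ‖y‖ + 1) * (ε / (2 * ‖y‖ + 1)) := by gcongr; linarith
      _ = 0 + ε := by rw [zero_add]; field_simp
  exact sub_eq_zero.1 (norm_le_zero_iff.1 hmain)

end SequenceAlgebra

/-! ### Implementing symmetries by unitaries -/

section Rotation

variable {E : Type*} [CStarAlgebra E]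

/-- The two sides vanish to first order at the end points `t = ±1`. -/
theorem norm_one_add_exp_le {t : ℝ} (ht : |t| ≤ 1) :
    ‖1 + Complex.exp (-(Complex.I * Real.pi * t))‖ ≤ Real.pi * (1 - t ^ 2) := by
  have hpi : Complex.exp (Real.pi * Complex.I) = -1 := Complex.exp_pi_mul_I
  have key : ∀ y : ℝ, 0 ≤ y → ‖1 - Complex.exp (Complex.I * (y * Real.pi : ℝ))‖ ≤ y * Real.pi :=
    fun y hy => by
      rw [norm_sub_rev]
      refine Real.norm_exp_I_mul_ofReal_sub_one_le.trans_eq ?_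
      rw [Real.norm_eq_abs, abs_of_nonneg (mul_nonneg hy Real.pi_pos.le)]
  have h1 := abs_le.1 ht
  rcases le_total 0 t with h | h
  · have e1 : Complex.exp (-(Complex.I * Real.pi * t)) =
        -Complex.exp (Complex.I * ((1 - t) * Real.pi : ℝ)) := by
      have : -(Complex.I * Real.pi * t) = Complex.I * ((1 - t) * Real.pi : ℝ) -
          Real.pi * Complex.I := by push_cast; ring
      rw [this, Complex.exp_sub, hpi, div_neg, div_one]
    rw [e1, ← sub_eq_add_neg]
    refine (key (1 - t) (by linarith)).trans ?_
    nlinarith [Real.pi_pos, mul_nonneg h (by linarith : 0 ≤ 1 - t)]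
  · have e1 : ‖1 + Complex.exp (-(Complex.I * Real.pi * t))‖ =
        ‖1 - Complex.exp (Complex.I * ((1 + t) * Real.pi : ℝ))‖ := by
      have e2 : Complex.exp (-(Complex.I * Real.pi * t)) =
          -(Complex.exp (Complex.I * ((1 + t) * Real.pi : ℝ)))⁻¹ := by
        have : -(Complex.I * Real.pi * t) = Real.pi * Complex.I -
            Complex.I * ((1 + t) * Real.pi : ℝ) := by push_cast; ring
        rw [this, Complex.exp_sub, hpi, neg_div, one_div]
      have e3 : ‖Complex.exp (Complex.I * ((1 + t) * Real.pi : ℝ))‖ = 1 := by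
        rw [mul_comm, Complex.norm_exp_ofReal_mul_I]
      rw [e2, ← sub_eq_add_neg]
      have e4 := Complex.exp_ne_zero (Complex.I * ((1 + t) * Real.pi : ℝ))
      have e5 : 1 - (Complex.exp (Complex.I * ((1 + t) * Real.pi : ℝ)))⁻¹ =
          -((Complex.exp (Complex.I * ((1 + t) * Real.pi : ℝ)))⁻¹ *
            (1 - Complex.exp (Complex.I * ((1 + t) * Real.pi : ℝ)))) := by
        field_simp
        ring
      rw [e5, norm_neg, norm_mul, norm_inv, e3, inv_one, one_mul]
    rw [e1]
    refine (key (1 + t) (by linarith)).trans ?_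
    nlinarith [Real.pi_pos, mul_nonneg (neg_nonneg.2 h) (by linarith : 0 ≤ 1 + t)]

/-- The function `1 + e^{-iπt}` is dominated on `[-1, 1]` by a multiple of `1 - t²`. -/
theorem norm_mul_one_add_exp_le {σ : E} (hσ : IsSelfAdjoint σ) (h1 : ‖σ‖ ≤ 1) (β : E) :
    ‖β * (1 + NormedSpace.exp (-((Complex.I * Real.pi) • σ)))‖ ≤
      Real.pi * ‖β * (1 - σ * σ)‖ := by
  have hn : IsStarNormal σ := hσ.isStarNormal
  have hspec : ∀ z ∈ spectrum ℂ σ, ∃ t : ℝ, z = t ∧ |t| ≤ 1 := fun z hz => by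
    refine ⟨z.re, hσ.mem_spectrum_eq_re hz, ?_⟩
    have h2 := spectrum.norm_le_norm_mul_of_mem hz
    have h3 : ‖(1 : E)‖ ≤ 1 := norm_le_one_of_mem_unitary (one_mem _)
    have h4 : ‖z‖ ≤ 1 := h2.trans ((mul_le_of_le_one_right (norm_nonneg _) h3).trans h1)
    exact (Complex.abs_re_le_norm z).trans h4
  let f : ℂ → ℂ := fun z => 1 + Complex.exp (-(Complex.I * Real.pi) * z)
  have hf : Continuous f := by fun_prop
  have hexp : 1 + NormedSpace.exp (-((Complex.I * Real.pi) • σ)) = cfc f σ := by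
    have e1 : cfc (fun z : ℂ => Complex.exp (-(Complex.I * Real.pi) * z)) σ =
        NormedSpace.exp (-((Complex.I * Real.pi) • σ)) := by
      rw [← neg_smul, ← CFC.complex_exp_eq_normedSpace_exp (a := (-(Complex.I * Real.pi)) • σ),
        ← cfc_comp_const_mul (-(Complex.I * Real.pi)) Complex.exp σ]
    rw [← e1, ← cfc_const_one ℂ σ, ← cfc_add σ (fun _ => 1) _]
  have hpoly : 1 - σ * σ = cfc (fun z : ℂ => 1 - z * z) σ := by
    rw [cfc_sub (fun _ : ℂ => (1 : ℂ)) (fun z => z * z) σ, cfc_const_one ℂ σ,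
      cfc_mul (fun z : ℂ => z) (fun z => z) σ, cfc_id' ℂ σ]
  refine le_of_forall_pos_le_add fun ε hε => ?_
  -- up to `δ`, the function factors through `1 - t²` with a factor bounded by `π`
  obtain ⟨δ, hδdef⟩ : ∃ δ : ℝ, δ = ε / (Real.pi * ‖β‖ + 1) := ⟨_, rfl⟩
  have hδ : 0 < δ := hδdef ▸ by positivity
  let k : ℂ → ℂ := fun z => f z / (1 - z * z + δ)
  have hden : ∀ t : ℝ, |t| ≤ 1 → 0 < 1 - t * t + δ := fun t ht => by
    have : t * t ≤ 1 := by nlinarith [abs_mul_abs_self t, abs_nonneg t]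
    linarith
  have hk : ContinuousOn k (spectrum ℂ σ) := by
    refine hf.continuousOn.div (by fun_prop) fun z hz => ?_
    obtain ⟨t, rfl, ht⟩ := hspec z hz
    have := (hden t ht).ne'
    exact_mod_cast this
  have hft : ∀ t : ℝ, |t| ≤ 1 → ‖f t‖ ≤ Real.pi * (1 - t * t) := fun t ht => by
    have := norm_one_add_exp_le ht
    rw [sq] at this
    simpa only [f, neg_mul] using this
  have hkn : ‖cfc k σ‖ ≤ Real.pi := by
    refine norm_cfc_le Real.pi_pos.le fun z hz => ?_
    obtain ⟨t, rfl, ht⟩ := hspec z hz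
    have e1 : ((1 : ℂ) - t * t + δ) = ((1 - t * t + δ : ℝ) : ℂ) := by push_cast; ring
    simp only [k]
    rw [e1, norm_div, Complex.norm_real, Real.norm_eq_abs, abs_of_pos (hden t ht),
      div_le_iff₀ (hden t ht)]
    refine (hft t ht).trans ?_
    gcongr
    linarith
  have herr : ‖cfc f σ - (1 - σ * σ) * cfc k σ‖ ≤ Real.pi * δ := by
    rw [hpoly, ← cfc_mul _ _ σ (by fun_prop) hk, ← cfc_sub f (fun z => (1 - z * z) * k z) σ
      hf.continuousOn (ContinuousOn.mul (f := fun z => 1 - z * z) (by fun_prop) hk)]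
    refine norm_cfc_le (by positivity) fun z hz => ?_
    obtain ⟨t, rfl, ht⟩ := hspec z hz
    have e1 : ((1 : ℂ) - t * t + δ) = ((1 - t * t + δ : ℝ) : ℂ) := by push_cast; ring
    have e2 : f t - (1 - (t : ℂ) * t) * k t = f t * ((δ / (1 - t * t + δ) : ℝ) : ℂ) := by
      have e3 : ((1 : ℂ) - t * t + δ) ≠ 0 := by
        rw [e1]
        exact_mod_cast (hden t ht).ne'
      simp only [k]
      rw [Complex.ofReal_div, ← e1, mul_div_assoc', mul_div_assoc', eq_div_iff e3, sub_mul,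
        div_mul_cancel₀ _ e3]
      ring
    rw [e2, norm_mul, Complex.norm_real, Real.norm_eq_abs,
      abs_of_pos (div_pos hδ (hden t ht)), mul_div_assoc', div_le_iff₀ (hden t ht)]
    have := hft t ht
    calc ‖f t‖ * δ ≤ (Real.pi * (1 - t * t)) * δ := by gcongr
      _ ≤ Real.pi * δ * (1 - t * t + δ) := by nlinarith [Real.pi_pos, mul_pos Real.pi_pos hδ]
  rw [hexp]
  calc ‖β * cfc f σ‖ = ‖β * (1 - σ * σ) * cfc k σ +
        β * (cfc f σ - (1 - σ * σ) * cfc k σ)‖ := by congr 1; noncomm_ring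
    _ ≤ ‖β * (1 - σ * σ)‖ * ‖cfc k σ‖ + ‖β‖ * ‖cfc f σ - (1 - σ * σ) * cfc k σ‖ :=
        (norm_add_le _ _).trans (add_le_add (norm_mul_le _ _) (norm_mul_le _ _))
    _ ≤ ‖β * (1 - σ * σ)‖ * Real.pi + ‖β‖ * (Real.pi * δ) := by gcongr
    _ ≤ Real.pi * ‖β * (1 - σ * σ)‖ + ε := by
        have : ‖β‖ * (Real.pi * δ) ≤ ε := by
          rw [hδdef]
          rw [mul_div_assoc', mul_div_assoc', div_le_iff₀ (by positivity)]
          nlinarith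
        linarith

/-- If `σ` commutes with `β₀` and anticommutes with `β₁`, conjugation by `e^{iπσ/2}` comes close to
changing the sign of `β₁`, provided that `σ² = 1` approximately on the support of `β₁`. -/
theorem norm_conj_exp_sub_le (σ : selfAdjoint E) (h1 : ‖(σ : E)‖ ≤ 1) {β₀ β₁ : E}
    (h₀ : Commute (σ : E) β₀) (h₁ : (σ : E) * β₁ = -(β₁ * σ)) :
    ‖(selfAdjoint.expUnitary ((Real.pi / 2) • σ) : E) * (β₀ + β₁) *
      star (selfAdjoint.expUnitary ((Real.pi / 2) • σ) : E) - (β₀ - β₁)‖ ≤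
      Real.pi * ‖β₁ * (1 - σ * σ)‖ := by
  let +nondep : NormedAlgebra ℚ E := .restrictScalars ℚ ℂ _
  set W := selfAdjoint.expUnitary ((Real.pi / 2) • σ) with hW
  set y : E := Complex.I • ((Real.pi / 2) • (σ : E)) with hy
  have hWy : (W : E) = NormedSpace.exp y := rfl
  have hWs : star (W : E) = NormedSpace.exp (-y) := by
    rw [hWy, NormedSpace.star_exp]
    congr 1
    rw [hy, star_smul, star_smul, σ.2.star_eq, Complex.star_def, Complex.conj_I, neg_smul]
    simp
  have hyσ : y = (Complex.I * (Real.pi / 2 : ℝ)) • (σ : E) := by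
    rw [hy, ← Complex.coe_smul, smul_smul]
  have e0 : (W : E) * β₀ = β₀ * W := by
    rw [hWy, hyσ]
    exact ((h₀.smul_left _).exp_left).eq
  have e1 : (W : E) * β₁ = β₁ * star (W : E) := by
    rw [hWs, hWy]
    have : SemiconjBy β₁ (-y) y := by
      rw [SemiconjBy, hyσ, smul_mul_assoc, h₁, mul_neg, smul_neg, mul_smul_comm]
    exact this.exp_right.eq.symm
  have e2 : star (W : E) * star (W : E) = NormedSpace.exp (-((Complex.I * Real.pi) • (σ : E))) := by
    rw [hWs, ← NormedSpace.exp_add_of_commute (Commute.refl _)]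
    congr 1
    rw [hyσ, ← neg_add, ← add_smul]
    congr 2
    push_cast
    ring
  have e3 : (W : E) * star (W : E) = 1 := Unitary.coe_mul_star_self W
  have e4 : (W : E) * (β₀ + β₁) * star (W : E) - (β₀ - β₁) =
      β₁ * (1 + NormedSpace.exp (-((Complex.I * Real.pi) • (σ : E)))) := by
    rw [← e2, mul_add, add_mul, e0, e1, mul_assoc, e3, mul_assoc]
    noncomm_ring
  rw [e4]
  exact norm_mul_one_add_exp_le σ.2 h1 β₁

end Rotation

section RegularisedInverse

variable {B : Type v} [NonUnitalCStarAlgebra B]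

/-- A regularised inverse `G` of `h`, commuting with everything that commutes with `h`: the product
`h * G` is an approximate unit on `h`. -/
theorem exists_regularised_inverse {h : B} (hh : IsSelfAdjoint h) {δ : ℝ} (hδ : 0 < δ) :
    ∃ G : B, IsSelfAdjoint G ∧ (∀ x, Commute h x → Commute G x) ∧ ‖h * G‖ ≤ 1 ∧
      ‖h - h * (h * G * (h * G))‖ ≤ δ := by
  let g : ℝ → ℝ := fun t => t / max |t| δ ^ 2
  have hmax : ∀ t : ℝ, 0 < max |t| δ := fun t => lt_max_of_lt_right hδ
  have hg : Continuous g := by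
    refine continuous_id.div (by fun_prop) fun t => (pow_pos (hmax t) 2).ne'
  have hg0 : g 0 = 0 := by simp [g]
  have htg : ∀ t, |t * g t| ≤ 1 := fun t => by
    simp only [g]
    rw [mul_div_assoc', abs_div, abs_of_pos (pow_pos (hmax t) 2), div_le_one (pow_pos (hmax t) 2),
      abs_mul, sq]
    exact mul_self_le_mul_self (abs_nonneg _) (le_max_left _ _)
  have htg' : ∀ t, |t - t * (t * g t * (t * g t))| ≤ δ := fun t => by
    rcases le_total δ |t| with h1 | h1
    · have h0 : t ≠ 0 := fun h0 => by rw [h0, abs_zero] at h1; linarith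
      have : t * g t = 1 := by
        simp only [g]
        rw [max_eq_left h1, sq_abs]
        field_simp
      rw [this]
      simp [hδ.le]
    · have h3 := abs_le.1 (htg t)
      have h4 : 0 ≤ t * g t * (t * g t) := mul_self_nonneg _
      have h5 : t * g t * (t * g t) ≤ 1 := by nlinarith
      have : t - t * (t * g t * (t * g t)) = t * (1 - t * g t * (t * g t)) := by ring
      rw [this, abs_mul, abs_of_nonneg (by linarith : 0 ≤ 1 - t * g t * (t * g t))]
      calc |t| * (1 - t * g t * (t * g t)) ≤ |t| * 1 := by gcongr; linarith
        _ ≤ δ := by linarith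
  clear_value g
  have hid : cfcₙ (fun t : ℝ => t) h = h := cfcₙ_id' ℝ h
  have hk : h * cfcₙ g h = cfcₙ (fun t => t * g t) h := by
    rw [cfcₙ_mul (fun t : ℝ => t) g h (by fun_prop) rfl (by fun_prop) hg0, hid]
  refine ⟨cfcₙ g h, cfcₙ_predicate g h, fun x hx => hh.commute_cfcₙ hx g, ?_, ?_⟩
  · rw [hk]
    exact norm_cfcₙ_le fun t _ => htg t
  · have e1 : h - h * (h * cfcₙ g h * (h * cfcₙ g h)) =
        cfcₙ (fun t => t - t * (t * g t * (t * g t))) h := by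
      rw [cfcₙ_sub (fun t : ℝ => t) (fun t => t * (t * g t * (t * g t))) h (by fun_prop) rfl
          (by fun_prop) (by simp),
        cfcₙ_mul (fun t : ℝ => t) (fun t => t * g t * (t * g t)) h (by fun_prop) rfl
          (by fun_prop) (by simp),
        cfcₙ_mul (fun t : ℝ => t * g t) (fun t => t * g t) h (by fun_prop) (by simp)
          (by fun_prop) (by simp), ← hk, hid]
    rw [e1]
    exact norm_cfcₙ_le fun t _ => htg' t

/-- If `S² = h²`, then `h⁻¹ S`, suitably regularised, approximately squares to `1` on the elements
`β` with `β² ∈ h B`. A rotation by this element changes the sign of such `β` if they anticommute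
with `S`. -/
theorem exists_conj_exp_sub_le {h S β₀ β₁ c : B} (hh : IsSelfAdjoint h) (hS : IsSelfAdjoint S)
    (hβ₁ : IsSelfAdjoint β₁) (hhS : Commute h S) (hhβ₀ : Commute h β₀) (hhβ₁ : Commute h β₁)
    (hSβ₀ : Commute S β₀) (hSβ₁ : S * β₁ = -(β₁ * S)) (hSS : S * S = h * h)
    (hββ : β₁ * β₁ = h * c) {ε : ℝ} (hε : 0 < ε) :
    ∃ q : selfAdjoint B, ‖(selfAdjoint.expUnitary (UnitaryZero.inrSelfAdjoint q) :
      Unitization ℂ B) * ((β₀ + β₁ : B) : Unitization ℂ B) *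
      star (selfAdjoint.expUnitary (UnitaryZero.inrSelfAdjoint q) : Unitization ℂ B) -
      ((β₀ - β₁ : B) : Unitization ℂ B)‖ ≤ ε := by
  obtain ⟨δ, hδ, hδε⟩ : ∃ δ > 0, Real.pi ^ 2 * (2 * (δ * ‖c‖)) ≤ ε ^ 2 := by
    refine ⟨ε ^ 2 / (Real.pi ^ 2 * (2 * ‖c‖) + 1), by positivity, ?_⟩
    rw [div_mul_eq_mul_div, mul_div_assoc', mul_div_assoc', div_le_iff₀ (by positivity)]
    nlinarith [sq_nonneg ε]
  obtain ⟨G, hG, hGc, hkn, hkk⟩ := exists_regularised_inverse hh hδ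
  have hGS : Commute G S := hGc S hhS
  have hGh : Commute G h := hGc h (Commute.refl h)
  have hσ : IsSelfAdjoint (G * S) := by
    rw [IsSelfAdjoint, star_mul, hS.star_eq, hG.star_eq, hGS.eq]
  have hk : IsSelfAdjoint (h * G) := by
    rw [IsSelfAdjoint, star_mul, hh.star_eq, hG.star_eq, hGh.eq]
  have hσσ : G * S * (G * S) = h * G * (h * G) := by
    rw [hGS.symm.mul_mul_mul_comm, hSS, ← hGh.symm.mul_mul_mul_comm, hGh.eq]
  have hσn : ‖G * S‖ ≤ 1 := by
    have h1 := CStarRing.norm_star_mul_self (x := G * S)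
    rw [hσ.star_eq, hσσ] at h1
    have h2 : ‖h * G * (h * G)‖ ≤ 1 := (norm_mul_le _ _).trans (by nlinarith [norm_nonneg (h * G)])
    nlinarith [norm_nonneg (G * S)]
  set k : B := h * G with hkdef
  have hkh : Commute k h := (Commute.refl h).mul_left hGh
  have hσβ₀ : Commute (G * S) β₀ := (hGc β₀ hhβ₀).mul_left hSβ₀
  have hσβ₁ : G * S * β₁ = -(β₁ * (G * S)) := by
    rw [mul_assoc, hSβ₁, mul_neg, ← mul_assoc, (hGc β₁ hhβ₁).eq, mul_assoc]
  have hy : ‖β₁ - β₁ * (k * k)‖ ^ 2 ≤ 2 * (δ * ‖c‖) := by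
    have h1 := CStarRing.norm_star_mul_self (x := β₁ - β₁ * (k * k))
    have h2 : star (β₁ - β₁ * (k * k)) * (β₁ - β₁ * (k * k)) =
        (h - h * (k * k)) * c - (h - h * (k * k)) * c * (k * k) := by
      have h3 : k * k * h = h * (k * k) := (hkh.mul_left hkh).eq
      rw [star_sub, star_mul, star_mul, hk.star_eq, hβ₁.star_eq, sub_mul, mul_sub, mul_sub,
        ← mul_assoc β₁, hββ, mul_assoc (k * k), hββ, mul_assoc (k * k), ← mul_assoc β₁, hββ,
        ← mul_assoc (k * k), ← mul_assoc (k * k), ← mul_assoc (k * k) h, h3, sub_mul, sub_mul]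
      abel
    rw [h2] at h1
    rw [sq, ← h1]
    have h4 : ‖(h - h * (k * k)) * c‖ ≤ δ * ‖c‖ := (norm_mul_le _ _).trans (by gcongr)
    have h5 : ‖k * k‖ ≤ 1 := (norm_mul_le _ _).trans (by nlinarith [norm_nonneg k])
    calc _ ≤ ‖(h - h * (k * k)) * c‖ + ‖(h - h * (k * k)) * c * (k * k)‖ := norm_sub_le _ _
      _ ≤ δ * ‖c‖ + δ * ‖c‖ * 1 := by
          refine add_le_add h4 ((norm_mul_le _ _).trans ?_)
          gcongr
      _ = _ := by ring
  have hmain := norm_conj_exp_sub_le (UnitaryZero.inrSelfAdjoint (⟨G * S, hσ⟩ : selfAdjoint B))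
    (β₀ := (β₀ : Unitization ℂ B)) (β₁ := (β₁ : Unitization ℂ B))
    ((Unitization.norm_inr (𝕜 := ℂ) (G * S)).trans_le hσn)
    (by
      change ((G * S : B) : Unitization ℂ B) * β₀ = β₀ * ((G * S : B) : Unitization ℂ B)
      rw [← Unitization.inr_mul, ← Unitization.inr_mul, hσβ₀.eq])
    (by
      change ((G * S : B) : Unitization ℂ B) * β₁ = -(β₁ * ((G * S : B) : Unitization ℂ B))
      rw [← Unitization.inr_mul, ← Unitization.inr_mul, hσβ₁, Unitization.inr_neg])
  refine ⟨(Real.pi / 2) • ⟨G * S, hσ⟩, ?_⟩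
  have e1 : UnitaryZero.inrSelfAdjoint ((Real.pi / 2) • (⟨G * S, hσ⟩ : selfAdjoint B)) =
      (Real.pi / 2) • UnitaryZero.inrSelfAdjoint ⟨G * S, hσ⟩ :=
    Subtype.ext (Unitization.inr_smul ℂ (Real.pi / 2) (G * S))
  rw [e1, Unitization.inr_add, Unitization.inr_sub]
  refine hmain.trans ?_
  have e2 : (β₁ : Unitization ℂ B) * (1 - (UnitaryZero.inrSelfAdjoint (⟨G * S, hσ⟩ :
      selfAdjoint B) : Unitization ℂ B) * (UnitaryZero.inrSelfAdjoint (⟨G * S, hσ⟩ :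
      selfAdjoint B) : Unitization ℂ B)) = ((β₁ - β₁ * (k * k) : B) : Unitization ℂ B) := by
    change (β₁ : Unitization ℂ B) * (1 - ((G * S : B) : Unitization ℂ B) *
      ((G * S : B) : Unitization ℂ B)) = _
    rw [← Unitization.inr_mul, hσσ, mul_sub, mul_one, ← Unitization.inr_mul,
      ← Unitization.inr_sub]
  rw [e2, Unitization.norm_inr]
  refine abs_le_of_sq_le_sq' ?_ hε.le |>.2
  rw [mul_pow]
  exact (mul_le_mul_of_nonneg_left hy (by positivity)).trans hδε

end RegularisedInverse

section OrderZeroSequences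

variable {F : ℕ → Type u} [∀ n, CStarAlgebra (F n)] [∀ n, FiniteDimensional ℂ (F n)]
  {B : Type v} [NonUnitalCStarAlgebra B] [PartialOrder B] [StarOrderedRing B]
  {φ : SeqAlg F →CP B}

namespace IsContractiveOrderZero

variable (hφ : IsContractiveOrderZero φ)
include hφ

theorem commute_map_unit {x : lp F ∞} (hx : IsSelfAdjoint x) :
    Commute (φ (seqUnit F)) (φ (SeqAlg.mk x)) := by
  have h := hφ.map_mul_map_of_commute (y := oneSeq F) hx (by
    rw [Commute, SemiconjBy, oneSeq_mul, mul_oneSeq])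
  rw [mul_oneSeq] at h
  exact h.symm

theorem commute_map {x y : lp F ∞} (hx : IsSelfAdjoint x) (hy : IsSelfAdjoint y)
    (hxy : Commute x y) : Commute (φ (SeqAlg.mk x)) (φ (SeqAlg.mk y)) := by
  rw [Commute, SemiconjBy, hφ.map_mul_map_of_commute hx hxy,
    hφ.map_mul_map_of_commute hy hxy.symm, hxy.eq]

theorem map_mul_map_add {x y : lp F ∞} (hx : IsSelfAdjoint x) (hy : IsSelfAdjoint y) :
    φ (SeqAlg.mk x) * φ (SeqAlg.mk y) + φ (SeqAlg.mk y) * φ (SeqAlg.mk x) =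
      φ (seqUnit F) * φ (SeqAlg.mk (x * y + y * x)) := by
  have h1 := hφ.map_mul_map_of_commute hx (Commute.refl x)
  have h2 := hφ.map_mul_map_of_commute hy (Commute.refl y)
  have h3 := hφ.map_mul_map_of_commute (hx.add hy) (Commute.refl (x + y))
  simp only [add_mul, mul_add, map_add] at h3 ⊢
  rw [h1, h2] at h3
  have h4 := sub_eq_zero.2 h3
  rw [← sub_eq_zero, ← h4]
  abel

/-- A symmetry `s` acts on the range of an order zero map approximately as a unitary exponential:
with `h = φ 1`, the self-adjoint element `h⁻¹ φ s`, suitably regularised, approximately squares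
to `1` on the range of `φ`. -/
theorem exists_conj_map {s b : lp F ∞} (hs : IsSelfAdjoint s) (hss : s * s = oneSeq F)
    (hb : IsSelfAdjoint b) {ε : ℝ} (hε : 0 < ε) :
    ∃ q : selfAdjoint B, ‖(selfAdjoint.expUnitary (UnitaryZero.inrSelfAdjoint q) :
      Unitization ℂ B) * ((φ (SeqAlg.mk b) : B) : Unitization ℂ B) *
      star (selfAdjoint.expUnitary (UnitaryZero.inrSelfAdjoint q) : Unitization ℂ B) -
      ((φ (SeqAlg.mk (s * b * s)) : B) : Unitization ℂ B)‖ ≤ ε := by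
  set b₀ : lp F ∞ := (2⁻¹ : ℂ) • (b + s * b * s) with hb₀def
  set b₁ : lp F ∞ := (2⁻¹ : ℂ) • (b - s * b * s) with hb₁def
  have hsbs : IsSelfAdjoint (s * b * s) := by
    rw [IsSelfAdjoint, star_mul, star_mul, hs.star_eq, hb.star_eq, mul_assoc]
  have h2 : IsSelfAdjoint (2⁻¹ : ℂ) := by simp [IsSelfAdjoint]
  have hb₀ : IsSelfAdjoint b₀ := h2.smul (hb.add hsbs)
  have hb₁ : IsSelfAdjoint b₁ := h2.smul (hb.sub hsbs)
  have hs1 : s * (s * b * s) = b * s := by rw [← mul_assoc, ← mul_assoc, hss, oneSeq_mul]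
  have hs2 : s * b * s * s = s * b := by rw [mul_assoc, hss, mul_oneSeq]
  have hc₀ : Commute s b₀ := by
    rw [Commute, SemiconjBy, hb₀def, mul_smul_comm, smul_mul_assoc, mul_add, add_mul, hs1, hs2,
      add_comm]
  have hc₁ : s * b₁ + b₁ * s = 0 := by
    rw [hb₁def, mul_smul_comm, smul_mul_assoc, mul_sub, sub_mul, hs1, hs2, ← smul_add]
    simp
  have hsum : b = b₀ + b₁ := by rw [hb₀def, hb₁def]; module
  have hdiff : s * b * s = b₀ - b₁ := by rw [hb₀def, hb₁def]; module
  set h : B := φ (seqUnit F) with hhdef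
  set β₀ : B := φ (SeqAlg.mk b₀) with hβ₀def
  set β₁ : B := φ (SeqAlg.mk b₁) with hβ₁def
  set S : B := φ (SeqAlg.mk s) with hSdef
  have hmk : ∀ {x : lp F ∞}, IsSelfAdjoint x → IsSelfAdjoint (φ (SeqAlg.mk x)) := fun hx =>
    IsSelfAdjoint.map (show IsSelfAdjoint (SeqAlg.mk _) by
      rw [IsSelfAdjoint, ← SeqAlg.mk_star, hx.star_eq]) φ
  have hh : IsSelfAdjoint h := hmk isSelfAdjoint_oneSeq
  have hS : IsSelfAdjoint S := hmk hs
  have hhS : Commute h S := hφ.commute_map_unit hs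
  have hhβ₀ : Commute h β₀ := hφ.commute_map_unit hb₀
  have hhβ₁ : Commute h β₁ := hφ.commute_map_unit hb₁
  have hSβ₀ : Commute S β₀ := hφ.commute_map hs hb₀ hc₀
  have hSβ₁ : S * β₁ = -(β₁ * S) := by
    rw [eq_neg_iff_add_eq_zero, hSdef, hβ₁def, hφ.map_mul_map_add hs hb₁, hc₁, map_zero, map_zero,
      mul_zero]
  have hSS : S * S = h * h := by
    rw [hSdef, hφ.map_mul_map_of_commute hs (Commute.refl s), hss]
    rfl
  have hββ : β₁ * β₁ = h * φ (SeqAlg.mk (b₁ * b₁)) :=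
    hφ.map_mul_map_of_commute hb₁ (Commute.refl b₁)
  obtain ⟨q, hq⟩ := exists_conj_exp_sub_le hh hS (hmk hb₁) hhS hhβ₀ hhβ₁ hSβ₀ hSβ₁ hSS hββ hε
  refine ⟨q, ?_⟩
  rw [hdiff, hsum, map_add, map_add, map_sub, map_sub]
  exact hq

end IsContractiveOrderZero

end OrderZeroSequences

/-! ### Reduction of a self-adjoint element of trace zero -/

section SequenceDecomposition

variable {F : ℕ → Type u} [∀ n, CStarAlgebra (F n)] [∀ n, FiniteDimensional ℂ (F n)]

/-- Entrywise decomposition of a bounded self-adjoint sequence into a central sequence and a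
difference of elements conjugate by a product of two symmetries. -/
theorem exists_seq_central_add_sub_conj {x : lp F ∞} (hx : IsSelfAdjoint x) :
    ∃ z b s t : lp F ∞, IsSelfAdjoint z ∧ (∀ n a, Commute (z n) a) ∧ IsSelfAdjoint b ∧
      IsSelfAdjoint s ∧ s * s = oneSeq F ∧ IsSelfAdjoint t ∧ t * t = oneSeq F ∧
      Commute b (s * (t * b * t) * s) ∧ x = z + (b - s * (t * b * t) * s) := by
  have hxn : ∀ n, IsSelfAdjoint (x n) := fun n => congrArg (fun y : lp F ∞ => y n) hx.star_eq
  have hxb : ∀ n, ‖x n‖ ≤ ‖x‖ := fun n => lp.norm_apply_le_norm ENNReal.top_ne_zero x n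
  choose z b s t hz hzc hzn hb hbn hs hss ht htt hc hsum using
    fun n => exists_central_add_sub_conj (hxn n)
  have hsym : ∀ (n : ℕ) (y : F n), IsSelfAdjoint y → y * y = 1 → ‖y‖ ≤ 1 := fun n y h1 h2 =>
    norm_le_one_of_mem_unitary (Unitary.mem_iff.2 (by rw [h1.star_eq]; exact ⟨h2, h2⟩))
  refine ⟨boundedSeq z fun n => (hzn n).trans (hxb n),
    boundedSeq b fun n => (hbn n).trans (mul_le_mul_of_nonneg_left (hxb n) zero_le_two),
    boundedSeq s fun n => hsym n _ (hs n) (hss n), boundedSeq t fun n => hsym n _ (ht n) (htt n),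
    lp.ext (funext hz), hzc, lp.ext (funext hb), lp.ext (funext hs), lp.ext (funext hss),
    lp.ext (funext ht), lp.ext (funext htt), lp.ext (funext fun n => (hc n).eq),
    lp.ext (funext hsum)⟩

omit [∀ n, FiniteDimensional ℂ (F n)] in
/-- Every element of the linear span of the commutators of the sequence algebra lifts to a
sequence of elements of the spans of the commutators. -/
theorem exists_lift_span_commutators {c : SeqAlg F}
    (hc : c ∈ Submodule.span ℂ {c : SeqAlg F | ∃ x y : SeqAlg F, c = x * y - y * x}) :
    ∃ d : lp F ∞, SeqAlg.mk d = c ∧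
      ∀ n, d n ∈ Submodule.span ℂ {c : F n | ∃ x y : F n, c = x * y - y * x} := by
  induction hc using Submodule.span_induction with
  | mem c hc =>
    obtain ⟨x, y, rfl⟩ := hc
    obtain ⟨x, rfl⟩ := SeqAlg.mk_surjective x
    obtain ⟨y, rfl⟩ := SeqAlg.mk_surjective y
    exact ⟨x * y - y * x, by rw [map_sub, SeqAlg.mk_mul, SeqAlg.mk_mul],
      fun n => Submodule.subset_span ⟨x n, y n, rfl⟩⟩
  | zero => exact ⟨0, map_zero _, fun n => Submodule.zero_mem _⟩
  | add a b _ _ ha hb =>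
    obtain ⟨d, rfl, hd⟩ := ha
    obtain ⟨d', rfl, hd'⟩ := hb
    exact ⟨d + d', map_add _ _ _, fun n => Submodule.add_mem _ (hd n) (hd' n)⟩
  | smul t a _ ha =>
    obtain ⟨d, rfl, hd⟩ := ha
    exact ⟨t • d, map_smul _ _ _, fun n => Submodule.smul_mem _ t (hd n)⟩

/-- A sequence of central elements that lies in the closed span of the commutators of the sequence
algebra tends to zero. -/
theorem mk_eq_zero_of_central {z : lp F ∞} (hz : ∀ n a, Commute (z n) a)
    (h : universalTrace (SeqAlg F) (SeqAlg.mk z) = 0) : SeqAlg.mk z = 0 := by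
  rw [← norm_le_zero_iff]
  refine le_of_forall_pos_le_add fun ε hε => ?_
  rw [zero_add]
  have h1 : SeqAlg.mk z ∈ closure (Submodule.span ℂ
      {c : SeqAlg F | ∃ x y : SeqAlg F, c = x * y - y * x} : Set (SeqAlg F)) :=
    universalTrace_eq_zero_iff.1 h
  obtain ⟨c, hc, hzc⟩ := Metric.mem_closure_iff.1 h1 (ε / 2) (half_pos hε)
  obtain ⟨d, rfl, hd⟩ := exists_lift_span_commutators hc
  rw [dist_eq_norm, ← map_sub] at hzc
  refine SeqAlg.norm_mk_le_of_eventually hε.le ?_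
  filter_upwards [SeqAlg.eventually_norm_lt (z - d) (half_pos hε)] with n hn
  exact norm_le_of_central (hz n) (hd n) (hn.le.trans (by linarith))

end SequenceDecomposition

section Column

variable {B : Type v} [NonUnitalCStarAlgebra B]

/-- The unitary `e^{iq}` of the unitization. -/
abbrev expInr (q : selfAdjoint B) : unitary (Unitization ℂ B) :=
  selfAdjoint.expUnitary (UnitaryZero.inrSelfAdjoint q)

/-- Data writing self-adjoint elements `a j` as `γ j + (β j - β' j)`, where the `γ j` have sum
zero and commute, `γ j`, `β j` and `β' j` commute for every `j`, and `β' j` is within `ε` of the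
conjugate of `β j` by `e^{i q j} e^{i q' j}`. -/
structure IsColumnDecomposition {k : ℕ} (a : Fin k → B) (ε : ℝ)
    (γ β β' q q' : Fin k → selfAdjoint B) : Prop where
  eq : ∀ j, a j = γ j + (β j - β' j)
  sum : ∑ j, γ j = 0
  comm : ∀ i j, Commute (γ i : B) (γ j)
  comm_left : ∀ j, Commute (γ j : B) (β j)
  comm_right : ∀ j, Commute (γ j : B) (β' j)
  comm_mid : ∀ j, Commute (β j : B) (β' j)
  norm_conj : ∀ j, ‖(expInr (q j) * expInr (q' j) : Unitization ℂ B) * ((β j : B) : Unitization ℂ B) *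
    star (expInr (q j) * expInr (q' j) : Unitization ℂ B) - ((β' j : B) : Unitization ℂ B)‖ ≤ ε

variable [PartialOrder B] [StarOrderedRing B]

/-- The elements `γ j`, `β j` and `β' j` are the images under `φ` of the central part of `x j` and of
the two conjugate parts. -/
theorem exists_isColumnDecomposition_of_unital {F : ℕ → Type u} [∀ n, CStarAlgebra (F n)]
    [∀ n, FiniteDimensional ℂ (F n)] {φ : SeqAlg F →CP B} (hφ : IsContractiveOrderZero φ) {k : ℕ}
    {x : Fin k → SeqAlg F} (hx : ∀ j, IsSelfAdjoint (x j))
    (htr : universalTrace (SeqAlg F) (∑ j, x j) = 0) {ε : ℝ} (hε : 0 < ε) :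
    ∃ γ β β' q q' : Fin k → selfAdjoint B,
      IsColumnDecomposition (fun j => φ (x j)) ε γ β β' q q' := by
  have hlift : ∀ j, ∃ y : lp F ∞, IsSelfAdjoint y ∧ SeqAlg.mk y = x j := fun j => by
    obtain ⟨y, hy⟩ := SeqAlg.mk_surjective (x j)
    refine ⟨(2⁻¹ : ℂ) • (y + star y), ?_, ?_⟩
    · have h2 : IsSelfAdjoint (2⁻¹ : ℂ) := by simp [IsSelfAdjoint]
      exact h2.smul (IsSelfAdjoint.add_star_self y)
    · rw [map_smul, map_add, SeqAlg.mk_star, hy, (hx j).star_eq]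
      module
  choose y hy hyx using hlift
  choose z b s t hz hzc hb hs hss ht htt hc hsum using
    fun j => exists_seq_central_add_sub_conj (hy j)
  have htbt : ∀ j, IsSelfAdjoint (t j * b j * t j) := fun j => by
    rw [IsSelfAdjoint, star_mul, star_mul, (ht j).star_eq, (hb j).star_eq, mul_assoc]
  have hstbts : ∀ j, IsSelfAdjoint (s j * (t j * b j * t j) * s j) := fun j => by
    rw [IsSelfAdjoint, star_mul, star_mul, (hs j).star_eq, (htbt j).star_eq, ← mul_assoc (s j)]
  have hmk : ∀ {x : lp F ∞}, IsSelfAdjoint x → IsSelfAdjoint (φ (SeqAlg.mk x)) := fun hx =>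
    IsSelfAdjoint.map (show IsSelfAdjoint (SeqAlg.mk _) by
      rw [IsSelfAdjoint, ← SeqAlg.mk_star, hx.star_eq]) φ
  have hzcomm : ∀ j (a : lp F ∞), Commute (z j) a := fun j a =>
    lp.ext (funext fun n => (hzc j n (a n)).eq)
  have hconj : ∀ r c : lp F ∞, r * r = oneSeq F →
      universalTrace (SeqAlg F) (SeqAlg.mk (c - r * c * r)) = 0 := fun r c hr => by
    have h1 : c - r * c * r = (c * r) * r - r * (c * r) := by
      rw [mul_assoc c, hr, mul_oneSeq, mul_assoc]
    rw [h1, map_sub, map_sub, SeqAlg.mk_mul, SeqAlg.mk_mul r, universalTrace_mul_comm, sub_self]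
  have hzsum : SeqAlg.mk (∑ j, z j) = 0 := by
    refine mk_eq_zero_of_central (fun n a => ?_) ?_
    · have h1 : (∑ j, z j : lp F ∞) n = ∑ j, z j n := by
        rw [lp.coeFn_sum, Finset.sum_apply]
      rw [h1]
      exact Commute.sum_left _ _ _ fun j _ => hzc j n a
    · rw [map_sum, map_sum, ← htr, map_sum]
      refine Finset.sum_congr rfl fun j _ => ?_
      have h1 := hconj (s j) (t j * b j * t j) (hss j)
      have h2 := hconj (t j) (b j) (htt j)
      rw [← hyx j, hsum j, map_add, map_add]
      have h3 : b j - s j * (t j * b j * t j) * s j = (b j - t j * b j * t j) +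
          (t j * b j * t j - s j * (t j * b j * t j) * s j) := by abel
      rw [h3, map_add, map_add, h1, h2, add_zero, add_zero]
  choose q' hq' using fun j => hφ.exists_conj_map (ht j) (htt j) (hb j) (half_pos hε)
  choose q hq using fun j => hφ.exists_conj_map (hs j) (hss j) (htbt j) (half_pos hε)
  refine ⟨fun j => ⟨φ (SeqAlg.mk (z j)), hmk (hz j)⟩, fun j => ⟨φ (SeqAlg.mk (b j)), hmk (hb j)⟩,
    fun j => ⟨φ (SeqAlg.mk (s j * (t j * b j * t j) * s j)), hmk (hstbts j)⟩, q, q',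
    fun j => ?_, ?_, fun i j => ?_, fun j => ?_, fun j => ?_, fun j => ?_, fun j => ?_⟩
  · change φ (x j) = φ (SeqAlg.mk (z j)) + (φ (SeqAlg.mk (b j)) -
      φ (SeqAlg.mk (s j * (t j * b j * t j) * s j)))
    rw [← hyx j, hsum j, map_add, map_add, map_sub, map_sub]
  · ext
    rw [AddSubgroup.val_finsetSum, ← map_sum, ← map_sum, hzsum, map_zero]
    rfl
  · exact hφ.commute_map (hz i) (hz j) (hzcomm i _)
  · exact hφ.commute_map (hz j) (hb j) (hzcomm j _)
  · exact hφ.commute_map (hz j) (hstbts j) (hzcomm j _)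
  · exact hφ.commute_map (hb j) (hstbts j) (hc j)
  · have h1 : (expInr (q j) : Unitization ℂ B) * expInr (q' j) *
        ((φ (SeqAlg.mk (b j)) : B) : Unitization ℂ B) * star ((expInr (q j) : Unitization ℂ B) *
        expInr (q' j)) - ((φ (SeqAlg.mk (s j * (t j * b j * t j) * s j)) : B) : Unitization ℂ B) =
        (expInr (q j) : Unitization ℂ B) * ((expInr (q' j) : Unitization ℂ B) *
          ((φ (SeqAlg.mk (b j)) : B) : Unitization ℂ B) * star (expInr (q' j) : Unitization ℂ B) -
          ((φ (SeqAlg.mk (t j * b j * t j)) : B) : Unitization ℂ B)) *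
          star (expInr (q j) : Unitization ℂ B) +
        ((expInr (q j) : Unitization ℂ B) *
          ((φ (SeqAlg.mk (t j * b j * t j)) : B) : Unitization ℂ B) *
          star (expInr (q j) : Unitization ℂ B) -
          ((φ (SeqAlg.mk (s j * (t j * b j * t j) * s j)) : B) : Unitization ℂ B)) := by
      rw [star_mul]
      noncomm_ring
    refine (congrArg norm h1).trans_le ((norm_add_le _ _).trans ?_)
    have h2 : ∀ X : Unitization ℂ B, ‖(expInr (q j) : Unitization ℂ B) * X *
        star (expInr (q j) : Unitization ℂ B)‖ = ‖X‖ := fun X => by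
      rw [← Unitary.coe_star, CStarRing.norm_mul_coe_unitary, CStarRing.norm_coe_unitary_mul]
    rw [h2]
    linarith [hq j, hq' j]

theorem exists_isColumnDecomposition {F : ℕ → Type u} [inst : ∀ n, NonUnitalCStarAlgebra (F n)]
    (hF : ∀ n, FiniteDimensional ℂ (F n)) {φ : SeqAlg F →CP B} (hφ : IsContractiveOrderZero φ)
    {k : ℕ} {x : Fin k → SeqAlg F} (hx : ∀ j, IsSelfAdjoint (x j))
    (htr : universalTrace (SeqAlg F) (∑ j, x j) = 0) {ε : ℝ} (hε : 0 < ε) :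
    ∃ γ β β' q q' : Fin k → selfAdjoint B,
      IsColumnDecomposition (fun j => φ (x j)) ε γ β β' q q' := by
  choose S hS using fun n => exists_cstarAlgebra_of_finiteDimensional (F n)
  obtain rfl : (fun n => (S n).toNonUnitalCStarAlgebra) = inst := funext hS
  exact exists_isColumnDecomposition_of_unital hφ hx htr hε

end Column

/-! ### Products of commutators -/

section CommutatorProducts

open scoped commutatorElement

variable {G : Type*} [Group G] {α β : Type*}

/-- `g` is a product of at most `N` commutators. -/
def IsCommutatorProduct (N : ℕ) (g : G) : Prop :=
  ∃ l : List (G × G), l.length ≤ N ∧ g = (l.map fun p => ⁅p.1, p.2⁆).prod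

namespace IsCommutatorProduct

variable {N N' : ℕ} {g g' : G}

theorem one : IsCommutatorProduct N (1 : G) := ⟨[], by simp, by simp⟩

theorem commutator (a b : G) : IsCommutatorProduct 1 ⁅a, b⁆ := ⟨[(a, b)], by simp, by simp⟩

theorem mul (h : IsCommutatorProduct N g) (h' : IsCommutatorProduct N' g') :
    IsCommutatorProduct (N + N') (g * g') := by
  obtain ⟨l, hl, rfl⟩ := h
  obtain ⟨l', hl', rfl⟩ := h'
  exact ⟨l ++ l', by rw [List.length_append]; omega, by rw [List.map_append, List.prod_append]⟩

theorem conj (h : IsCommutatorProduct N g) (a : G) : IsCommutatorProduct N (a * g * a⁻¹) := by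
  obtain ⟨l, hl, rfl⟩ := h
  refine ⟨l.map fun p => (a * p.1 * a⁻¹, a * p.2 * a⁻¹), by rwa [List.length_map], ?_⟩
  rw [List.map_map, ← MulAut.conj_apply, map_list_prod, List.map_map]
  refine congrArg List.prod (List.map_congr_left fun p _ => ?_)
  simp only [Function.comp_apply, MulAut.conj_apply, conjugate_commutatorElement]

theorem exists_eq (h : IsCommutatorProduct N g) (hN : N ≤ N') :
    ∃ v w : Fin N' → G, g = (List.ofFn fun j => v j * w j * (v j)⁻¹ * (w j)⁻¹).prod := by
  obtain ⟨l, hl, rfl⟩ := h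
  have hlen : (l ++ List.replicate (N' - l.length) 1).length = N' := by
    rw [List.length_append, List.length_replicate]; omega
  have hprod : (l.map fun p => ⁅p.1, p.2⁆).prod =
      ((l ++ List.replicate (N' - l.length) 1).map fun p : G × G => ⁅p.1, p.2⁆).prod := by
    simp
  rw [hprod]
  generalize l ++ List.replicate (N' - l.length) 1 = l' at hlen
  subst hlen
  refine ⟨fun j => (l'.get j).1, fun j => (l'.get j).2, ?_⟩
  have h1 : l'.map (fun p => ⁅p.1, p.2⁆) = List.ofFn fun j => (l'.get j).1 * (l'.get j).2 *
      (l'.get j).1⁻¹ * (l'.get j).2⁻¹ := by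
    conv_lhs => rw [← List.ofFn_get l', List.map_ofFn]
    rfl
  rw [h1]

/-- Commutators interspersed in a product may be collected at its left end. -/
theorem prod_map_mul (L : List α) (c ζ : α → G) (hc : ∀ i ∈ L, IsCommutatorProduct N (c i)) :
    ∃ K, IsCommutatorProduct (L.length * N) K ∧
      (L.map fun i => c i * ζ i).prod = K * (L.map ζ).prod := by
  induction L with
  | nil => exact ⟨1, one, by simp⟩
  | cons i L ih =>
    obtain ⟨K, hK, h⟩ := ih fun j hj => hc j (List.mem_cons_of_mem _ hj)
    refine ⟨c i * (ζ i * K * (ζ i)⁻¹), ?_, ?_⟩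
    · rw [List.length_cons, Nat.succ_mul, add_comm]
      exact (hc i List.mem_cons_self).mul (hK.conj _)
    · rw [List.map_cons, List.prod_cons, h, List.map_cons, List.prod_cons]
      group

/-- Two products may be merged entrywise at the cost of one commutator per entry. -/
theorem prod_map_mul_prod_map (L : List α) (c d : α → G) :
    ∃ K, IsCommutatorProduct L.length K ∧
      (L.map c).prod * (L.map d).prod = K * (L.map fun i => c i * d i).prod := by
  induction L with
  | nil => exact ⟨1, one, by simp⟩
  | cons i L ih =>
    obtain ⟨K, hK, h⟩ := ih
    refine ⟨(c i * ⁅(L.map c).prod, d i⁆ * (c i)⁻¹) * ((c i * d i) * K * (c i * d i)⁻¹), ?_, ?_⟩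
    · rw [List.length_cons, add_comm]
      exact ((commutator _ _).conj _).mul (hK.conj _)
    · simp only [List.map_cons, List.prod_cons]
      have h1 : (L.map fun i => c i * d i).prod = K⁻¹ * ((L.map c).prod * (L.map d).prod) := by
        rw [h, inv_mul_cancel_left]
      rw [h1, commutatorElement_def]
      group

/-- Exchanging the order of a double product costs at most one commutator per factor. -/
theorem prod_prod_comm (J : List β) (L : List α) (ζ : α → β → G) :
    ∃ K, IsCommutatorProduct (J.length * L.length) K ∧
      (J.map fun j => (L.map fun i => ζ i j).prod).prod =
        K * (L.map fun i => (J.map fun j => ζ i j).prod).prod := by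
  induction J with
  | nil => exact ⟨1, one, by simp⟩
  | cons j J ih =>
    obtain ⟨K, hK, h⟩ := ih
    obtain ⟨K', hK', h'⟩ := prod_map_mul_prod_map L (fun i => ζ i j)
      (fun i => (J.map fun j => ζ i j).prod)
    refine ⟨((L.map fun i => ζ i j).prod * K * ((L.map fun i => ζ i j).prod)⁻¹) * K', ?_, ?_⟩
    · rw [List.length_cons, Nat.succ_mul]
      exact (hK.conj _).mul hK'
    · simp only [List.map_cons, List.prod_cons]
      rw [h, mul_assoc _ K', ← h']
      group

/-- Collecting one commutator per entry of a double product on the left and exchanging the order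
of the two products costs two commutators per entry. -/
theorem prod_prod_mul (J : List β) (L : List α) (c ζ : α → β → G)
    (hc : ∀ i j, IsCommutatorProduct 1 (c i j)) :
    ∃ K, IsCommutatorProduct (2 * L.length * J.length) K ∧
      (J.map fun j => (L.map fun i => c i j * ζ i j).prod).prod =
        K * (L.map fun i => (J.map fun j => ζ i j).prod).prod := by
  choose K hK h using fun j => prod_map_mul L (fun i => c i j) (fun i => ζ i j)
    fun i _ => hc i j
  obtain ⟨K₁, hK₁, h₁⟩ := prod_map_mul J K (fun j => (L.map fun i => ζ i j).prod) fun j _ => hK j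
  obtain ⟨K₂, hK₂, h₂⟩ := prod_prod_comm J L ζ
  refine ⟨K₁ * K₂, ?_, ?_⟩
  · have : 2 * L.length * J.length = J.length * (L.length * 1) + J.length * L.length := by ring
    rw [this]
    exact hK₁.mul hK₂
  · simp only [h]
    rw [h₁, h₂, mul_assoc]

end IsCommutatorProduct

end CommutatorProducts

/-! ### Estimates for products of exponentials -/

section Estimates

variable {E : Type*} [CStarAlgebra E] {α : Type*}

/-- Duhamel's formula: `t ↦ e^{itx} e^{i(1 - t)y}` has derivative of norm at most `‖x - y‖`. -/
theorem norm_expUnitary_sub_expUnitary_le (x y : selfAdjoint E) :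
    ‖(selfAdjoint.expUnitary x : E) - selfAdjoint.expUnitary y‖ ≤ ‖(x : E) - y‖ := by
  let f : ℝ → E := fun t => NormedSpace.exp (t • (Complex.I • (x : E))) *
    NormedSpace.exp ((1 - t) • (Complex.I • (y : E)))
  have hu : ∀ (t : ℝ) (z : selfAdjoint E), ‖NormedSpace.exp (t • (Complex.I • (z : E)))‖ ≤ 1 :=
    fun t z => by
      rw [smul_comm]
      exact norm_le_one_of_mem_unitary (selfAdjoint.expUnitary (t • z)).2
  have hf : ∀ t : ℝ, HasDerivAt f (NormedSpace.exp (t • (Complex.I • (x : E))) *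
      (Complex.I • ((x : E) - y)) * NormedSpace.exp ((1 - t) • (Complex.I • (y : E)))) t :=
    fun t => by
      have h1 := hasDerivAt_exp_smul_const (𝕂 := ℝ) (Complex.I • (x : E)) t
      have h2 := (hasDerivAt_exp_smul_const' (𝕂 := ℝ) (Complex.I • (y : E)) (1 - t)).scomp t
        ((hasDerivAt_id t).const_sub 1)
      refine (h1.mul h2).congr_deriv ?_
      simp only [Function.comp_apply]
      rw [smul_sub, neg_one_smul]
      noncomm_ring
  have h := norm_image_sub_le_of_norm_deriv_le_segment_01' (f := f) (C := ‖(x : E) - y‖)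
    (fun t _ => (hf t).hasDerivWithinAt) fun t _ => by
      refine (norm_mul_le _ _).trans ?_
      refine (mul_le_of_le_one_right (norm_nonneg _) (hu _ y)).trans ?_
      refine (norm_mul_le _ _).trans ?_
      refine (mul_le_of_le_one_left (norm_nonneg _) (hu _ x)).trans ?_
      rw [norm_smul, Complex.norm_I, one_mul]
  have h1 : f 1 = selfAdjoint.expUnitary x := by
    simp only [f]
    rw [one_smul, sub_self, zero_smul, NormedSpace.exp_zero, mul_one]
    rfl
  have h0 : f 0 = selfAdjoint.expUnitary y := by
    simp only [f]
    rw [zero_smul, NormedSpace.exp_zero, one_mul, sub_zero, one_smul]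
    rfl
  rwa [h1, h0] at h

theorem norm_mul_sub_mul_le (a b c d : unitary E) :
    ‖((a * b : unitary E) : E) - (c * d : unitary E)‖ ≤ ‖(a : E) - c‖ + ‖(b : E) - d‖ := by
  have h1 : ((a * b : unitary E) : E) - (c * d : unitary E) =
      ((a : E) - c) * b + c * ((b : E) - d) := by
    push_cast
    noncomm_ring
  rw [h1]
  refine (norm_add_le _ _).trans_eq ?_
  rw [CStarRing.norm_mul_coe_unitary, CStarRing.norm_coe_unitary_mul]

theorem norm_list_prod_sub_le (L : List α) (a b : α → unitary E) {ε : ℝ}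
    (h : ∀ i ∈ L, ‖(a i : E) - b i‖ ≤ ε) :
    ‖(((L.map a).prod : unitary E) : E) - ((L.map b).prod : unitary E)‖ ≤ L.length * ε := by
  induction L with
  | nil => simp
  | cons i L ih =>
    rw [List.map_cons, List.map_cons, List.prod_cons, List.prod_cons, List.length_cons]
    refine (norm_mul_sub_mul_le _ _ _ _).trans ?_
    rw [Nat.cast_succ]
    linarith [h i List.mem_cons_self, ih fun j hj => h j (List.mem_cons_of_mem _ hj)]

theorem prod_expUnitary_smul (J : List α) (γ : α → selfAdjoint E)
    (hγ : ∀ i j, Commute (γ i : E) (γ j)) (s : ℝ) :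
    (J.map fun j => selfAdjoint.expUnitary (s • γ j)).prod =
      selfAdjoint.expUnitary (s • (J.map γ).sum) := by
  induction J with
  | nil => simp
  | cons j J ih =>
    rw [List.map_cons, List.prod_cons, ih, List.map_cons, List.sum_cons, smul_add]
    refine (Commute.expUnitary_add ?_).symm
    have h1 : Commute (γ j : E) ((J.map γ).sum : selfAdjoint E) := by
      clear ih
      induction J with
      | nil => simp
      | cons l J ih =>
        rw [List.map_cons, List.sum_cons, AddSubgroup.coe_add]
        exact (hγ j l).add_right ih
    exact (h1.smul_left s).smul_right s

theorem prod_expUnitary_smul_eq_one (J : List α) (γ : α → selfAdjoint E)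
    (hγ : ∀ i j, Commute (γ i : E) (γ j)) (hsum : (J.map γ).sum = 0) (s : ℝ) :
    (J.map fun j => selfAdjoint.expUnitary (s • γ j)).prod = 1 := by
  rw [prod_expUnitary_smul J γ hγ, hsum, smul_zero, selfAdjoint.expUnitary_zero]

end Estimates

/-! ### Recursively commuting summands -/

section Trees

variable {E : Type*} [CStarAlgebra E] {α : Type*}

/-- The exponential of a recursively commuting sum is the product of the exponentials of the summands,
in the order of the leaves. -/
theorem LeafTree.NodesCommute.exp_sum {f : α → E} {t : LeafTree α} (h : t.NodesCommute f) :
    NormedSpace.exp (t.leaves.map f).sum =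
      (t.leaves.map fun i => NormedSpace.exp (f i)).prod := by
  let +nondep : NormedAlgebra ℚ E := .restrictScalars ℚ ℂ _
  induction t with
  | leaf a => simp [leaves]
  | node l r hl hr =>
    rw [leaves, List.map_append, List.sum_append, NormedSpace.exp_add_of_commute h.1,
      List.map_append, List.prod_append, hl h.2.1, hr h.2.2]

theorem LeafTree.NodesCommute.map_mul {R : Type*} [NonUnitalRing R] {e : α → R} {a : R}
    (ha : ∀ i, Commute (e i) a) (f : R →+ E) (hf : ∀ x y, Commute x y → Commute (f x) (f y))
    {t : LeafTree α} (h : t.NodesCommute e) : t.NodesCommute fun i => f (e i * a) := by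
  have hsum : ∀ L : List α, (L.map fun i => f (e i * a)).sum = f ((L.map e).sum * a) := fun L => by
    rw [← List.sum_map_mul_right, map_list_sum, List.map_map]
    rfl
  have hcomm : ∀ L : List α, Commute (L.map e).sum a := fun L => by
    induction L with
    | nil => simp
    | cons i L ih =>
      rw [List.map_cons, List.sum_cons]
      exact (ha i).add_left ih
  induction t with
  | leaf a => trivial
  | node l r hl hr =>
    refine ⟨?_, hl h.2.1, hr h.2.2⟩
    rw [hsum, hsum]
    exact hf _ _ ((h.1.mul_right (hcomm _)).mul_left ((hcomm _).symm.mul_right (Commute.refl a)))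

end Trees

/-! ### The factorization in the sequence algebra -/

section ColumnEstimate

open scoped commutatorElement

variable {B : Type v} [NonUnitalCStarAlgebra B]

theorem expInr_add {x y : selfAdjoint B} (h : Commute (x : B) (y : B)) :
    expInr (x + y) = expInr x * expInr y := by
  have h1 : UnitaryZero.inrSelfAdjoint (x + y) =
      UnitaryZero.inrSelfAdjoint x + UnitaryZero.inrSelfAdjoint y :=
    Subtype.ext (Unitization.inr_add ℂ (x : B) (y : B))
  rw [expInr, h1]
  refine Commute.expUnitary_add ?_
  change ((x : B) : Unitization ℂ B) * ((y : B) : Unitization ℂ B) =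
    ((y : B) : Unitization ℂ B) * ((x : B) : Unitization ℂ B)
  rw [← Unitization.inr_mul, ← Unitization.inr_mul, h.eq]

theorem conj_expUnitary {E : Type*} [CStarAlgebra E] (W : unitary E) (x : selfAdjoint E) :
    W * selfAdjoint.expUnitary x * W⁻¹ =
      selfAdjoint.expUnitary ⟨(W : E) * x * star (W : E), x.2.conjugate (W : E)⟩ := by
  let +nondep : NormedAlgebra ℚ E := .restrictScalars ℚ ℂ _
  refine Subtype.ext ?_
  have h := NormedSpace.exp_units_conj (Unitary.toUnits W) (Complex.I • (x : E))
  change (W : E) * NormedSpace.exp (Complex.I • (x : E)) * star (W : E) =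
    NormedSpace.exp (Complex.I • ((W : E) * x * star (W : E)))
  change NormedSpace.exp ((W : E) * (Complex.I • (x : E)) * star (W : E)) =
    (W : E) * NormedSpace.exp (Complex.I • (x : E)) * star (W : E) at h
  rw [← h, mul_smul_comm, smul_mul_assoc]

/-- Up to `ε`, the exponential of `a j` is the product of a commutator of exponentials and of the
exponential of `γ j`. -/
theorem IsColumnDecomposition.norm_sub_le {k : ℕ} {a : Fin k → selfAdjoint B} {ε : ℝ}
    {γ β β' q q' : Fin k → selfAdjoint B}
    (h : IsColumnDecomposition (fun j => (a j : B)) ε γ β β' q q') (j : Fin k) {s : ℝ}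
    (hs : |s| ≤ 1) : ‖(expInr (s • a j) : Unitization ℂ B) -
      (⁅expInr (s • β j), expInr (q j) * expInr (q' j)⁆ * expInr (s • γ j) :
        unitary (Unitization ℂ B))‖ ≤ ε := by
  set W := expInr (q j) * expInr (q' j) with hW
  have hε : 0 ≤ ε := (norm_nonneg _).trans (h.norm_conj j)
  have e1 : s • a j = (s • β j + -(s • β' j)) + s • γ j := by
    ext
    have := h.eq j
    simp only [selfAdjoint.val_smul, AddSubgroup.coe_add, AddSubgroup.coe_neg] at this ⊢
    rw [this]
    module
  have e2 : expInr (s • a j) = expInr (s • β j) * expInr (-(s • β' j)) * expInr (s • γ j) := by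
    rw [e1, expInr_add, expInr_add]
    · exact (((h.comm_mid j).smul_left s).smul_right s).neg_right
    · refine Commute.add_left ?_ (Commute.neg_left ?_)
      · exact (((h.comm_left j).smul_left s).smul_right s).symm
      · exact (((h.comm_right j).smul_left s).smul_right s).symm
  have e3 : expInr (-(s • β j)) = (expInr (s • β j))⁻¹ := by
    rw [eq_inv_iff_mul_eq_one, ← expInr_add (Commute.neg_left (Commute.refl _)), neg_add_cancel,
      expInr]
    have : UnitaryZero.inrSelfAdjoint (0 : selfAdjoint B) = 0 :=
      Subtype.ext (Unitization.inr_zero ℂ)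
    rw [this, selfAdjoint.expUnitary_zero]
  have e4 : ⁅expInr (s • β j), W⁆ = expInr (s • β j) * (W * expInr (-(s • β j)) * W⁻¹) := by
    rw [e3, commutatorElement_def]
    group
  rw [e2, e4, conj_expUnitary]
  refine (norm_mul_sub_mul_le _ _ _ _).trans ?_
  rw [sub_self, norm_zero, add_zero]
  refine (norm_mul_sub_mul_le _ _ _ _).trans ?_
  rw [sub_self, norm_zero, zero_add]
  refine (norm_expUnitary_sub_expUnitary_le _ _).trans ?_
  have e5 : ((UnitaryZero.inrSelfAdjoint (-(s • β' j)) : selfAdjoint (Unitization ℂ B)) :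
      Unitization ℂ B) - (W : Unitization ℂ B) * (UnitaryZero.inrSelfAdjoint (-(s • β j)) :
      selfAdjoint (Unitization ℂ B)) * star (W : Unitization ℂ B) =
      s • ((W : Unitization ℂ B) * ((β j : B) : Unitization ℂ B) * star (W : Unitization ℂ B) -
        ((β' j : B) : Unitization ℂ B)) := by
    change ((-(s • (β' j : B)) : B) : Unitization ℂ B) - (W : Unitization ℂ B) *
      ((-(s • (β j : B)) : B) : Unitization ℂ B) * star (W : Unitization ℂ B) = _
    rw [Unitization.inr_neg, Unitization.inr_neg, Unitization.inr_smul, Unitization.inr_smul,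
      mul_neg, neg_mul, mul_smul_comm, smul_mul_assoc]
    module
  rw [e5, norm_smul, Real.norm_eq_abs]
  exact (mul_le_mul hs (h.norm_conj j) (norm_nonneg _) zero_le_one).trans_eq (one_mul ε)

end ColumnEstimate

section SequenceFactorization

open scoped commutatorElement

variable {A : Type u} [NonUnitalCStarAlgebra A]

/-- The constant sequence of a self-adjoint element. -/
def constSelfAdjoint (h : selfAdjoint A) : selfAdjoint (SeqAlg fun _ : ℕ => A) :=
  ⟨SeqAlg.const (h : A), by
    rw [selfAdjoint.mem_iff, SeqAlg.const, ← SeqAlg.mk_star]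
    exact congrArg SeqAlg.mk (lp.ext (funext fun _ => h.2))⟩

variable [PartialOrder A] [StarOrderedRing A]

/-- The exponential of a constant sequence factors along the leaves of a tree witnessing recursive
commutation. -/
theorem expInr_const_eq_prod {m : ℕ} {D : NuclearDecomposition.{u, v} A m}
    {e : Fin (m + 1) → SeqAlg (fun _ : ℕ => A)} (he : D.IsPartitionOfUnity e)
    {t : LeafTree (Fin (m + 1))} (ht : t.leaves.Perm (List.finRange (m + 1)))
    (hcomm : t.NodesCommute e) (h : selfAdjoint A)
    {x : Fin (m + 1) → selfAdjoint (SeqAlg fun _ : ℕ => A)}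
    (hx : ∀ i, (x i : SeqAlg fun _ : ℕ => A) = D.φ i (D.ψ i (h : A))) (s : ℝ) :
    expInr (s • constSelfAdjoint h) = (t.leaves.map fun i => expInr (s • x i)).prod := by
  let f : (SeqAlg fun _ : ℕ => A) →+ Unitization ℂ (SeqAlg fun _ : ℕ => A) :=
    { toFun := fun y => Complex.I • (s • (y : Unitization ℂ (SeqAlg fun _ : ℕ => A)))
      map_zero' := by rw [Unitization.inr_zero, smul_zero, smul_zero]
      map_add' := fun y z => by rw [Unitization.inr_add, smul_add, smul_add] }
  have hf : ∀ y z, Commute y z → Commute (f y) (f z) := fun y z hyz => by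
    have h1 : Commute (y : Unitization ℂ (SeqAlg fun _ : ℕ => A))
        (z : Unitization ℂ (SeqAlg fun _ : ℕ => A)) := by
      rw [Commute, SemiconjBy, ← Unitization.inr_mul, ← Unitization.inr_mul, hyz.eq]
    exact (((h1.smul_left s).smul_right s).smul_left Complex.I).smul_right Complex.I
  have hexp := (hcomm.map_mul (fun i => he.commute i (h : A)) f hf).exp_sum
  have hsum : (t.leaves.map fun i => f (e i * SeqAlg.const (h : A))).sum =
      f (SeqAlg.const (h : A)) := by
    rw [(ht.map _).sum_eq, ← Fin.sum_univ_def, ← map_sum]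
    congr 1
    exact (Finset.sum_congr rfl fun i _ => (he.φ_ψ i _).symm).trans (D.sum_eq _)
  have hinr : ∀ y : selfAdjoint (SeqAlg fun _ : ℕ => A),
      (expInr (s • y) : Unitization ℂ (SeqAlg fun _ : ℕ => A)) = NormedSpace.exp (f y) := fun y => by
    rw [expInr, selfAdjoint.expUnitary_coe]
    congr 2
    exact Unitization.inr_smul ℂ s _
  refine Subtype.ext ?_
  rw [hinr]
  change NormedSpace.exp (f (SeqAlg.const (h : A))) = _
  rw [← hsum, hexp, SubmonoidClass.coe_list_prod, List.map_map]
  refine congrArg List.prod (List.map_congr_left fun i _ => ?_)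
  rw [Function.comp_apply, hinr, hx, he.φ_ψ]

/-- In the sequence algebra, `∏ j, e^{is ι(h j)}` is uniformly close to a product over `j` and the
leaves `i` of commutators times `e^{is γ i j}`; the product of the `e^{is γ i j}` with the order of
`i` and `j` interchanged is `1`. -/
theorem exists_factorization {m : ℕ} {D : NuclearDecomposition.{u, v} A m}
    {e : Fin (m + 1) → SeqAlg (fun _ : ℕ => A)} (he : D.IsPartitionOfUnity e)
    {t : LeafTree (Fin (m + 1))} (ht : t.leaves.Perm (List.finRange (m + 1)))
    (hcomm : t.NodesCommute e) {k : ℕ} (h : Fin k → selfAdjoint A)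
    (htr : TrEquiv (∑ j, (h j : A)) 0) {η : ℝ} (hη : 0 < η) :
    ∃ γ β q q' : Fin (m + 1) → Fin k → selfAdjoint (SeqAlg fun _ : ℕ => A),
      (∀ s : ℝ, |s| ≤ 1 →
        ‖(((List.finRange k).map fun j => expInr (s • constSelfAdjoint (h j))).prod :
          Unitization ℂ (SeqAlg fun _ : ℕ => A)) -
          (((List.finRange k).map fun j => (t.leaves.map fun i =>
            ⁅expInr (s • β i j), expInr (q i j) * expInr (q' i j)⁆ *
              expInr (s • γ i j)).prod).prod :
            unitary (Unitization ℂ (SeqAlg fun _ : ℕ => A)))‖ ≤ η) ∧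
      ∀ s : ℝ, (t.leaves.map fun i =>
        ((List.finRange k).map fun j => expInr (s • γ i j)).prod).prod = 1 := by
  have hδ : 0 < η / (k * (m + 1) + 1) := by positivity
  have hψ : ∀ i j, IsSelfAdjoint (D.ψ i (h j : A)) := fun i j => IsSelfAdjoint.map (h j).2 (D.ψ i)
  have hφ : ∀ i j, IsSelfAdjoint (D.φ i (D.ψ i (h j : A))) := fun i j => (hψ i j).map (D.φ i)
  have htr' : ∀ i, universalTrace (SeqAlg (D.F i)) (∑ j, D.ψ i (h j : A)) = 0 := fun i => by
    rw [← map_sum]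
    refine (D.ψ_orderZero i).universalTrace_eq_zero ?_
    rw [trEquiv_iff, map_zero] at htr
    exact htr
  choose γ β β' q q' hcol using fun i => exists_isColumnDecomposition (D.finiteDimensional i)
    (D.φ_orderZero i) (hψ i) (htr' i) hδ
  refine ⟨γ, β, q, q', fun s hs => ?_, fun s => ?_⟩
  · have hlen : (t.leaves.length : ℝ) = m + 1 := by
      rw [ht.length_eq, List.length_finRange]
      push_cast
      rfl
    have hrow : ∀ j, ‖((expInr (s • constSelfAdjoint (h j)) :
        unitary (Unitization ℂ (SeqAlg fun _ : ℕ => A))) :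
        Unitization ℂ (SeqAlg fun _ : ℕ => A)) - ((t.leaves.map fun i =>
          ⁅expInr (s • β i j), expInr (q i j) * expInr (q' i j)⁆ * expInr (s • γ i j)).prod :
          unitary (Unitization ℂ (SeqAlg fun _ : ℕ => A)))‖ ≤
        t.leaves.length * (η / (k * (m + 1) + 1)) := fun j => by
      rw [expInr_const_eq_prod he ht hcomm (h j) (x := fun i => ⟨_, hφ i j⟩) (fun i => rfl) s]
      refine norm_list_prod_sub_le _ _ _ fun i _ => ?_
      exact IsColumnDecomposition.norm_sub_le (a := fun j => ⟨_, hφ i j⟩) (hcol i) j hs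
    refine (norm_list_prod_sub_le _ _ _ fun j _ => hrow j).trans ?_
    rw [List.length_finRange, hlen, ← mul_assoc, mul_div_assoc', div_le_iff₀ (by positivity)]
    nlinarith
  · refine List.prod_eq_one fun g hg => ?_
    obtain ⟨i, -, rfl⟩ := List.mem_map.1 hg
    have h1 : ∀ j, expInr (s • γ i j) =
        selfAdjoint.expUnitary (s • UnitaryZero.inrSelfAdjoint (γ i j)) := fun j => by
      rw [expInr]
      congr 1
      exact Subtype.ext (Unitization.inr_smul ℂ s _)
    simp only [h1]
    refine prod_expUnitary_smul_eq_one _ (fun j => UnitaryZero.inrSelfAdjoint (γ i j))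
      (fun j l => ?_) ?_ s
    · change ((γ i j : SeqAlg fun _ : ℕ => A) : Unitization ℂ (SeqAlg fun _ : ℕ => A)) *
        ((γ i l : SeqAlg fun _ : ℕ => A) : Unitization ℂ (SeqAlg fun _ : ℕ => A)) =
        ((γ i l : SeqAlg fun _ : ℕ => A) : Unitization ℂ (SeqAlg fun _ : ℕ => A)) *
        ((γ i j : SeqAlg fun _ : ℕ => A) : Unitization ℂ (SeqAlg fun _ : ℕ => A))
      rw [← Unitization.inr_mul, ← Unitization.inr_mul, ((hcol i).comm j l).eq]
    · rw [← Fin.sum_univ_def]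
      refine Subtype.ext ?_
      rw [AddSubgroup.val_finsetSum]
      have h3 : ∑ j, (γ i j : SeqAlg fun _ : ℕ => A) = 0 := by
        have := congrArg (fun y : selfAdjoint (SeqAlg fun _ : ℕ => A) =>
          (y : SeqAlg fun _ : ℕ => A)) (hcol i).sum
        rwa [AddSubgroup.val_finsetSum] at this
      have h4 := congrArg (Unitization.inrHom ℂ ℂ (SeqAlg fun _ : ℕ => A)) h3
      rw [map_sum, map_zero] at h4
      exact h4

end SequenceFactorization

/-! ### Passing from the sequence algebra to the entries -/

section Transfer

variable {A : Type u} {A' : Type v} [NonUnitalCStarAlgebra A] [NonUnitalCStarAlgebra A']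

/-- The group homomorphism on unitaries induced by a ⋆-homomorphism. -/
def unitaryMap (f : A →⋆ₙₐ[ℂ] A') : unitary (Unitization ℂ A) →* unitary (Unitization ℂ A') where
  toFun u := ⟨Unitization.starMap f u, Unitary.map_mem (Unitization.starMap f) u.2⟩
  map_one' := by ext1; exact map_one (Unitization.starMap f)
  map_mul' u w := by ext1; exact map_mul (Unitization.starMap f) _ _

theorem unitaryMap_expInr (f : A →⋆ₙₐ[ℂ] A') (x : selfAdjoint A) {y : selfAdjoint A'}
    (hy : (y : A') = f x) : unitaryMap f (expInr x) = expInr y := by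
  let +nondep : NormedAlgebra ℚ (Unitization ℂ A) := .restrictScalars ℚ ℂ _
  let +nondep : NormedAlgebra ℚ (Unitization ℂ A') := .restrictScalars ℚ ℂ _
  refine Subtype.ext ?_
  refine (NormedSpace.map_exp (Unitization.starMap f) (map_continuous (Unitization.starMap f))
    _).trans ?_
  rw [map_smul, expInr, selfAdjoint.expUnitary_coe]
  congr 2
  change Unitization.starMap f ((x : A) : Unitization ℂ A) = ((y : A') : Unitization ℂ A')
  rw [Unitization.starMap_inr, hy]

theorem unitaryMap_expInr_smul (f : A →⋆ₙₐ[ℂ] A') (x : selfAdjoint A) {y : selfAdjoint A'}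
    (hy : (y : A') = f x) (s : ℝ) : unitaryMap f (expInr (s • x)) = expInr (s • y) :=
  unitaryMap_expInr f _ (by
    rw [selfAdjoint.val_smul, selfAdjoint.val_smul, hy, ← Complex.coe_smul, ← Complex.coe_smul,
      map_smul])

/-- The quotient map `∏ F n → ∏ F n / ⨁ F n` as a ⋆-homomorphism. -/
def seqMkHom (F : ℕ → Type u) [∀ n, NonUnitalCStarAlgebra (F n)] : lp F ∞ →⋆ₙₐ[ℂ] SeqAlg F where
  toFun := SeqAlg.mk
  map_smul' c x := map_smul SeqAlg.mk c x
  map_zero' := map_zero SeqAlg.mk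
  map_add' := map_add SeqAlg.mk
  map_mul' := SeqAlg.mk_mul
  map_star' := SeqAlg.mk_star

/-- Evaluation of bounded sequences at `n`. -/
def seqEvalHom (F : ℕ → Type u) [∀ n, NonUnitalCStarAlgebra (F n)] (n : ℕ) :
    lp F ∞ →⋆ₙₐ[ℂ] F n where
  toFun x := x n
  map_smul' _ _ := rfl
  map_zero' := rfl
  map_add' _ _ := rfl
  map_mul' _ _ := rfl
  map_star' _ := rfl

theorem norm_starMap_eq (f : A →⋆ₙₐ[ℂ] A') {x : Unitization ℂ A} (hx : x.fst = 0) :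
    ‖Unitization.starMap f x‖ = ‖f x.snd‖ := by
  have h : x = ((x.snd : A) : Unitization ℂ A) := by
    ext
    · exact hx
    · rfl
  rw [h, Unitization.starMap_inr, Unitization.norm_inr]
  rfl

/-- A continuous path in `∏ F n` that is small modulo `⨁ F n` has eventually small entries,
uniformly on `[0, 1]` by compactness. -/
theorem eventually_norm_starMap_le {F : ℕ → Type u} [∀ n, NonUnitalCStarAlgebra (F n)]
    {f : ℝ → Unitization ℂ (lp F ∞)} (hf : Continuous f) (hfst : ∀ s, (f s).fst = 0) {η : ℝ}
    (hη : 0 < η) (h : ∀ s ∈ Set.Icc (0 : ℝ) 1, ‖Unitization.starMap (seqMkHom F) (f s)‖ ≤ η) :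
    ∀ᶠ n in Filter.atTop, ∀ s ∈ Set.Icc (0 : ℝ) 1,
      ‖Unitization.starMap (seqEvalHom F n) (f s)‖ ≤ 3 * η := by
  obtain ⟨T, hT, hcover⟩ := (isCompact_Icc (a := (0 : ℝ)) (b := 1)).elim_nhds_subcover
    (fun s => {r | ‖f r - f s‖ < η}) fun s _ => by
      refine (isOpen_lt (by fun_prop) continuous_const).mem_nhds ?_
      simpa using hη
  have hev : ∀ᶠ n in Filter.atTop, ∀ s ∈ T, ‖Unitization.starMap (seqEvalHom F n) (f s)‖ < 2 * η := by
    rw [Filter.eventually_all_finset]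
    intro s hs
    have h1 := h s (hT s hs)
    rw [norm_starMap_eq _ (hfst s)] at h1
    filter_upwards [SeqAlg.eventually_norm_lt (f s).snd hη] with n hn
    rw [norm_starMap_eq _ (hfst s)]
    have h2 : ‖SeqAlg.mk (f s).snd‖ ≤ η := h1
    have h3 : ‖(seqEvalHom F n) (f s).snd‖ < ‖SeqAlg.mk (f s).snd‖ + η := hn
    linarith
  filter_upwards [hev] with n hn s hs
  obtain ⟨r, hr, hsr⟩ := Set.mem_iUnion₂.1 (hcover hs)
  have h1 : ‖Unitization.starMap (seqEvalHom F n) (f s - f r)‖ ≤ ‖f s - f r‖ :=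
    NonUnitalStarAlgHom.norm_apply_le _ _
  have h2 : ‖f s - f r‖ < η := hsr
  rw [map_sub] at h1
  have h3 := norm_add_le (Unitization.starMap (seqEvalHom F n) (f s) -
    Unitization.starMap (seqEvalHom F n) (f r)) (Unitization.starMap (seqEvalHom F n) (f r))
  rw [sub_add_cancel] at h3
  linarith [hn r hr]

theorem exists_selfAdjoint_lift {F : ℕ → Type u} [∀ n, NonUnitalCStarAlgebra (F n)]
    (x : selfAdjoint (SeqAlg F)) :
    ∃ y : selfAdjoint (lp F ∞), (x : SeqAlg F) = seqMkHom F (y : lp F ∞) := by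
  obtain ⟨y, hy⟩ := SeqAlg.mk_surjective (x : SeqAlg F)
  have h2 : IsSelfAdjoint (2⁻¹ : ℂ) := by simp [IsSelfAdjoint]
  refine ⟨⟨(2⁻¹ : ℂ) • (y + star y), h2.smul (IsSelfAdjoint.add_star_self y)⟩, ?_⟩
  change (x : SeqAlg F) = SeqAlg.mk ((2⁻¹ : ℂ) • (y + star y))
  rw [map_smul, map_add, SeqAlg.mk_star, hy, x.2.star_eq]
  module

end Transfer

/-! ### Block products of exponentials and their trace slopes -/

section Factorization

open scoped commutatorElement

variable {A : Type u} [NonUnitalCStarAlgebra A]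

/-- The product over rows `j` of products over columns `i` of commutators of exponentials times
exponentials of `s γ i j`. -/
def blockProduct {A : Type*} [NonUnitalCStarAlgebra A] {α κ : Type*} (J : List κ) (L : List α)
    (γ β q q' : α → κ → selfAdjoint A) (s : ℝ) : unitary (Unitization ℂ A) :=
  (J.map fun j => (L.map fun i => ⁅expInr (s • β i j), expInr (q i j) * expInr (q' i j)⁆ *
    expInr (s • γ i j)).prod).prod

/-- The product over columns `i` of products over rows `j` of the exponentials of `s γ i j`. -/
def columnProduct {A : Type*} [NonUnitalCStarAlgebra A] {α κ : Type*} (J : List κ) (L : List α)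
    (γ : α → κ → selfAdjoint A) (s : ℝ) : unitary (Unitization ℂ A) :=
  (L.map fun i => (J.map fun j => expInr (s • γ i j)).prod).prod

/-- The product of the exponentials of `s h j`. -/
def rowProduct {A : Type*} [NonUnitalCStarAlgebra A] {κ : Type*} (J : List κ)
    (h : κ → selfAdjoint A) (s : ℝ) : unitary (Unitization ℂ A) :=
  (J.map fun j => expInr (s • h j)).prod

section Naturality

variable {A : Type u} {A' : Type v} [NonUnitalCStarAlgebra A] [NonUnitalCStarAlgebra A']
  (f : A →⋆ₙₐ[ℂ] A') {α κ : Type*} (J : List κ) (L : List α)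

theorem unitaryMap_rowProduct {h : κ → selfAdjoint A} {h' : κ → selfAdjoint A'}
    (hh : ∀ j, (h' j : A') = f (h j)) (s : ℝ) :
    unitaryMap f (rowProduct J h s) = rowProduct J h' s := by
  rw [rowProduct, rowProduct, map_list_prod, List.map_map]
  exact congrArg List.prod (List.map_congr_left fun j _ => unitaryMap_expInr_smul f _ (hh j) s)

theorem unitaryMap_columnProduct {γ : α → κ → selfAdjoint A} {γ' : α → κ → selfAdjoint A'}
    (hγ : ∀ i j, (γ' i j : A') = f (γ i j)) (s : ℝ) :
    unitaryMap f (columnProduct J L γ s) = columnProduct J L γ' s := by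
  rw [columnProduct, columnProduct, map_list_prod, List.map_map]
  exact congrArg List.prod (List.map_congr_left fun i _ => unitaryMap_rowProduct f J (hγ i) s)

theorem unitaryMap_blockProduct {γ β q q' : α → κ → selfAdjoint A}
    {γ₁ β₁ q₁ q₁' : α → κ → selfAdjoint A'} (hγ : ∀ i j, (γ₁ i j : A') = f (γ i j))
    (hβ : ∀ i j, (β₁ i j : A') = f (β i j)) (hq : ∀ i j, (q₁ i j : A') = f (q i j))
    (hq' : ∀ i j, (q₁' i j : A') = f (q' i j)) (s : ℝ) :
    unitaryMap f (blockProduct J L γ β q q' s) = blockProduct J L γ₁ β₁ q₁ q₁' s := by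
  rw [blockProduct, blockProduct, map_list_prod, List.map_map]
  refine congrArg List.prod (List.map_congr_left fun j _ => ?_)
  rw [Function.comp_apply, map_list_prod, List.map_map]
  refine congrArg List.prod (List.map_congr_left fun i _ => ?_)
  rw [Function.comp_apply, map_mul, map_commutatorElement, map_mul,
    unitaryMap_expInr_smul f _ (hβ i j), unitaryMap_expInr f _ (hq i j),
    unitaryMap_expInr f _ (hq' i j), unitaryMap_expInr_smul f _ (hγ i j)]

end Naturality

theorem continuous_expInr_smul (x : selfAdjoint A) : Continuous fun s : ℝ => expInr (s • x) := by
  have h : ∀ s : ℝ, expInr (s • x) =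
      selfAdjoint.expUnitary (s • UnitaryZero.inrSelfAdjoint x) := fun s => by
    rw [expInr]
    congr 1
    exact Subtype.ext (Unitization.inr_smul ℂ s _)
  simp only [h]
  exact selfAdjoint.continuous_expUnitary.comp (by fun_prop)

theorem expInr_mem_unitaryZero (x : selfAdjoint A) : expInr x ∈ UnitaryZero A :=
  (UnitaryZero.expI x).2

section Products

variable {α κ : Type*} (J : List κ) (L : List α) (h : κ → selfAdjoint A)
  (γ β q q' : α → κ → selfAdjoint A)

theorem continuous_rowProduct : Continuous (rowProduct J h) :=
  continuous_list_prod J fun j _ => continuous_expInr_smul (h j)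

theorem continuous_columnProduct : Continuous (columnProduct J L γ) :=
  continuous_list_prod L fun i _ => continuous_rowProduct J (γ i)

theorem continuous_blockProduct : Continuous (blockProduct J L γ β q q') := by
  refine continuous_list_prod J fun j _ => continuous_list_prod L fun i _ => ?_
  simp only [commutatorElement_def]
  have h1 := continuous_expInr_smul (β i j)
  exact (((h1.mul continuous_const).mul h1.inv).mul continuous_const).mul
    (continuous_expInr_smul (γ i j))

theorem rowProduct_mem (s : ℝ) : rowProduct J h s ∈ UnitaryZero A :=
  Subgroup.list_prod_mem _ fun g hg => by
    obtain ⟨j, -, rfl⟩ := List.mem_map.1 hg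
    exact expInr_mem_unitaryZero _

theorem columnProduct_mem (s : ℝ) : columnProduct J L γ s ∈ UnitaryZero A :=
  Subgroup.list_prod_mem _ fun g hg => by
    obtain ⟨i, -, rfl⟩ := List.mem_map.1 hg
    exact rowProduct_mem J (γ i) s

theorem blockProduct_mem (s : ℝ) : blockProduct J L γ β q q' s ∈ UnitaryZero A :=
  Subgroup.list_prod_mem _ fun g hg => by
    obtain ⟨j, -, rfl⟩ := List.mem_map.1 hg
    refine Subgroup.list_prod_mem _ fun g hg => ?_
    obtain ⟨i, -, rfl⟩ := List.mem_map.1 hg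
    have h1 := expInr_mem_unitaryZero (s • β i j)
    have h2 := mul_mem (expInr_mem_unitaryZero (q i j)) (expInr_mem_unitaryZero (q' i j))
    exact mul_mem (mul_mem (mul_mem (mul_mem h1 h2) (inv_mem h1)) (inv_mem h2))
      (expInr_mem_unitaryZero _)

/-- Reordering of the block product: moving all commutators to the left and exchanging rows and
columns costs at most two commutators per block. -/
theorem exists_blockProduct_eq (s : ℝ) : ∃ K : UnitaryZero A,
    IsCommutatorProduct (2 * L.length * J.length) K ∧
      blockProduct J L γ β q q' s = K * columnProduct J L γ s := by
  obtain ⟨K, hK, h1⟩ := IsCommutatorProduct.prod_prod_mul J L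
    (fun i j => ⁅UnitaryZero.expI (s • β i j),
      UnitaryZero.expI (q i j) * UnitaryZero.expI (q' i j)⁆)
    (fun i j => UnitaryZero.expI (s • γ i j)) fun i j => IsCommutatorProduct.commutator _ _
  refine ⟨K, hK, ?_⟩
  have h2 := congrArg (UnitaryZero A).subtype h1
  simp only [map_mul, map_list_prod, List.map_map, Function.comp_def, map_commutatorElement] at h2
  exact h2

end Products

section Slopes

variable {E : Type*} [CStarAlgebra E] {V : Type*} [NormedAddCommGroup V] [NormedSpace ℂ V]
  {T : E →L[ℂ] V} (hT : ∀ x y, T (x * y) = T (y * x))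
include hT

theorem HasTraceSlope.list_prod {α : Type*} (L : List α) {g : α → ℝ → unitary E} {τ : α → V}
    (hg : ∀ i, HasTraceSlope T (fun s => (g i s : E)) (τ i)) :
    HasTraceSlope T (fun s => ((L.map fun i => g i s).prod : unitary E)) (L.map τ).sum := by
  induction L with
  | nil => simpa using HasTraceSlope.one
  | cons i L ih =>
    simp only [List.map_cons, List.prod_cons, List.sum_cons]
    exact (hg i).mul hT ih

theorem HasTraceSlope.commutator {g : ℝ → unitary E} {τ : V}
    (hg : HasTraceSlope T (fun s => (g s : E)) τ) (W : unitary E) :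
    HasTraceSlope T (fun s => (⁅g s, W⁆ : unitary E)) 0 := by
  have h1 := hg.mul hT ((hg.star hT).conj hT W.2)
  rw [add_neg_cancel] at h1
  refine (funext fun s => ?_ : (fun s => ((⁅g s, W⁆ : unitary E) : E)) = _) ▸ h1
  rw [commutatorElement_def, mul_assoc, mul_assoc, ← mul_assoc W]
  rfl

end Slopes

section SlopesOfProducts

variable {α κ : Type*} (J : List κ) (L : List α) (h : κ → selfAdjoint A)
  (γ β q q' : α → κ → selfAdjoint A)

theorem hasTraceSlope_expInr (x : selfAdjoint A) :
    HasTraceSlope (unitizationTrace A) (fun s => (expInr (s • x) : Unitization ℂ A))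
      (Complex.I • universalTrace A (x : A)) := by
  have h1 := HasTraceSlope.exp (UnitaryZero.inrSelfAdjoint x) (unitizationTrace A)
  refine (funext fun s => ?_ : (fun s : ℝ => (expInr (s • x) : Unitization ℂ A)) = _) ▸ h1
  rw [expInr, selfAdjoint.expUnitary_coe]
  congr 2
  exact Unitization.inr_smul ℂ s _

theorem hasTraceSlope_rowProduct :
    HasTraceSlope (unitizationTrace A) (fun s => (rowProduct J h s : Unitization ℂ A))
      (J.map fun j => Complex.I • universalTrace A (h j : A)).sum :=
  HasTraceSlope.list_prod (unitizationTrace_mul_comm) J fun j => hasTraceSlope_expInr (h j)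

theorem hasTraceSlope_columnProduct :
    HasTraceSlope (unitizationTrace A) (fun s => (columnProduct J L γ s : Unitization ℂ A))
      (L.map fun i => (J.map fun j => Complex.I • universalTrace A (γ i j : A)).sum).sum :=
  HasTraceSlope.list_prod (unitizationTrace_mul_comm) L fun i =>
    hasTraceSlope_rowProduct J (γ i)

theorem hasTraceSlope_blockProduct :
    HasTraceSlope (unitizationTrace A) (fun s => (blockProduct J L γ β q q' s : Unitization ℂ A))
      (L.map fun i => (J.map fun j => Complex.I • universalTrace A (γ i j : A)).sum).sum := by
  have hT := unitizationTrace_mul_comm (A := A)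
  have h1 : ∀ i j, HasTraceSlope (unitizationTrace A) (fun s =>
      ((⁅expInr (s • β i j), expInr (q i j) * expInr (q' i j)⁆ * expInr (s • γ i j) :
        unitary (Unitization ℂ A)) : Unitization ℂ A))
      (Complex.I • universalTrace A (γ i j : A)) := fun i j => by
    have h2 := ((hasTraceSlope_expInr (β i j)).commutator hT
      (expInr (q i j) * expInr (q' i j))).mul hT (hasTraceSlope_expInr (γ i j))
    rwa [zero_add] at h2
  have h3 : (L.map fun i => (J.map fun j => Complex.I • universalTrace A (γ i j : A)).sum).sum =
      (J.map fun j => (L.map fun i => Complex.I • universalTrace A (γ i j : A)).sum).sum := by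
    induction L with
    | nil => simp
    | cons i L ih => simp only [List.map_cons, List.sum_cons, ih, List.sum_map_add]
  rw [h3]
  exact HasTraceSlope.list_prod hT J fun j => HasTraceSlope.list_prod hT L fun i => h1 i j

end SlopesOfProducts

end Factorization

end

/-! ### The factorization in `A` -/

theorem mainTheorem11 {A : Type u} [NonUnitalCStarAlgebra A] [PartialOrder A] [StarOrderedRing A]
    (m : ℕ) (hA : HasNuclearDimensionLE A m)
    (D : NuclearDecomposition.{u, v} A m) (e : Fin (m + 1) → SeqAlg (fun _ : ℕ => A))
    (he : D.IsPartitionOfUnity e) (hcomm : RecursivelyCommute e)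
    (k : ℕ) (hk : 1 ≤ k) (h : Fin k → selfAdjoint A)
    (htr : TrEquiv (∑ j, (h j : A)) 0)
    (U : UnitaryZero A) (hU : U = (List.ofFn fun j => UnitaryZero.expI (h j)).prod)
    (ε : ℝ) (hε : 0 < ε) :
    ∃ (v w : Fin (2 * (m + 1) * k + (m + 1) / 2 * (k - 1)) → UnitaryZero A) (c : selfAdjoint A),
      TrEquiv (c : A) 0 ∧ ‖(c : A)‖ < ε ∧
      U = (List.ofFn fun j => v j * w j * (v j)⁻¹ * (w j)⁻¹).prod * UnitaryZero.expI c := by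
  obtain ⟨η, hη, hfinal⟩ := exists_expI_of_norm_path (A := A) ε hε
  obtain ⟨t, ht, htc⟩ := hcomm
  have hη6 : 0 < η / 6 := by positivity
  obtain ⟨γ', β', q', r', happrox, hcolumn⟩ := exists_factorization he ht htc h htr hη6
  choose γ hγ using fun i j => exists_selfAdjoint_lift (γ' i j)
  choose β hβ using fun i j => exists_selfAdjoint_lift (β' i j)
  choose q hq using fun i j => exists_selfAdjoint_lift (q' i j)
  choose r hr using fun i j => exists_selfAdjoint_lift (r' i j)
  let g : Fin k → selfAdjoint (lp (fun _ : ℕ => A) ∞) := fun j =>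
    ⟨⟨fun _ => (h j : A), memℓp_infty ⟨‖(h j : A)‖, by rintro _ ⟨_, rfl⟩; exact le_rfl⟩⟩,
      lp.ext (funext fun _ => (h j).2)⟩
  let J := List.finRange k
  let L := t.leaves
  let F : ℕ → Type u := fun _ => A
  have hfst : ∀ x ∈ UnitaryZero (lp (fun _ : ℕ => A) ∞), ∀ y ∈ UnitaryZero (lp (fun _ : ℕ => A) ∞),
      ((x : Unitization ℂ (lp (fun _ : ℕ => A) ∞)) - y).fst = 0 := fun x hx y hy => by
    change (x : Unitization ℂ (lp (fun _ : ℕ => A) ∞)).fst -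
      (y : Unitization ℂ (lp (fun _ : ℕ => A) ∞)).fst = 0
    rw [hx.2, hy.2, sub_self]
  have hmap : ∀ {A' : Type u} [NonUnitalCStarAlgebra A']
      (f : lp (fun _ : ℕ => A) ∞ →⋆ₙₐ[ℂ] A')
      (x y : unitary (Unitization ℂ (lp (fun _ : ℕ => A) ∞))),
      Unitization.starMap f ((x : Unitization ℂ (lp (fun _ : ℕ => A) ∞)) - y) =
        (unitaryMap f x : Unitization ℂ A') - unitaryMap f y := fun f x y => map_sub _ _ _
  have hev₁ := eventually_norm_starMap_le (F := F)
    (f := fun s => (rowProduct J g s : Unitization ℂ (lp F ∞)) - blockProduct J L γ β q r s)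
    ((continuous_subtype_val.comp (continuous_rowProduct J g)).sub
      (continuous_subtype_val.comp (continuous_blockProduct J L γ β q r)))
    (fun s => hfst _ (rowProduct_mem J g s) _ (blockProduct_mem J L γ β q r s)) hη6
    (fun s hs => by
      rw [hmap, unitaryMap_rowProduct (seqMkHom F) J (h' := fun j => constSelfAdjoint (h j))
          (fun j => rfl) s, unitaryMap_blockProduct (seqMkHom F) J L hγ hβ hq hr]
      exact happrox s (abs_le.2 ⟨by linarith [hs.1], hs.2⟩))
  have hev₂ := eventually_norm_starMap_le (F := F)
    (f := fun s => (columnProduct J L γ s : Unitization ℂ (lp F ∞)) -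
      (1 : unitary (Unitization ℂ (lp F ∞))))
    ((continuous_subtype_val.comp (continuous_columnProduct J L γ)).sub continuous_const)
    (fun s => hfst _ (columnProduct_mem J L γ s) _ (one_mem _)) hη6
    (fun s hs => by
      rw [hmap, unitaryMap_columnProduct (seqMkHom F) J L hγ, columnProduct, hcolumn s, map_one,
        sub_self, norm_zero]
      exact hη6.le)
  obtain ⟨n, hn₁, hn₂⟩ := (hev₁.and hev₂).exists
  -- the entries at `n` of the lifted data
  let ent : selfAdjoint (lp F ∞) → selfAdjoint A := fun x =>
    ⟨seqEvalHom F n (x : lp F ∞), x.2.map (seqEvalHom F n)⟩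
  let R : ℝ → unitary (Unitization ℂ A) := rowProduct J h
  let C : ℝ → unitary (Unitization ℂ A) := columnProduct J L fun i j => ent (γ i j)
  let Bl : ℝ → unitary (Unitization ℂ A) := blockProduct J L (fun i j => ent (γ i j))
    (fun i j => ent (β i j)) (fun i j => ent (q i j)) (fun i j => ent (r i j))
  have hn₁' : ∀ s ∈ Set.Icc (0 : ℝ) 1, ‖(R s : Unitization ℂ A) - Bl s‖ ≤ η / 2 := fun s hs => by
    have h1 := hn₁ s hs
    rw [hmap, unitaryMap_rowProduct (seqEvalHom F n) J (h' := h) (fun j => rfl) s,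
      unitaryMap_blockProduct (seqEvalHom F n) J L (γ₁ := fun i j => ent (γ i j))
        (β₁ := fun i j => ent (β i j)) (q₁ := fun i j => ent (q i j))
        (q₁' := fun i j => ent (r i j)) (fun _ _ => rfl) (fun _ _ => rfl) (fun _ _ => rfl)
        (fun _ _ => rfl)] at h1
    exact h1.trans_eq (by ring)
  have hn₂' : ∀ s ∈ Set.Icc (0 : ℝ) 1, ‖(C s : Unitization ℂ A) - 1‖ ≤ η / 2 := fun s hs => by
    have h1 := hn₂ s hs
    rw [hmap, unitaryMap_columnProduct (seqEvalHom F n) J L (γ' := fun i j => ent (γ i j))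
      (fun _ _ => rfl), map_one] at h1
    exact h1.trans_eq (by ring)
  -- the error path has trace slope zero and stays near the identity
  have hslope : HasTraceSlope (unitizationTrace A)
      (fun s => ((C s * (Bl s)⁻¹ * R s : unitary (Unitization ℂ A)) : Unitization ℂ A)) 0 := by
    have hT := unitizationTrace_mul_comm (A := A)
    have h1 := ((hasTraceSlope_columnProduct J L fun i j => ent (γ i j)).mul hT
      ((hasTraceSlope_blockProduct J L (fun i j => ent (γ i j)) (fun i j => ent (β i j))
        (fun i j => ent (q i j)) (fun i j => ent (r i j))).star hT)).mul hT
      (hasTraceSlope_rowProduct J h)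
    have h2 : (J.map fun j => Complex.I • universalTrace A (h j : A)).sum = 0 := by
      rw [trEquiv_iff, map_zero, map_sum] at htr
      rw [← Fin.sum_univ_def, ← Finset.smul_sum, htr, smul_zero]
    rw [h2, add_zero, add_neg_cancel] at h1
    exact h1
  have hnear : ∀ s ∈ Set.Icc (0 : ℝ) 1,
      ‖1 - ((C s * (Bl s)⁻¹ * R s : unitary (Unitization ℂ A)) : Unitization ℂ A)‖ ≤ η :=
    fun s hs => by
      have h1 := norm_mul_sub_mul_le 1 1 (C s) ((Bl s)⁻¹ * R s)
      rw [← mul_assoc, one_mul] at h1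
      have h2 : ((1 : unitary (Unitization ℂ A)) : Unitization ℂ A) - ((Bl s)⁻¹ * R s :
          unitary (Unitization ℂ A)) = ((Bl s)⁻¹ : unitary (Unitization ℂ A)) *
          ((Bl s : Unitization ℂ A) - R s) := by
        rw [mul_sub, ← Submonoid.coe_mul, ← Submonoid.coe_mul, inv_mul_cancel]
      rw [h2, CStarRing.norm_coe_unitary_mul, norm_sub_rev (Bl s : Unitization ℂ A),
        norm_sub_rev _ (C s : Unitization ℂ A)] at h1
      have h3 := hn₁' s hs
      have h4 := hn₂' s hs
      have h5 : ((1 : unitary (Unitization ℂ A)) : Unitization ℂ A) = 1 := rfl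
      rw [h5] at h1
      linarith
  have hmem : C 1 * (Bl 1)⁻¹ * R 1 ∈ UnitaryZero A :=
    mul_mem (mul_mem (columnProduct_mem J L _ 1) (inv_mem (blockProduct_mem J L _ _ _ _ 1)))
      (rowProduct_mem J h 1)
  obtain ⟨c, hc0, hcε, hc⟩ := hfinal _ ⟨_, hmem⟩ hslope hnear rfl
  obtain ⟨K, hK, hKeq⟩ := exists_blockProduct_eq J L (fun i j => ent (γ i j))
    (fun i j => ent (β i j)) (fun i j => ent (q i j)) (fun i j => ent (r i j)) 1
  have hlenL : L.length = m + 1 := by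
    rw [ht.length_eq, List.length_finRange]
  rw [hlenL, List.length_finRange] at hK
  obtain ⟨v, w, hvw⟩ := hK.exists_eq (Nat.le_add_right (2 * (m + 1) * k) ((m + 1) / 2 * (k - 1)))
  refine ⟨v, w, c, hc0, hcε, ?_⟩
  rw [← hvw, ← hc]
  have hUR : (U : unitary (Unitization ℂ A)) = R 1 := by
    have h1 := congrArg (UnitaryZero A).subtype hU
    rw [map_list_prod, List.map_ofFn, List.ofFn_eq_map] at h1
    refine h1.trans (congrArg List.prod (List.map_congr_left fun j _ => ?_))
    rw [one_smul]
    rfl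
  refine Subtype.ext ?_
  change (U : unitary (Unitization ℂ A)) = K * (C 1 * (Bl 1)⁻¹ * R 1)
  have h1 : Bl 1 = K * C 1 := hKeq
  rw [hUR, h1]
  group
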